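/- **Setting.** Let $d\in\{2,3\}$, let $D\subset\mathbb{R}^d$ be a bounded open set, and let $\lambda,\mu$ be measurable, positive and bounded almost everywhere on $D$. Put $V=H_0^1(D)^d$ and, with $\epsilon(u)=\frac12(\nabla u+\nabla u^T)$, $$a(u,v)=\int_D 2\mu\,\epsilon(u):\epsilon(v)+\lambda\,(\nabla\cdot u)(\nabla\cdot v)\,dx,\qquad \|u\|_a^2=a(u,u),\qquad (f,v)=\int_D f\cdot v\,dx .$$ Let $\overline D=\bigcup_{i=1}^N K_i$ be a coarse partition of mesh size $H$ into compact cells with disjoint interiors (each cell being the closure of its interior and having a null boundary), with vertices $x_1,\dots,x_{N_c}$; each cell has diameter at most $H$, contains a ball of radius $\rho H$ with $\rho>0$, and has at most $N_v$ vertices. (Every single grid of this kind satisfies these conditions for some $\rho$ and $N_v$.) Let $\omega_j$ be the union of the cells containing $x_j$, and let $\chi_1,\dots,\chi_{N_c}\ge 0$ be a Lipschitz partition of unity on $D$ with $\chi_j=0$ on $D$ off $\omega_j$. Put $\tilde\kappa=\sum_{j}(\lambda+2\mu)|\nabla\chi_j|^2$, assumed positive a.e. in $D$, and $$s_i(u,v)=\int_{K_i}\tilde\kappa\,u\cdot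 v\,dx,\qquad s=\sum_i s_i,\qquad \|u\|_s^2=\int_D\tilde\kappa|u|^2\,dx .$$ Let $a_i$ be the form $a$ with the integral over $K_i$, and let $V(K_i)$ be the ($H^1(K_i)$-closed) space of restrictions of elements of $V$ to $K_i$. On each $K_i$ let $\phi_1^i,\dots,\phi_{J_i}^i\in V(K_i)$ be $s_i$-orthonormal eigenfunctions for the $J_i$ smallest eigenvalues (counted with multiplicity, and numbered by the min-max principle) of the problem $a_i(\phi,v)=\lambda\, s_i(\phi,v)$ for all $v\in V(K_i)$. Let $\Lambda$ be the minimum over $i$ of the first discarded eigenvalue (number $J_i+1$), and assume $\Lambda>0$. Extend the $\phi_j^i$ by zero, let $V_{\rm aux}$ be their span, and put $\pi v=\sum_{i,j}s_i(v,\phi_j^i)\phi_j^i$. Let $K_{i,m}$ be the cell $K_i$ extended by $m\ge0$ layers of cells, where one layer adds all cells that meet the region, and let $V_0(K_{i,m})$ be the space $H_0^1(D\cap\operatorname{int}K_{i,m})^d$. Let $\psi_{j,ms}^i$ be the minimizer of $$a(\psi,\psi)+s(\pi\psi-\phi_j^i,\pi\psi-\phi_j^i)$$ over $\psi\in V_0(K_{i,m})$,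 and let $\psi_j^i$ be its minimizer over $\psi\in V$. Let $f\in L^2(D)^d$ with $\tilde\kappa^{-1/2}f\in L^2(D)^d$, and let $u\in V$, $u_{ms}^{\rm off}\in \operatorname{span}\{\psi_{j,ms}^i\}$ and $u_{glo}\in\operatorname{span}\{\psi_j^i\}$ be the Galerkin solutions of $a(\cdot,v)=(f,v)$ (for all $v$ in the respective space). Let $D_*$ be the infimum of the constants $D\ge0$ such that every $w\in V_{\rm aux}$ can be written as $w=\pi v$ with $v\in V$ and $\|v\|_a^2\le D\|w\|_s^2$. **Theorem.** There are a constant $C>0$ and a function $\mathcal D(\Lambda,m)\ge0$, both depending only on $d$, $\rho$ and $N_v$ (and not on the domain, the Lamé coefficients, $H$, the partition of unity, the number of auxiliary functions, $m$ or $f$), such that in every such setting $$\|u-u_{ms}^{\rm off}\|_a\le C\Lambda^{-1/2}\|\tilde\kappa^{-1/2}f\|_{L^2(D)}+C(m+1)^{d/2}E^{1/2}(1+D)^{1/2}\|u_{glo}\|_s ,$$ both for $D=D_*$ and for $D=\mathcal D(\Lambda,m)$, where $$E=(1+\Lambda)(1+\Lambda^{-1})^2\Big(1+\frac{1}{\gamma(1+\Lambda^{-1/2})}\Big)^{1-m},\qquad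 \gamma=\max\big\{2,\sqrt{1+N_v/4}\big\},$$ so that $E$ decays exponentially in $m$, and $\gamma=2$ if no cell has more than $12$ vertices. -/

import Mathlib

open MeasureTheory
open scoped ContDiff

noncomputable section

/-- Euclidean space `ℝ^d`. -/
abbrev Rd (d : ℕ) : Type := EuclideanSpace ℝ (Fin d)

/-- Pairs `(u, ∇u)` in `L²(ℝ^d; ℝ^d) × L²(ℝ^d; ℝ^{d×d})`; the matrix `∇u(x)` is stored as the linear
map `w ↦ ∇u(x) w`. Functions on a subset are extended by zero. -/
abbrev H1Pair (d : ℕ) : Type :=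
  Lp (Rd d) 2 (volume : Measure (Rd d)) × Lp (Rd d →L[ℝ] Rd d) 2 (volume : Measure (Rd d))

/-- `H¹₀(Ω)^d`: the closure of the smooth vector fields with compact support in `Ω` in the `H¹`
norm. The second component of an element is the weak gradient of the first one. -/
def H10 {d : ℕ} (Ω : Set (Rd d)) : Submodule ℝ (H1Pair d) :=
  (Submodule.span ℝ {p : H1Pair d | ∃ φ : Rd d → Rd d,
    ContDiff ℝ ∞ φ ∧ HasCompactSupport φ ∧ tsupport φ ⊆ Ω ∧
    (p.1 : Rd d → Rd d) =ᵐ[volume] φ ∧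
    (p.2 : Rd d → (Rd d →L[ℝ] Rd d)) =ᵐ[volume] fderiv ℝ φ}).topologicalClosure

/-- The `(i, j)` entry `(∂u_i/∂x_j + ∂u_j/∂x_i) / 2` of the strain tensor, from `G = ∇u(x)`. -/
def strain {d : ℕ} (G : Rd d →L[ℝ] Rd d) (i j : Fin d) : ℝ :=
  (G (EuclideanSpace.single j 1) i + G (EuclideanSpace.single i 1) j) / 2

/-- The divergence `∑ ∂u_i/∂x_i`, from `G = ∇u(x)`. -/
def divg {d : ℕ} (G : Rd d →L[ℝ] Rd d) : ℝ :=
  ∑ i, G (EuclideanSpace.single i 1) i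

/-- The elasticity problem, the coarse grid and the partition of unity.

The coarse grid consists of finitely many cells, each of which is a compact set that is the closure
of its interior and has a null boundary; the interiors are disjoint and the cells cover the closed
domain. `H` is the mesh size; `ρ` measures how regular the grid is (each cell has diameter at
most `H` and contains a ball of radius `ρ * H`), and no cell has more than `Nv` vertices. Every
single grid has these properties for some `ρ > 0` and `Nv`. -/
structure ElasticSetup (d : ℕ) (ρ : ℝ) (Nv : ℕ) where
  /-- the elastic body -/
  dom : Set (Rd d)
  dom_open : IsOpen dom
  dom_bounded : Bornology.IsBounded dom
  /-- the Lamé coefficient `λ` -/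
  lam : Rd d → ℝ
  /-- the Lamé coefficient `μ` -/
  mu : Rd d → ℝ
  lam_meas : Measurable lam
  mu_meas : Measurable mu
  lame_pos : ∀ᵐ x ∂(volume.restrict dom), 0 < lam x ∧ 0 < mu x
  lame_bdd : ∃ M : ℝ, ∀ᵐ x ∂(volume.restrict dom), lam x ≤ M ∧ mu x ≤ M
  /-- number of coarse cells -/
  N : ℕ
  /-- number of coarse vertices -/
  Nc : ℕ
  /-- the closed coarse cells `K_i` -/
  cell : Fin N → Set (Rd d)
  /-- the coarse vertices `x_j` -/
  vertex : Fin Nc → Rd d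
  cell_compact : ∀ i, IsCompact (cell i)
  cell_regular : ∀ i, closure (interior (cell i)) = cell i
  cell_frontier : ∀ i, volume (frontier (cell i)) = 0
  cell_disjoint : ∀ i j, i ≠ j → Disjoint (interior (cell i)) (interior (cell j))
  cell_cover : (⋃ i, cell i) = closure dom
  /-- the coarse mesh size -/
  H : ℝ
  H_pos : 0 < H
  cell_diam : ∀ i, Metric.diam (cell i) ≤ H
  cell_ball : ∀ i, ∃ c, Metric.ball c (ρ * H) ⊆ cell i
  cell_vertices : ∀ i, {j | vertex j ∈ cell i}.ncard ≤ Nv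
  /-- the partition of unity functions `χ_j`, one for each vertex -/
  chi : Fin Nc → Rd d → ℝ
  chi_lipschitz : ∀ j, ∃ L, LipschitzOnWith L (chi j) dom
  chi_nonneg : ∀ j, ∀ x ∈ dom, 0 ≤ chi j x
  chi_sum : ∀ x ∈ dom, ∑ j, chi j x = 1
  /-- `χ_j` vanishes off `ω_j`, the union of the cells that contain `x_j` -/
  chi_support : ∀ j, ∀ x ∈ dom, (∀ i, vertex j ∈ cell i → x ∉ cell i) → chi j x = 0
  /-- the weight `κ̃` is positive almost everywhere -/
  weight_pos : ∀ᵐ x ∂(volume.restrict dom),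
    0 < ∑ j, (lam x + 2 * mu x) * ‖fderiv ℝ (chi j) x‖ ^ 2

namespace ElasticSetup

variable {d : ℕ} {ρ : ℝ} {Nv : ℕ} (S : ElasticSetup d ρ Nv)

/-- `κ̃ = ∑_j (λ + 2μ) |∇χ_j|²`. -/
def kappa (x : Rd d) : ℝ :=
  ∑ j, (S.lam x + 2 * S.mu x) * ‖fderiv ℝ (S.chi j) x‖ ^ 2

/-- `∫_K 2μ ε(u) : ε(v) + λ (∇·u) (∇·v)`. -/
def aOn (K : Set (Rd d)) (u v : H1Pair d) : ℝ :=
  ∫ x in K, (2 * S.mu x * (∑ i, ∑ j, strain (u.2 x) i j * strain (v.2 x) i j)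
    + S.lam x * divg (u.2 x) * divg (v.2 x))

/-- `a(u, v)`. -/
def a (u v : H1Pair d) : ℝ := S.aOn S.dom u v

/-- `‖u‖_a`. -/
def aNorm (u : H1Pair d) : ℝ := √(S.a u u)

/-- `s_i(g, h) = ∫_{K_i} κ̃ g · h`. -/
def sLoc (i : Fin S.N) (g h : Rd d → Rd d) : ℝ :=
  ∫ x in S.cell i, S.kappa x * inner ℝ (g x) (h x)

/-- `s(g, h) = ∑_i s_i(g, h)`. -/
def s (g h : Rd d → Rd d) : ℝ := ∑ i, S.sLoc i g h

/-- `‖g‖_s`, where `‖g‖_s² = ∫_D κ̃ |g|²`. -/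
def sNorm (g : Rd d → Rd d) : ℝ := √(∫ x in S.dom, S.kappa x * ‖g x‖ ^ 2)

/-- `(f, v) = ∫_D f · v`. -/
def load (f : Rd d → Rd d) (v : H1Pair d) : ℝ := ∫ x in S.dom, inner ℝ (f x) (v.1 x)

/-- `‖κ̃^{-1/2} f‖_{L²(D)}`. -/
def loadNorm (f : Rd d → Rd d) : ℝ := √(∫ x in S.dom, ‖f x‖ ^ 2 / S.kappa x)

/-- `V = H¹₀(D)^d`. -/
def V : Submodule ℝ (H1Pair d) := H10 S.dom

/-- `V(K_i)`: the (closed) space of the restrictions to `K_i` of the elements of `V`, extended by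
zero off `K_i`. The closure, in the `H¹(K_i)` norm, adds nothing if the restrictions form a closed
space, and makes the local spectral problem a problem in a Hilbert space in general. -/
def VLoc (i : Fin S.N) : Submodule ℝ (H1Pair d) :=
  (Submodule.span ℝ {p : H1Pair d | ∃ v ∈ S.V,
    (p.1 : Rd d → Rd d) =ᵐ[volume] (S.cell i).indicator (v.1 : Rd d → Rd d) ∧
    (p.2 : Rd d → (Rd d →L[ℝ] Rd d)) =ᵐ[volume]
      (S.cell i).indicator (v.2 : Rd d → (Rd d →L[ℝ] Rd d))}).topologicalClosure

/-- The eigenvalue number `k` (`k = 0, 1, …`, in increasing order and counted with multiplicity) of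
the spectral problem `a_i(φ, v) = λ s_i(φ, v)` for all `v ∈ V(K_i)`: the minimum over the
`(k+1)`-dimensional subspaces of `V(K_i)` of the maximum of the Rayleigh quotient `a_i / s_i`. -/
def eigval (i : Fin S.N) (k : ℕ) : ℝ :=
  sInf {r : ℝ | ∃ W : Submodule ℝ (H1Pair d), W ≤ S.VLoc i ∧ Module.finrank ℝ W = k + 1 ∧
    (∀ w ∈ W, w ≠ 0 → 0 < S.sLoc i w.1 w.1) ∧
    ∀ w ∈ W, S.aOn (S.cell i) w w ≤ r * S.sLoc i w.1 w.1}

/-- The oversampled region `K_{i,m}`: the cell `K_i` extended by `m` layers of coarse cells. -/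
def patch (i : Fin S.N) : ℕ → Set (Rd d)
  | 0 => S.cell i
  | m + 1 => ⋃ j ∈ {j : Fin S.N | (S.cell j ∩ patch i m).Nonempty}, S.cell j

/-- `V₀(K_{i,m}) = H¹₀(K_{i,m})^d`. -/
def VPatch (i : Fin S.N) (m : ℕ) : Submodule ℝ (H1Pair d) :=
  H10 (S.dom ∩ interior (S.patch i m))

/-- `u` is the Galerkin solution in the space `X`: `u ∈ X` and `a(u, v) = (f, v)` for all
`v ∈ X`. -/
def IsGalerkin (f : Rd d → Rd d) (X : Submodule ℝ (H1Pair d)) (u : H1Pair d) : Prop :=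
  u ∈ X ∧ ∀ v ∈ X, S.a u v = S.load f v

/-- The local auxiliary eigenfunctions: for each cell `K_i`, `s_i`-orthonormal eigenfunctions
`φ_1^i, …, φ_{J_i}^i` that belong to the first `J_i` eigenvalues. -/
structure AuxBasis where
  /-- the number of eigenfunctions on `K_i` -/
  J : Fin S.N → ℕ
  /-- the eigenfunctions -/
  phi : (i : Fin S.N) → Fin (J i) → H1Pair d
  phi_mem : ∀ i j, phi i j ∈ S.VLoc i
  phi_eigen : ∀ i j, ∀ v ∈ S.VLoc i,
    S.aOn (S.cell i) (phi i j) v = S.eigval i j * S.sLoc i (phi i j).1 v.1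
  phi_orthonormal : ∀ i j k, S.sLoc i (phi i j).1 (phi i k).1 = if j = k then 1 else 0

namespace AuxBasis

variable {S} (B : S.AuxBasis)

/-- `Λ`: the minimum over the cells of the first discarded eigenvalue. -/
def Lam : ℝ := ⨅ i, S.eigval i (B.J i)

/-- The eigenfunction `φ_j^i` as a function on `ℝ^d` (zero off `K_i`). -/
def fn (i : Fin S.N) (j : Fin (B.J i)) : Rd d → Rd d := ((B.phi i j).1 : Rd d → Rd d)

/-- The auxiliary space, the sum of the local auxiliary spaces `span {φ_j^i | j ≤ J_i}`. -/
def auxSpace : Submodule ℝ (Rd d → Rd d) :=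
  ⨆ i, Submodule.span ℝ (Set.range (B.fn i))

/-- `π(v) = ∑_i ∑_j s_i(v, φ_j^i) φ_j^i`. -/
def proj (v : H1Pair d) : Rd d → Rd d :=
  ∑ i, ∑ j, S.sLoc i v.1 (B.fn i j) • B.fn i j

/-- The relaxed energy `a(ψ, ψ) + s(πψ - φ_j^i, πψ - φ_j^i)`. -/
def energy (i : Fin S.N) (j : Fin (B.J i)) (ψ : H1Pair d) : ℝ :=
  S.a ψ ψ + S.s (B.proj ψ - B.fn i j) (B.proj ψ - B.fn i j)

/-- `ψ_j^i`, for all `i` and `j`, is the minimizer of the relaxed energy over `X i`. -/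
def IsRelaxedBasis (X : Fin S.N → Submodule ℝ (H1Pair d))
    (ψ : (i : Fin S.N) → Fin (B.J i) → H1Pair d) : Prop :=
  ∀ i j, ψ i j ∈ X i ∧ IsMinOn (B.energy i j) (X i : Set (H1Pair d)) (ψ i j)

/-- The span of all functions of a family `ψ_j^i`. -/
def spanAll (ψ : (i : Fin S.N) → Fin (B.J i) → H1Pair d) : Submodule ℝ (H1Pair d) :=
  Submodule.span ℝ {p | ∃ i j, p = ψ i j}

/-- The smallest constant `D` such that every `w ∈ V_aux` is `w = π(v)` for functions `v ∈ V`
of energy at most (or arbitrarily close to) `D ‖w‖_s²`. -/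
def stab : ℝ :=
  sInf {D : ℝ | 0 ≤ D ∧ ∀ w ∈ B.auxSpace, ∃ v ∈ S.V, B.proj v = w ∧ S.a v v ≤ D * S.s w w}

end AuxBasis

end ElasticSetup

/-- The factor
`E = (1 + Λ) (1 + Λ⁻¹)² (1 + (γ (1 + Λ^{-1/2}))⁻¹)^{1-m}` with `γ = max (2, √(1 + Nv/4))`; it
decays exponentially in the number `m` of layers. One has `γ = 2` as long as no cell has more than
`12` vertices. -/
def decayE (Nv : ℕ) (Λ : ℝ) (m : ℕ) : ℝ :=
  (1 + Λ) * (1 + Λ⁻¹) ^ 2 *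
    (1 + (max 2 (√(1 + (Nv : ℝ) / 4)) * (1 + Λ ^ (-(1 / 2) : ℝ)))⁻¹) ^ (1 - (m : ℤ))

end

/-! Identify π v with its coefficient vector `coef v`. Minimality of ψ_j^i means b(ψ_j^i, v) =
s_i(v, φ_j^i) for the form b = a + ⟨coef ·, coef ·⟩, so the combination R c of global basis
functions with coefficients c solves b(R c, v) = ⟨c, coef v⟩ on V. The operator T = coef ∘ R on the
finite-dimensional coefficient space is symmetric, and a(R c, R c) = ⟨c - T c, T c⟩. Everything
about the global space is read off from T.

Global error: u - u_glo is a-orthogonal to the range of R, which forces its coefficients to vanish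
up to a function of zero energy. By the min-max principle, functions with vanishing coefficients
satisfy ‖v‖_s² ≤ Λ⁻¹ ‖v‖_a² (`spectral_estimate`), and weighted Cauchy–Schwarz gives the Λ^{-1/2}
term (`global_error`).

Localization: b is a sum of forms on cells, and the right-hand side of the i-th problem lives on
K_i. Testing with the solution times a cutoff that vanishes on a patch shows that one layer reduces
the outer energy by the factor (1 + 1/Q)⁻¹ (`tail_step`). Here Q² ≥ (1 + Nv/4)(1 + Λ⁻¹) is enough;
the number Nv/4 appears because the gradients of the partition of unity sum to zero
(`norm_partial_sum_sq_le`). The errors of different cells interact only through overlapping patches,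
whose number grows like (m + 1)^d by a volume count (`sum_error`, `overlap_le`).

Coefficients: the localization error is proportional to a norm of coefficients, whereas ‖u_glo‖_s
only controls T w for u_glo = R w. If D_* is small, T is bounded below by 1/(1 + D_*)
(`norm_le_of_stable`). Independently of D_*, one can split w along the eigenvectors of T at the
threshold 1/(1 + Λ): the upper part g is bounded by (1 + Λ)‖T w‖, while the lower part has energy at
most 2 Λ⁻¹ ‖κ̃^{-1/2} f‖² and joins the first error term (`exists_low_part`). Hence 𝒟(Λ, m) = Λ is
admissible, and for D_* the better of the two arguments is used. Céa's lemma compares u_ms with the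
localized combination with coefficients g. -/

noncomputable section

/-! ### Positive semidefinite bilinear forms -/

section PsdForms

variable {X : Type*} [AddCommGroup X] [Module ℝ X]

/-- Symmetric positive semidefinite bilinear forms. -/
structure IsPsd (b : LinearMap.BilinForm ℝ X) : Prop where
  symm : ∀ x y, b x y = b y x
  nonneg : ∀ x, 0 ≤ b x x

namespace IsPsd

variable {b : LinearMap.BilinForm ℝ X}

theorem sum {ι : Type*} {s : Finset ι} {b : ι → LinearMap.BilinForm ℝ X}
    (h : ∀ i ∈ s, IsPsd (b i)) : IsPsd (∑ i ∈ s, b i) where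
  symm x y := by
    simp only [LinearMap.sum_apply]
    exact Finset.sum_congr rfl fun i hi => (h i hi).symm x y
  nonneg x := by
    simp only [LinearMap.sum_apply]
    exact Finset.sum_nonneg fun i hi => (h i hi).nonneg x

theorem expand_add (hb : IsPsd b) (x y : X) :
    b (x + y) (x + y) = b x x + 2 * b x y + b y y := by
  simp only [map_add, LinearMap.add_apply, hb.symm y x]; ring

theorem expand_sub (hb : IsPsd b) (x y : X) :
    b (x - y) (x - y) = b x x - 2 * b x y + b y y := by
  simp only [map_sub, LinearMap.sub_apply, hb.symm y x]; ring

theorem sub_le (hb : IsPsd b) (x y : X) : b (x - y) (x - y) ≤ 2 * (b x x + b y y) := by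
  have h := hb.nonneg (x + y)
  rw [hb.expand_add] at h
  rw [hb.expand_sub]; linarith

theorem young (hb : IsPsd b) (x y : X) {t : ℝ} (ht : 0 < t) :
    b x y ≤ t / 2 * b x x + 1 / (2 * t) * b y y := by
  have h := hb.nonneg (t • x - y)
  rw [hb.expand_sub] at h
  simp only [map_smul, LinearMap.smul_apply, smul_eq_mul] at h
  have : t / 2 * b x x + 1 / (2 * t) * b y y - b x y =
      (t * (t * b x x) - 2 * (t * b x y) + b y y) / (2 * t) := by field_simp; ring
  have h2 := div_nonneg h (by positivity : 0 ≤ 2 * t)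
  linarith

theorem cauchy_sq (hb : IsPsd b) (x y : X) : b x y ^ 2 ≤ b x x * b y y :=
  LinearMap.BilinForm.apply_sq_le_of_symm b hb.nonneg ⟨fun x y => by simpa using hb.symm x y⟩ x y

theorem cauchy (hb : IsPsd b) (x y : X) : b x y ≤ √(b x x) * √(b y y) := by
  rw [← Real.sqrt_mul (hb.nonneg x)]
  exact Real.le_sqrt_of_sq_le (hb.cauchy_sq x y)

theorem eq_zero_left (hb : IsPsd b) {x : X} (hx : b x x = 0) (y : X) : b x y = 0 := by
  have := hb.cauchy_sq x y
  rw [hx, zero_mul] at this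
  exact pow_eq_zero_iff two_ne_zero |>.1 (le_antisymm this (sq_nonneg _))

theorem eq_zero_right (hb : IsPsd b) {y : X} (hy : b y y = 0) (x : X) : b x y = 0 := by
  rw [hb.symm]; exact hb.eq_zero_left hy x

theorem sqrt_add_le (hb : IsPsd b) (x y : X) :
    √(b (x + y) (x + y)) ≤ √(b x x) + √(b y y) := by
  rw [Real.sqrt_le_left (by positivity), hb.expand_add]
  have := hb.cauchy x y
  nlinarith [Real.sq_sqrt (hb.nonneg x), Real.sq_sqrt (hb.nonneg y)]

/-- Minimizers of a quadratic functional satisfy the variational equation. -/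
theorem euler_lagrange (hb : IsPsd b) {Y : Submodule ℝ X} {l : X →ₗ[ℝ] ℝ} {x : X} (hx : x ∈ Y)
    (hmin : ∀ y ∈ Y, b x x - 2 * l x ≤ b y y - 2 * l y) {v : X} (hv : v ∈ Y) : b x v = l v := by
  have key : ∀ t : ℝ, 0 ≤ 2 * t * (b x v - l v) + t ^ 2 * b v v := by
    intro t
    have h := hmin (x + t • v) (Y.add_mem hx (Y.smul_mem t hv))
    rw [hb.expand_add] at h
    simp only [map_add, map_smul, LinearMap.smul_apply, smul_eq_mul] at h
    linarith
  have h0 := hb.nonneg v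
  set c := b v v
  set e := b x v - l v with he
  -- The optimal step would be -e / c; the denominator c + 1 also covers directions of zero energy.
  have h1 := key (-e / (c + 1))
  have : 2 * (-e / (c + 1)) * e + (-e / (c + 1)) ^ 2 * c = -(e ^ 2 * (c + 2) / (c + 1) ^ 2) := by
    field_simp; ring
  rw [this] at h1
  have h2 : e ^ 2 * (c + 2) / (c + 1) ^ 2 ≤ 0 := by linarith
  have h3 : e ^ 2 * (c + 2) ≤ 0 := by
    by_contra! h
    have : 0 < e ^ 2 * (c + 2) / (c + 1) ^ 2 := by positivity
    linarith
  have h4 : e ^ 2 = 0 := by nlinarith [sq_nonneg e]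
  have := pow_eq_zero_iff two_ne_zero |>.1 h4
  linarith

/-- A Galerkin projection is a best approximation. -/
theorem best_approx (hb : IsPsd b) {u p y : X} (h : b (u - p) (p - y) = 0) :
    b (u - p) (u - p) ≤ b (u - y) (u - y) := by
  have e : u - y = (u - p) + (p - y) := by abel
  rw [e, hb.expand_add, h]
  have := hb.nonneg (p - y)
  linarith

end IsPsd

end PsdForms

/-! ### Exponential decay and localization for a sum of cell forms -/

section Decay

variable {X : Type*} [AddCommGroup X] [Module ℝ X] {ι : Type*} [Fintype ι]
  {b : ι → LinearMap.BilinForm ℝ X} {V : Submodule ℝ X}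

open Classical in
/-- The energy of `x` on the cells outside `P`. -/
def tail (b : ι → LinearMap.BilinForm ℝ X) (P : Set ι) (x : X) : ℝ :=
  ∑ k, if k ∈ P then 0 else b k x x

theorem tail_le_sum (hb : ∀ k, IsPsd (b k)) (P : Set ι) (x : X) :
    tail b P x ≤ ∑ k, b k x x := by
  refine Finset.sum_le_sum fun k _ => ?_
  split_ifs
  exacts [(hb k).nonneg x, le_rfl]

/-- One layer of cells reduces the energy of a solution with data in the interior. -/
theorem tail_step (hb : ∀ k, IsPsd (b k)) {Q : ℝ} (hQ : 0 < Q) {P P' : Set ι} (hP : P ⊆ P')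
    {x y : X} (hxy : ∑ k, b k x y = 0)
    (hy0 : ∀ k ∈ P, b k y y = 0) (hy1 : ∀ k ∉ P', b k (x - y) (x - y) = 0)
    (hcut : ∀ k, -(Q * b k x x) ≤ b k x y) :
    tail b P' x ≤ (1 + Q⁻¹)⁻¹ * tail b P x := by
  classical
  -- On the cells in P the test element is null, and outside P' it agrees with x; only the layer P'
  -- \ P costs Q times the energy. Summation then gives (1 + Q) tail(P') ≤ Q tail(P).
  have key : ∀ k, (1 + Q) * (if k ∈ P' then 0 else b k x x) -
      Q * (if k ∈ P then 0 else b k x x) ≤ b k x y := by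
    intro k
    by_cases h' : k ∈ P'
    · by_cases h : k ∈ P
      · simp [h, h', (hb k).eq_zero_right (hy0 k h) x]
      · have := hcut k
        simp only [h, h', if_true, if_false]; linarith
    · have h : k ∉ P := fun h => h' (hP h)
      have h2 := (hb k).eq_zero_right (hy1 k h') x
      rw [map_sub] at h2
      simp only [h, h', if_false]; linarith
  have := Finset.sum_le_sum fun k (_ : k ∈ Finset.univ) => key k
  rw [hxy, Finset.sum_sub_distrib, ← Finset.mul_sum, ← Finset.mul_sum] at this
  have h2 : (1 + Q) * tail b P' x ≤ Q * tail b P x := by simp only [tail]; linarith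
  have h3 : (1 + Q⁻¹)⁻¹ = Q / (1 + Q) := by field_simp; ring
  rw [h3, div_mul_eq_mul_div, le_div_iff₀ (by positivity)]
  linarith

theorem tail_decay (hb : ∀ k, IsPsd (b k)) {Q : ℝ} (hQ : 0 < Q) {P : ℕ → Set ι}
    (hP : ∀ n, P n ⊆ P (n + 1)) {x : X}
    (hcut : ∀ n, ∃ y, ∑ k, b k x y = 0 ∧ (∀ k ∈ P n, b k y y = 0) ∧
      (∀ k ∉ P (n + 1), b k (x - y) (x - y) = 0) ∧ ∀ k, -(Q * b k x x) ≤ b k x y) (n : ℕ) :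
    tail b (P n) x ≤ (1 + Q⁻¹)⁻¹ ^ n * ∑ k, b k x x := by
  induction n with
  | zero => simpa using tail_le_sum hb (P 0) x
  | succ n ih =>
    obtain ⟨y, h1, h2, h3, h4⟩ := hcut n
    refine (tail_step hb hQ (hP n) h1 h2 h3 h4).trans ?_
    rw [pow_succ', mul_assoc]
    exact mul_le_mul_of_nonneg_left ih (by positivity)

/-- The data of an overlapping localization: for each cell `i` the patches `P i n` of cells, the
local spaces `Vp i n`, and cutoff operations with constants `Q` and `C₁`. -/
structure PatchSystem (b : ι → LinearMap.BilinForm ℝ X) (V : Submodule ℝ X)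
    (P : ι → ℕ → Set ι) (Vp : ι → ℕ → Submodule ℝ X) (Q C₁ : ℝ) : Prop where
  psd : ∀ k, IsPsd (b k)
  Q_pos : 0 < Q
  C_pos : 0 < C₁
  self_mem : ∀ i, i ∈ P i 0
  mono : ∀ i n, P i n ⊆ P i (n + 1)
  Vp_le : ∀ i n, Vp i n ≤ V
  Vp_supp : ∀ i n, ∀ v ∈ Vp i n, ∀ k ∉ P i n, b k v v = 0
  cut_out : ∀ i n, ∀ v ∈ V, ∃ y ∈ V, (∀ k ∈ P i n, b k y y = 0) ∧
    (∀ k ∉ P i (n + 1), b k (v - y) (v - y) = 0) ∧ ∀ k, -(Q * b k v v) ≤ b k v y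
  cut_in : ∀ i n, ∀ v ∈ V, ∃ y ∈ Vp i (n + 1), (∀ k ∈ P i n, b k (v - y) (v - y) = 0) ∧
    ∀ k, b k y y ≤ C₁ * b k v v

namespace PatchSystem

variable {P : ι → ℕ → Set ι} {Vp : ι → ℕ → Submodule ℝ X} {Q C₁ : ℝ}

theorem self_mem' (h : PatchSystem b V P Vp Q C₁) (i : ι) (n : ℕ) : i ∈ P i n := by
  induction n with
  | zero => exact h.self_mem i
  | succ n ih => exact h.mono i n ih

/-- Since z is the best approximation of x in the local space, it can be replaced by a cutoff of x,
and the error then only sees the energy of x outside the patch with one layer less. This lost layer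
is the reason for the exponent 1 - m. -/
theorem local_error (h : PatchSystem b V P Vp Q C₁) (i : ι) (m : ℕ) {l : X →ₗ[ℝ] ℝ}
    (hl : ∀ v, b i v v = 0 → l v = 0) {x z : X} (hx : x ∈ V) (hz : z ∈ Vp i m)
    (hxe : ∀ v ∈ V, ∑ k, b k x v = l v) (hze : ∀ v ∈ Vp i m, ∑ k, b k z v = l v) :
    ∑ k, b k (x - z) (x - z) ≤
      2 * (1 + C₁) * (1 + Q⁻¹) ^ (1 - (m : ℤ)) * ∑ k, b k x x := by
  have hQ := h.Q_pos
  have hC := h.C_pos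
  have hB : IsPsd (∑ k, b k) := IsPsd.sum fun k _ => h.psd k
  have hBa : ∀ x y, (∑ k, b k) x y = ∑ k, b k x y := fun x y => by simp [LinearMap.sum_apply]
  have hbest : ∀ y ∈ Vp i m, ∑ k, b k (x - z) (x - z) ≤ ∑ k, b k (x - y) (x - y) := by
    intro y hy
    rw [← hBa, ← hBa]
    refine hB.best_approx ?_
    have hm := (Vp i m).sub_mem hz hy
    rw [LinearMap.map_sub₂, hBa, hBa, hxe _ (h.Vp_le i m hm), hze _ hm, sub_self]
  have hsum0 : 0 ≤ ∑ k, b k x x := Finset.sum_nonneg fun k _ => (h.psd k).nonneg x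
  -- For m = 0 there is no room for a cutoff; the competitor 0 suffices because the constant is at
  -- least 1.
  rcases m with _ | n
  · have h0 := hbest 0 (Submodule.zero_mem _)
    simp only [sub_zero] at h0
    have : (1 : ℝ) ≤ 2 * (1 + C₁) * (1 + Q⁻¹) ^ (1 - ((0 : ℕ) : ℤ)) := by
      simp only [Nat.cast_zero, sub_zero, zpow_one]
      have : 0 < Q⁻¹ := by positivity
      nlinarith
    exact h0.trans (le_mul_of_one_le_left hsum0 this)
  · obtain ⟨y, hy, hy0, hyC⟩ := h.cut_in i n x hx
    have h1 := hbest y hy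
    have h2 : ∑ k, b k (x - y) (x - y) ≤ 2 * (1 + C₁) * tail b (P i n) x := by
      classical
      rw [tail, Finset.mul_sum]
      refine Finset.sum_le_sum fun k _ => ?_
      by_cases hk : k ∈ P i n
      · rw [hy0 k hk]; simp [hk]
      · simp only [hk, if_false]
        have := (h.psd k).sub_le x y
        have := hyC k
        linarith
    have h3 : tail b (P i n) x ≤ (1 + Q⁻¹)⁻¹ ^ n * ∑ k, b k x x := by
      refine tail_decay h.psd hQ (h.mono i) (fun n => ?_) n
      obtain ⟨y, hyV, a1, a2, a3⟩ := h.cut_out i n x hx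
      -- The load sits on cell i, which belongs to every patch P i n, so it does not see the outer
      -- cutoff.
      exact ⟨y, by rw [hxe y hyV, hl y (a1 i (h.self_mem' i n))], a1, a2, a3⟩
    have h4 : (1 + Q⁻¹) ^ (1 - ((n + 1 : ℕ) : ℤ)) = (1 + Q⁻¹)⁻¹ ^ n := by
      rw [inv_pow, ← zpow_natCast, ← zpow_neg]; congr 1; push_cast; ring
    rw [h4]
    calc _ ≤ _ := h1
      _ ≤ _ := h2
      _ ≤ 2 * (1 + C₁) * ((1 + Q⁻¹)⁻¹ ^ n * ∑ k, b k x x) :=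
        mul_le_mul_of_nonneg_left h3 (by positivity)
      _ = _ := by ring

/-- The error of cell i is orthogonal to every function of V that vanishes on its patch, so it meets
the total error only through a cutoff to the patch with one more layer. The finite overlap of these
patches replaces a factor that would grow with the number of cells. -/
theorem sum_error (h : PatchSystem b V P Vp Q C₁) (m : ℕ) {n₀ : ℝ} (hn : 0 < n₀)
    (hov : ∀ k, ({i | k ∈ P i (m + 1)}.ncard : ℝ) ≤ n₀) {l : ι → X →ₗ[ℝ] ℝ}
    (hl : ∀ i v, b i v v = 0 → l i v = 0) {x z : ι → X} (hx : ∀ i, x i ∈ V)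
    (hz : ∀ i, z i ∈ Vp i m) (hxe : ∀ i, ∀ v ∈ V, ∑ k, b k (x i) v = l i v) :
    ∑ k, b k (∑ i, (x i - z i)) (∑ i, (x i - z i)) ≤
      C₁ * n₀ * ∑ i, ∑ k, b k (x i - z i) (x i - z i) := by
  classical
  have hC := h.C_pos
  have hB : IsPsd (∑ k, b k) := IsPsd.sum fun k _ => h.psd k
  have hBa : ∀ x y, (∑ k, b k) x y = ∑ k, b k x y := fun x y => by simp [LinearMap.sum_apply]
  set E := ∑ i, (x i - z i) with hE
  have hEV : E ∈ V := V.sum_mem fun i _ => V.sub_mem (hx i) (h.Vp_le i m (hz i))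
  choose y hyV hy0 hyC using fun i => h.cut_in i m E hEV
  -- Tested with E - y i, the equation of x i has no load, and z i lives on the patch where E - y i
  -- is null.
  have horth : ∀ i, (∑ k, b k) (x i - z i) E = (∑ k, b k) (x i - z i) (y i) := by
    intro i
    have hd : E - y i ∈ V := V.sub_mem hEV (h.Vp_le i _ (hyV i))
    have : (∑ k, b k) (x i - z i) (E - y i) = 0 := by
      rw [LinearMap.map_sub₂, hBa, hBa, hxe i _ hd,
        hl i _ (hy0 i i (h.self_mem' i m)), zero_sub, neg_eq_zero]
      refine Finset.sum_eq_zero fun k _ => ?_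
      by_cases hk : k ∈ P i m
      · exact (h.psd k).eq_zero_right (hy0 i k hk) _
      · exact (h.psd k).eq_zero_left (h.Vp_supp i m _ (hz i) k hk) _
    rw [map_sub] at this
    linarith
  -- With the Young parameter C₁ n₀ the cutoff terms add up to at most half of the energy of E,
  -- which is absorbed.
  have hτ : 0 < C₁ * n₀ := by positivity
  have h1 : ∀ i, (∑ k, b k) (x i - z i) E ≤ C₁ * n₀ / 2 * (∑ k, b k (x i - z i) (x i - z i)) +
      1 / (2 * (C₁ * n₀)) * ∑ k, if k ∈ P i (m + 1) then C₁ * b k E E else 0 := by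
    intro i
    rw [horth i]
    refine (hB.young _ _ hτ).trans ?_
    rw [hBa, hBa]
    gcongr with k
    by_cases hk : k ∈ P i (m + 1)
    · simp only [hk, if_true]; exact hyC i k
    · simp only [hk, if_false]; exact (h.Vp_supp i _ _ (hyV i) k hk).le
  have h2 : ∑ i, ∑ k, (if k ∈ P i (m + 1) then C₁ * b k E E else 0) ≤
      C₁ * n₀ * ∑ k, b k E E := by
    rw [Finset.sum_comm, Finset.mul_sum]
    refine Finset.sum_le_sum fun k _ => ?_
    rw [← Finset.sum_filter, Finset.sum_const, nsmul_eq_mul]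
    have := hov k
    rw [Set.ncard_eq_toFinset_card', Set.toFinset_ofPred] at this
    have h0 := mul_nonneg hC.le ((h.psd k).nonneg E)
    nlinarith
  have h3 : (∑ k, b k) E E = ∑ i, (∑ k, b k) (x i - z i) E := by
    have := congrArg (fun y => (∑ k, b k) y E) hE
    simpa only [LinearMap.map_sum₂] using this
  have h4 := Finset.sum_le_sum fun i (_ : i ∈ Finset.univ) => h1 i
  rw [← h3, Finset.sum_add_distrib, ← Finset.mul_sum, ← Finset.mul_sum, hBa] at h4
  have h5 := mul_le_mul_of_nonneg_left h2 (by positivity : 0 ≤ 1 / (2 * (C₁ * n₀)))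
  have h6 : 1 / (2 * (C₁ * n₀)) * (C₁ * n₀ * ∑ k, b k E E) = (∑ k, b k E E) / 2 := by
    field_simp
  rw [h6] at h5
  linarith

/-- The total localization error. -/
theorem total_error (h : PatchSystem b V P Vp Q C₁) (m : ℕ) {n₀ : ℝ} (hn : 0 < n₀)
    (hov : ∀ k, ({i | k ∈ P i (m + 1)}.ncard : ℝ) ≤ n₀) {l : ι → X →ₗ[ℝ] ℝ} {W : ι → ℝ}
    (hW0 : ∀ i, 0 ≤ W i)
    (hl : ∀ i v, l i v ^ 2 ≤ W i * b i v v) {x z : ι → X} (hx : ∀ i, x i ∈ V)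
    (hz : ∀ i, z i ∈ Vp i m) (hxe : ∀ i, ∀ v ∈ V, ∑ k, b k (x i) v = l i v)
    (hze : ∀ i, ∀ v ∈ Vp i m, ∑ k, b k (z i) v = l i v) :
    ∑ k, b k (∑ i, (x i - z i)) (∑ i, (x i - z i)) ≤
      C₁ * n₀ * (2 * (1 + C₁) * (1 + Q⁻¹) ^ (1 - (m : ℤ))) * ∑ i, W i := by
  have hC := h.C_pos
  have hQ := h.Q_pos
  have hl0 : ∀ i v, b i v v = 0 → l i v = 0 := by
    intro i v hv
    have := hl i v
    rw [hv, mul_zero] at this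
    exact pow_eq_zero_iff two_ne_zero |>.1 (le_antisymm this (sq_nonneg _))
  -- Testing the equation with x i itself: the energy A satisfies A² = l(x i)² ≤ W i * A.
  have hW : ∀ i, ∑ k, b k (x i) (x i) ≤ W i := by
    intro i
    have h1 := hl i (x i)
    rw [← hxe i _ (hx i)] at h1
    set A := ∑ k, b k (x i) (x i) with hA
    have hAi : b i (x i) (x i) ≤ A :=
      Finset.single_le_sum (f := fun k => b k (x i) (x i))
        (fun k _ => (h.psd k).nonneg _) (Finset.mem_univ i)
    have h0 := (h.psd i).nonneg (x i)
    by_contra! hlt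
    have := hW0 i
    nlinarith
  refine (h.sum_error m hn hov hl0 hx hz hxe).trans ?_
  rw [mul_assoc (C₁ * n₀), Finset.mul_sum (a := 2 * (1 + C₁) * (1 + Q⁻¹) ^ (1 - (m : ℤ)))]
  refine mul_le_mul_of_nonneg_left (Finset.sum_le_sum fun i _ => ?_) (by positivity)
  refine (h.local_error i m (hl0 i) (hx i) (hz i) (hxe i) (hze i)).trans ?_
  exact mul_le_mul_of_nonneg_left (hW i) (by positivity)

end PatchSystem

end Decay

/-! ### The relaxed solution operator and its spectrum -/

section Relaxed

variable {X : Type*} [AddCommGroup X] [Module ℝ X] {κ : Type*} [Fintype κ]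

/-- The solution operator `R` of the relaxed problems: `R c ∈ V` has
`a(R c, v) + ⟨coef (R c), coef v⟩ = ⟨c, coef v⟩` for all `v ∈ V`. -/
structure RelaxedSolver (a : LinearMap.BilinForm ℝ X) (V : Submodule ℝ X)
    (coef : X →ₗ[ℝ] EuclideanSpace ℝ κ) (R : EuclideanSpace ℝ κ →ₗ[ℝ] X) : Prop where
  psd : IsPsd a
  mem : ∀ c, R c ∈ V
  eq : ∀ c, ∀ v ∈ V, a (R c) v + inner ℝ (coef (R c)) (coef v) = inner ℝ c (coef v)

namespace RelaxedSolver

variable {a : LinearMap.BilinForm ℝ X} {V : Submodule ℝ X}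
  {coef : X →ₗ[ℝ] EuclideanSpace ℝ κ} {R : EuclideanSpace ℝ κ →ₗ[ℝ] X}

theorem energy_eq (h : RelaxedSolver a V coef R) (c c' : EuclideanSpace ℝ κ) :
    a (R c) (R c') = inner ℝ (c - coef (R c)) (coef (R c')) := by
  rw [inner_sub_left]
  linarith [h.eq c _ (h.mem c')]

/-- Testing the equation of each of two solutions with the other one: the left-hand side is a
symmetric form. This makes the spectral theorem available. -/
theorem isSymmetric (h : RelaxedSolver a V coef R) : (coef ∘ₗ R).IsSymmetric := by
  intro c c'
  have h1 := h.eq c _ (h.mem c')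
  have h2 := h.eq c' _ (h.mem c)
  rw [h.psd.symm] at h2
  simp only [LinearMap.comp_apply]
  have h3 := real_inner_comm (coef (R c)) c'
  have h4 := real_inner_comm (coef (R c)) (coef (R c'))
  linarith

/-- If every coefficient vector is the image of a function of comparable energy, then the solution
operator is bounded from below. -/
theorem norm_le_of_stable (h : RelaxedSolver a V coef R) {D : ℝ} (hD : 0 ≤ D)
    {w : EuclideanSpace ℝ κ} {v : X} (hv : v ∈ V) (hvw : coef v = w) (hva : a v v ≤ D * ‖w‖ ^ 2) :
    ‖w‖ ≤ (1 + D) * ‖coef (R w)‖ := by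
  set A := √(a (R w) (R w)) with hA
  set P := ‖coef (R w)‖ with hP
  have hA0 : 0 ≤ A := Real.sqrt_nonneg _
  have hA2 : A ^ 2 = a (R w) (R w) := Real.sq_sqrt (h.psd.nonneg _)
  -- The equation of R w is tested with the preimage v of w.
  have h1 : ‖w‖ ^ 2 ≤ A * (√D * ‖w‖) + P * ‖w‖ := by
    rw [← real_inner_self_eq_norm_sq]
    nth_rewrite 2 [← hvw]
    rw [← h.eq w v hv, hvw]
    refine add_le_add ((h.psd.cauchy _ _).trans ?_) (real_inner_le_norm _ _)
    refine mul_le_mul_of_nonneg_left ?_ hA0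
    rw [Real.sqrt_le_left (by positivity), mul_pow, Real.sq_sqrt hD]
    exact hva
  -- Now it is tested with R w itself. Inserting ‖w‖ ≤ √D A + P yields A ≤ √D P, hence ‖w‖ ≤ (D + 1)
  -- P.
  have h2 : A ^ 2 + P ^ 2 ≤ ‖w‖ * P := by
    have := h.eq w _ (h.mem w)
    rw [hA2, hP, ← real_inner_self_eq_norm_sq, this]
    exact real_inner_le_norm _ _
  set s := √D
  have hs : s ^ 2 = D := Real.sq_sqrt hD
  have hs0 : 0 ≤ s := Real.sqrt_nonneg _
  have hP0 : 0 ≤ P := norm_nonneg _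
  have hw0 : 0 ≤ ‖w‖ := norm_nonneg _
  have h3 : ‖w‖ ≤ s * A + P := by
    rcases hw0.eq_or_lt with hw | hw
    · rw [← hw]; positivity
    · refine le_of_mul_le_mul_right ?_ hw
      linarith
  have h4 : A ≤ s * P := by
    rcases hA0.eq_or_lt with hw | hw
    · rw [← hw]; positivity
    · refine le_of_mul_le_mul_right ?_ hw
      nlinarith
  rw [← hs]
  nlinarith

/-- The part of the solution on which the solution operator is small has a small energy. -/
theorem exists_low_part (h : RelaxedSolver a V coef R) {Λ F : ℝ} (hΛ : 0 < Λ) {l : X →ₗ[ℝ] ℝ}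
    (hl : ∀ v ∈ V, l v ^ 2 ≤ F ^ 2 * (‖coef v‖ ^ 2 + Λ⁻¹ * a v v)) {w : EuclideanSpace ℝ κ}
    (hw : ∀ c, a (R w) (R c) = l (R c)) :
    ∃ g, ‖g‖ ≤ (1 + Λ) * ‖coef (R w)‖ ∧ a (R (w - g)) (R (w - g)) ≤ 2 * Λ⁻¹ * F ^ 2 := by
  classical
  have hT := h.isSymmetric
  set T := coef ∘ₗ R with hTdef
  have hTa : ∀ c, coef (R c) = T c := fun c => rfl
  set β := hT.eigenvectorBasis rfl
  set θ := hT.eigenvalues rfl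
  have hrep : ∀ c k, β.repr (T c) k = θ k * β.repr c k := fun c k => by
    simpa using hT.eigenvectorBasis_apply_self_apply rfl c k
  have hin : ∀ x y : EuclideanSpace ℝ κ, inner ℝ x y = ∑ k, β.repr x k * β.repr y k := by
    intro x y
    rw [← β.repr.inner_map_map, PiLp.inner_apply]
    exact Finset.sum_congr rfl fun k _ => by simp [mul_comm]
  have hnorm : ∀ x : EuclideanSpace ℝ κ, ‖x‖ ^ 2 = ∑ k, β.repr x k ^ 2 := by
    intro x
    rw [← real_inner_self_eq_norm_sq, hin]
    exact Finset.sum_congr rfl fun k _ => by ring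
  -- In the eigenbasis of T the energy is diagonal with weights (1 - θ) θ.
  have hen : ∀ x y : EuclideanSpace ℝ κ,
      a (R x) (R y) = ∑ k, (1 - θ k) * θ k * (β.repr x k * β.repr y k) := by
    intro x y
    rw [h.energy_eq, hTa, hTa, hin]
    refine Finset.sum_congr rfl fun k _ => ?_
    rw [map_sub, PiLp.sub_apply, hrep, hrep]; ring
  have hθ : ∀ k, 0 ≤ θ k := by
    intro k
    have h1 := h.eq (β k) _ (h.mem (β k))
    rw [hTa, hin, hin] at h1
    have h2 : ∑ j, β.repr (β k) j * β.repr (T (β k)) j = θ k := by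
      rw [Finset.sum_eq_single k]
      · rw [hrep]; simp
      · intro j _ hj; simp [hj]
      · simp
    rw [h2] at h1
    rw [← h1]
    exact add_nonneg (h.psd.nonneg _) (Finset.sum_nonneg fun _ _ => mul_self_nonneg _)
  -- The threshold 1 / (1 + Λ) is where θ = Λ⁻¹ (1 - θ). Components with larger θ are recovered from
  -- T w at the cost 1 + Λ; for smaller θ, the squared coefficients θ² of R are at most Λ⁻¹ times
  -- the energy (1 - θ) θ.
  set g : EuclideanSpace ℝ κ := β.repr.symm
    (WithLp.toLp 2 fun k => if θ k < 1 / (1 + Λ) then 0 else β.repr w k) with hg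
  have hgk : ∀ k, β.repr g k = if θ k < 1 / (1 + Λ) then 0 else β.repr w k := by
    intro k; rw [hg, LinearIsometryEquiv.apply_symm_apply]
  have hhk : ∀ k, β.repr (w - g) k = if θ k < 1 / (1 + Λ) then β.repr w k else 0 := by
    intro k; rw [map_sub, PiLp.sub_apply, hgk]; split_ifs <;> simp
  refine ⟨g, ?_, ?_⟩
  · refine le_of_sq_le_sq ?_ (by positivity)
    rw [mul_pow, hTa, hnorm, hnorm, Finset.mul_sum]
    refine Finset.sum_le_sum fun k _ => ?_
    rw [hgk, hrep, ← mul_pow]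
    split_ifs with hk
    · rw [zero_pow two_ne_zero]; positivity
    · push Not at hk
      rw [div_le_iff₀ (by positivity)] at hk
      rw [← mul_assoc, mul_pow]
      have : 1 ≤ ((1 + Λ) * θ k) ^ 2 := one_le_pow₀ (by linarith)
      nlinarith [sq_nonneg (β.repr w k)]
  · set A := a (R (w - g)) (R (w - g)) with hA
    have hA0 : 0 ≤ A := h.psd.nonneg _
    -- The spectral splitting is a-orthogonal, so the Galerkin equation of R w tests the low part
    -- with its own energy.
    have h1 : l (R (w - g)) = A := by
      rw [← hw, hA, hen, hen]
      refine Finset.sum_congr rfl fun k _ => ?_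
      rw [hhk]; split_ifs <;> simp
    have h2 : ‖coef (R (w - g))‖ ^ 2 ≤ Λ⁻¹ * A := by
      rw [hTa, hnorm, hA, hen, Finset.mul_sum]
      refine Finset.sum_le_sum fun k _ => ?_
      rw [hrep, hhk]
      split_ifs with hk
      · rw [lt_div_iff₀ (by positivity)] at hk
        have h3 : θ k ≤ Λ⁻¹ * (1 - θ k) := by
          rw [inv_mul_eq_div, le_div_iff₀ hΛ]; linarith
        have h4 := mul_le_mul_of_nonneg_right h3
          (mul_nonneg (hθ k) (sq_nonneg (β.repr w k)))
        calc _ = θ k * (θ k * β.repr w k ^ 2) := by ring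
          _ ≤ _ := h4
          _ = _ := by ring
      · simp
    have h3 := hl _ (h.mem (w - g))
    rw [h1] at h3
    rcases hA0.eq_or_lt with h0 | h0
    · rw [← h0]; positivity
    · refine le_of_mul_le_mul_right ?_ h0
      have := mul_le_mul_of_nonneg_left h2 (sq_nonneg F)
      nlinarith

/-- The error of the global basis. -/
theorem global_error (h : RelaxedSolver a V coef R) {Λ F : ℝ} (hΛ : 0 < Λ) {l : X →ₗ[ℝ] ℝ}
    (hl : ∀ v ∈ V, l v ^ 2 ≤ F ^ 2 * (‖coef v‖ ^ 2 + Λ⁻¹ * a v v)) {u : X} (hu : u ∈ V)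
    (hul : ∀ v ∈ V, a u v = l v) {w : EuclideanSpace ℝ κ}
    (hw : ∀ c, a (R w) (R c) = l (R c)) :
    a (u - R w) (u - R w) ≤ Λ⁻¹ * F ^ 2 := by
  set e := u - R w with he
  have heV : e ∈ V := V.sub_mem hu (h.mem w)
  set q := coef e with hq
  have horth : ∀ c, a (R c) e = 0 := by
    intro c
    rw [h.psd.symm, he, LinearMap.map_sub₂, hul _ (h.mem c), hw, sub_self]
  -- Orthogonality to the range of R says that e solves the relaxed equations without energy term;
  -- by symmetry q is fixed by T, and then R q has zero energy. Subtracting R q from e removes the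
  -- coefficients without changing the energy.
  have hTq : coef (R q) = q := by
    have h1 : ∀ c, inner ℝ c (coef (R q) - q) = 0 := by
      intro c
      have h2 := h.eq c e heV
      rw [horth, zero_add] at h2
      have h3 := h.isSymmetric c q
      simp only [LinearMap.comp_apply] at h3
      rw [inner_sub_right, ← h3, h2, sub_self]
    have := h1 (coef (R q) - q)
    rw [inner_self_eq_zero] at this
    exact sub_eq_zero.1 this
  have hRq : a (R q) (R q) = 0 := by
    rw [h.energy_eq, hTq, sub_self, inner_zero_left]
  have hA : a e e = l (e - R q) := by
    have h1 : a u e = a e e := by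
      have := horth w
      have h2 : u = e + R w := by rw [he]; abel
      conv_lhs => rw [h2]
      rw [LinearMap.map_add₂, this, add_zero]
    rw [map_sub l, ← hul _ heV, ← hul _ (h.mem q), h1, h.psd.eq_zero_right hRq, sub_zero]
  have h1 := hl _ (V.sub_mem heV (h.mem q))
  rw [← hA, map_sub coef, ← hq, hTq, sub_self, norm_zero, h.psd.expand_sub e, hRq,
    h.psd.eq_zero_right hRq] at h1
  have h0 := h.psd.nonneg e
  rcases h0.eq_or_lt with h2 | h2
  · rw [← h2]; positivity
  · refine le_of_mul_le_mul_right ?_ h2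
    nlinarith

/-- The solution operator is injective if no coefficient vector is orthogonal to all of `V`, and
then the coefficient map is onto, with a bounded right inverse. -/
theorem exists_stable (h : RelaxedSolver a V coef R)
    (hinj : ∀ c, (∀ v ∈ V, inner ℝ c (coef v) = 0) → c = 0) :
    ∃ D : ℝ, 0 ≤ D ∧ ∀ w, ∃ v ∈ V, coef v = w ∧ a v v ≤ D * ‖w‖ ^ 2 := by
  set T := coef ∘ₗ R with hT
  have hTi : Function.Injective T := by
    refine (injective_iff_map_eq_zero T).2 fun c hc => hinj c fun v hv => ?_
    have hc' : coef (R c) = 0 := hc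
    have h0 : a (R c) (R c) = 0 := by
      rw [h.energy_eq, hc', inner_zero_right]
    rw [← h.eq c v hv, hc', inner_zero_left, h.psd.eq_zero_left h0, add_zero]
  -- Injectivity suffices for invertibility in finite dimension, and R T⁻¹ is the right inverse of
  -- `coef`.
  set Te := LinearEquiv.ofInjectiveEndo T hTi with hTe
  set G := LinearMap.toContinuousLinearMap Te.symm.toLinearMap
  refine ⟨‖G‖, norm_nonneg _, fun w => ⟨R (Te.symm w), h.mem _, ?_, ?_⟩⟩
  · exact Te.apply_symm_apply w
  · have hw : coef (R (Te.symm w)) = w := Te.apply_symm_apply w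
    rw [h.energy_eq, hw, inner_sub_left]
    have h1 : inner ℝ (Te.symm w) w ≤ ‖G‖ * ‖w‖ * ‖w‖ :=
      (real_inner_le_norm _ _).trans (mul_le_mul_of_nonneg_right (G.le_opNorm w) (norm_nonneg _))
    have h2 : (0 : ℝ) ≤ inner ℝ w w := real_inner_self_nonneg
    nlinarith

end RelaxedSolver

end Relaxed

/-! ### Lipschitz functions in H¹₀ by mollification -/

section Mollification

open Filter Topology Metric
open scoped Convolution

/-- Dominated convergence in `L²`. -/
theorem Lp_two_tendsto_of_dominated {α E : Type*} [MeasurableSpace α] {μ : Measure α}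
    [NormedAddCommGroup E] {F : ℕ → Lp E 2 μ} {F₀ : Lp E 2 μ} {G : α → ℝ} (hG : MemLp G 2 μ)
    (hb : ∀ n, ∀ᵐ x ∂μ, ‖F n x‖ ≤ G x)
    (hlim : ∀ᵐ x ∂μ, Tendsto (fun n => F n x) atTop (𝓝 (F₀ x))) :
    Tendsto F atTop (𝓝 F₀) := by
  rw [Lp.tendsto_Lp_iff_tendsto_eLpNorm']
  have h2 : (2 : ENNReal) ≠ 0 := by norm_num
  have h2' : (2 : ENNReal) ≠ ⊤ := by norm_num
  have hb0 : ∀ᵐ x ∂μ, ‖F₀ x‖ ≤ G x := by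
    filter_upwards [hlim, ae_all_iff.2 hb] with x hx hbx
    exact le_of_tendsto hx.norm (Eventually.of_forall hbx)
  have key : Tendsto (fun n => ∫⁻ x, ‖(F n - F₀ : α → E) x‖ₑ ^ (2 : ℝ) ∂μ) atTop (𝓝 0) := by
    have : (0 : ENNReal) = ∫⁻ _, 0 ∂μ := by simp
    rw [this]
    refine tendsto_lintegral_of_dominated_convergence' (fun x => ‖2 * G x‖ₑ ^ (2 : ℝ)) ?_ ?_ ?_ ?_
    · intro n
      exact (((Lp.aestronglyMeasurable (F n)).sub (Lp.aestronglyMeasurable F₀)).enorm).pow_const _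
    · intro n
      filter_upwards [hb n, hb0] with x h1 h0
      gcongr
      rw [enorm_le_iff_norm_le]
      calc ‖F n x - F₀ x‖ ≤ ‖F n x‖ + ‖F₀ x‖ := norm_sub_le _ _
        _ ≤ 2 * G x := by linarith
        _ ≤ ‖2 * G x‖ := le_abs_self _
    · have := (hG.const_mul 2).eLpNorm_lt_top
      exact (lintegral_rpow_enorm_lt_top_of_eLpNorm_lt_top h2 h2' this).ne
    · filter_upwards [hlim] with x hx
      have h1 : Tendsto (fun n => ‖F n x - F₀ x‖ₑ) atTop (𝓝 0) := by
        have := (hx.sub_const (F₀ x)).enorm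
        simpa using this
      have := (ENNReal.continuous_rpow_const (y := 2)).tendsto 0 |>.comp h1
      simpa [Function.comp_def] using this
  have h3 : ∀ n, eLpNorm (F n - F₀ : α → E) 2 μ =
      (∫⁻ x, ‖(F n - F₀ : α → E) x‖ₑ ^ (2 : ℝ) ∂μ) ^ (1 / (2 : ℝ)) := by
    intro n
    rw [eLpNorm_eq_lintegral_rpow_enorm_toReal h2 h2']
    simp
  simp_rw [h3]
  have := (ENNReal.continuous_rpow_const (y := 1 / 2)).tendsto 0 |>.comp key
  simpa [Function.comp_def] using this

variable {d : ℕ} {E : Type*} [NormedAddCommGroup E] [NormedSpace ℝ E]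

/-- The mollification of `h` with radius `r`. -/
def mollify {r : ℝ} (hr : 0 < r) (h : Rd d → E) : Rd d → E :=
  ((⟨r / 2, r, half_pos hr, half_lt_self hr⟩ : ContDiffBump (0 : Rd d)).normed volume
    ⋆[ContinuousLinearMap.lsmul ℝ ℝ, volume] h)

theorem mollify_apply {r : ℝ} (hr : 0 < r) (h : Rd d → E) (x : Rd d) :
    mollify hr h x = ∫ t, (⟨r / 2, r, half_pos hr, half_lt_self hr⟩ :
      ContDiffBump (0 : Rd d)).normed volume t • h (x - t) := rfl

theorem norm_mollify_le {r : ℝ} (hr : 0 < r) {h : Rd d → E} {M : ℝ} (hM : ∀ x, ‖h x‖ ≤ M)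
    (x : Rd d) : ‖mollify hr h x‖ ≤ M := by
  rw [mollify_apply]
  set φ : ContDiffBump (0 : Rd d) := ⟨r / 2, r, half_pos hr, half_lt_self hr⟩
  refine (norm_integral_le_of_norm_le (g := fun t => φ.normed volume t * M) ?_ ?_).trans ?_
  · exact φ.integrable_normed.mul_const M
  · refine Eventually.of_forall fun t => ?_
    rw [norm_smul, Real.norm_of_nonneg (φ.nonneg_normed t)]
    exact mul_le_mul_of_nonneg_left (hM _) (φ.nonneg_normed t)
  · rw [integral_mul_const, φ.integral_normed, one_mul]

theorem mollify_eq_zero {r δ : ℝ} (hr : 0 < r) (hrδ : r ≤ δ) {h : Rd d → E} {K : Set (Rd d)}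
    (hK : ∀ x ∉ K, h x = 0) {x : Rd d} (hx : x ∉ cthickening δ K) : mollify hr h x = 0 := by
  rw [mollify_apply]
  set φ : ContDiffBump (0 : Rd d) := ⟨r / 2, r, half_pos hr, half_lt_self hr⟩
  refine integral_eq_zero_of_ae (Eventually.of_forall fun t => ?_)
  by_cases ht : t ∈ ball (0 : Rd d) r
  · have : x - t ∉ K := fun hxt => hx (mem_cthickening_of_dist_le x (x - t) δ K hxt (by
      rw [dist_eq_norm, sub_sub_cancel]
      exact (mem_ball_zero_iff.1 ht).le.trans hrδ))
    simp [hK _ this]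
  · have h0 : φ.normed volume t = 0 := by
      have := φ.support_normed_eq (μ := volume)
      by_contra hne
      exact ht (this ▸ (Function.mem_support.2 hne))
    simp [h0]

theorem contDiff_mollify {r : ℝ} (hr : 0 < r) {h : Rd d → E} (hh : LocallyIntegrable h) :
    ContDiff ℝ ∞ (mollify hr h) :=
  (ContDiffBump.hasCompactSupport_normed _).contDiff_convolution_left _
    (ContDiffBump.contDiff_normed _) hh

/-- Differentiation under the integral: the Lipschitz constant supplies the dominating function, and
Rademacher's theorem supplies the derivative of the integrand for almost every t. -/
theorem fderiv_mollify {r : ℝ} (hr : 0 < r) {g : Rd d → Rd d} {L : NNReal}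
    (hg : LipschitzWith L g) (x : Rd d) :
    fderiv ℝ (mollify hr g) x = mollify hr (fderiv ℝ g) x := by
  set φ : ContDiffBump (0 : Rd d) := ⟨r / 2, r, half_pos hr, half_lt_self hr⟩ with hφ
  have hc : ∀ y, Continuous fun t => φ.normed volume t • g (y - t) := fun y =>
    (φ.continuous_normed (μ := volume)).smul (hg.continuous.comp (by fun_prop))
  have h := hasFDerivAt_integral_of_dominated_loc_of_lip (𝕜 := ℝ) (μ := volume)
    (F := fun y t => φ.normed volume t • g (y - t))
    (F' := fun t => φ.normed volume t • fderiv ℝ g (x - t))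
    (bound := fun t => φ.normed volume t * L) (s := Set.univ) (x₀ := x) univ_mem
    (Eventually.of_forall fun y => (hc y).aestronglyMeasurable)
    ((hc x).integrable_of_hasCompactSupport
      (φ.hasCompactSupport_normed.smul_right))
    ?_ ?_ (φ.integrable_normed.mul_const _) ?_
  · exact h.2.fderiv
  · refine (φ.continuous_normed (μ := volume)).aestronglyMeasurable.smul ?_
    exact ((measurable_fderiv ℝ g).comp (measurable_const.sub measurable_id)).aestronglyMeasurable
  · refine Eventually.of_forall fun t => LipschitzOnWith.of_dist_le_mul fun y _ z _ => ?_
    rw [dist_eq_norm, ← smul_sub, norm_smul, Real.norm_of_nonneg (φ.nonneg_normed t)]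
    have h1 := hg.dist_le_mul (y - t) (z - t)
    rw [dist_eq_norm, dist_sub_right] at h1
    have h0 := φ.nonneg_normed (μ := volume) t
    rw [Real.coe_nnabs, abs_of_nonneg (by positivity), mul_assoc]
    exact mul_le_mul_of_nonneg_left h1 h0
  · have h1 : ∀ᵐ t ∂(volume : Measure (Rd d)), DifferentiableAt ℝ g (x - t) :=
      (quasiMeasurePreserving_sub_left volume x).ae hg.ae_differentiableAt
    filter_upwards [h1] with t ht
    have h2 : HasFDerivAt (fun y => g (y - t)) (fderiv ℝ g (x - t)) x := by
      simpa [Function.comp_def] using ht.hasFDerivAt.comp x ((hasFDerivAt_id x).sub_const t)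
    exact h2.const_smul (φ.normed volume t)

theorem mollify_tendsto [CompleteSpace E] {r : ℕ → ℝ} (hr : ∀ n, 0 < r n) (hr0 : Tendsto r atTop (𝓝 0))
    {h : Rd d → E} (hh : LocallyIntegrable h) :
    ∀ᵐ x ∂(volume : Measure (Rd d)),
      Tendsto (fun n => mollify (hr n) h x) atTop (𝓝 (h x)) :=
  ContDiffBump.ae_convolution_tendsto_right_of_locallyIntegrable (K := 2)
    (φ := fun n => ⟨r n / 2, r n, half_pos (hr n), half_lt_self (hr n)⟩) hr0
    (Eventually.of_forall fun n => by simp; linarith) hh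

theorem memLp_of_bounded_of_compact {F : Type*} [NormedAddCommGroup F] {h : Rd d → F} {M : ℝ}
    {K : Set (Rd d)} (hm : AEStronglyMeasurable h volume) (hM : ∀ x, ‖h x‖ ≤ M)
    (hKc : IsCompact K) (hK : ∀ x ∉ K, h x = 0) (p : ENNReal) : MemLp h p volume := by
  refine (memLp_indicator_const p hKc.measurableSet M (Or.inr hKc.measure_lt_top.ne)).mono hm ?_
  refine Eventually.of_forall fun x => ?_
  by_cases hx : x ∈ K
  · rw [Set.indicator_of_mem hx]; exact (hM x).trans (le_abs_self _)
  · rw [hK x hx, Set.indicator_of_notMem hx, norm_zero, norm_zero]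

/-- Lipschitz functions with compact support in `Ω` belong to `H¹₀(Ω)`. -/
theorem lipschitz_mem_H10 {Ω : Set (Rd d)} (hΩ : IsOpen Ω) {g : Rd d → Rd d} {L : NNReal}
    (hg : LipschitzWith L g) (hgc : HasCompactSupport g) (hgΩ : tsupport g ⊆ Ω) {p : H1Pair d}
    (hp1 : (p.1 : Rd d → Rd d) =ᵐ[volume] g)
    (hp2 : (p.2 : Rd d → (Rd d →L[ℝ] Rd d)) =ᵐ[volume] fderiv ℝ g) : p ∈ H10 Ω := by
  -- Mollification with radius at most δ keeps all supports in one compact subset K of Ω, so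
  -- multiples of the indicator of K dominate.
  obtain ⟨δ, hδ, hδΩ⟩ := hgc.isCompact.exists_cthickening_subset_open hΩ hgΩ
  set K := cthickening δ (tsupport g)
  have hKc : IsCompact K := hgc.isCompact.cthickening
  set r : ℕ → ℝ := fun n => δ / (n + 1) with hrdef
  have hr : ∀ n, 0 < r n := fun n => by positivity
  have hrδ : ∀ n, r n ≤ δ := fun n => div_le_self hδ.le (by linarith [Nat.cast_nonneg (α := ℝ) n])
  have hr0 : Tendsto r atTop (𝓝 0) := by
    simpa [hrdef, div_eq_mul_inv] using
      (tendsto_one_div_add_atTop_nhds_zero_nat (𝕜 := ℝ)).const_mul δ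
  obtain ⟨M, hM⟩ := hg.continuous.bounded_above_of_compact_support hgc
  have hML : ∀ x, ‖fderiv ℝ g x‖ ≤ L := fun x => norm_fderiv_le_of_lipschitz ℝ hg
  have hg0 : ∀ x ∉ tsupport g, g x = 0 := fun x hx => image_eq_zero_of_notMem_tsupport hx
  have hd0 : ∀ x ∉ tsupport g, fderiv ℝ g x = 0 := fun x hx =>
    image_eq_zero_of_notMem_tsupport fun h => hx (tsupport_fderiv_subset ℝ h)
  have hgm : AEStronglyMeasurable g volume := hg.continuous.aestronglyMeasurable
  have hdm : AEStronglyMeasurable (fderiv ℝ g) volume := (measurable_fderiv ℝ g).aestronglyMeasurable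
  have hgl : LocallyIntegrable g := hg.continuous.locallyIntegrable
  have hdl : LocallyIntegrable (fderiv ℝ g) :=
    (memLp_one_iff_integrable.1
      (memLp_of_bounded_of_compact hdm hML hgc.isCompact hd0 1)).locallyIntegrable
  have hcd : ∀ n, ContDiff ℝ ∞ (mollify (hr n) g) := fun n => contDiff_mollify (hr n) hgl
  have hm1 : ∀ n, MemLp (mollify (hr n) g) 2 volume := fun n =>
    memLp_of_bounded_of_compact (hcd n).continuous.aestronglyMeasurable (norm_mollify_le (hr n) hM)
      hKc (fun x hx => mollify_eq_zero (hr n) (hrδ n) hg0 hx) 2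
  have hfd : ∀ n, fderiv ℝ (mollify (hr n) g) = mollify (hr n) (fderiv ℝ g) := fun n =>
    funext fun x => fderiv_mollify (hr n) hg x
  have hm2 : ∀ n, MemLp (mollify (hr n) (fderiv ℝ g)) 2 volume := fun n =>
    memLp_of_bounded_of_compact
      (by rw [← hfd]; exact (measurable_fderiv ℝ _).aestronglyMeasurable)
      (norm_mollify_le (hr n) hML)
      hKc (fun x hx => mollify_eq_zero (hr n) (hrδ n) hd0 hx) 2
  set q : ℕ → H1Pair d := fun n => ((hm1 n).toLp _, (hm2 n).toLp _)
  have hq : ∀ n, q n ∈ (Submodule.span ℝ {p : H1Pair d | ∃ φ : Rd d → Rd d,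
      ContDiff ℝ ∞ φ ∧ HasCompactSupport φ ∧ tsupport φ ⊆ Ω ∧
      (p.1 : Rd d → Rd d) =ᵐ[volume] φ ∧
      (p.2 : Rd d → (Rd d →L[ℝ] Rd d)) =ᵐ[volume] fderiv ℝ φ}) := by
    intro n
    have hsupp : tsupport (mollify (hr n) g) ⊆ K :=
      closure_minimal (fun x hx => by
        by_contra h
        exact hx (mollify_eq_zero (hr n) (hrδ n) hg0 h)) hKc.isClosed
    refine Submodule.subset_span ⟨mollify (hr n) g, hcd n, ?_, hsupp.trans hδΩ, ?_, ?_⟩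
    · exact hKc.of_isClosed_subset (isClosed_tsupport _) hsupp
    · exact (hm1 n).coeFn_toLp
    · rw [hfd]; exact (hm2 n).coeFn_toLp
  refine mem_closure_of_tendsto (f := q) (b := atTop) ?_ (Eventually.of_forall hq)
  have hdom : ∀ M : ℝ, MemLp (K.indicator fun _ => M) 2 (volume : Measure (Rd d)) := fun M =>
    memLp_indicator_const 2 hKc.measurableSet M (Or.inr hKc.measure_lt_top.ne)
  refine Tendsto.prodMk_nhds ?_ ?_
  · refine Lp_two_tendsto_of_dominated (hdom M) ?_ ?_
    · intro n
      filter_upwards [(hm1 n).coeFn_toLp] with x hx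
      rw [hx]
      by_cases h : x ∈ K
      · rw [Set.indicator_of_mem h]; exact norm_mollify_le (hr n) hM x
      · rw [Set.indicator_of_notMem h, mollify_eq_zero (hr n) (hrδ n) hg0 h, norm_zero]
    · filter_upwards [ae_all_iff.2 fun n => (hm1 n).coeFn_toLp, hp1,
        mollify_tendsto hr hr0 hgl] with x h1 h2 h3
      simpa only [h1, h2] using h3
  · refine Lp_two_tendsto_of_dominated (hdom L) ?_ ?_
    · intro n
      filter_upwards [(hm2 n).coeFn_toLp] with x hx
      rw [hx]
      by_cases h : x ∈ K
      · rw [Set.indicator_of_mem h]; exact norm_mollify_le (hr n) hML x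
      · rw [Set.indicator_of_notMem h, mollify_eq_zero (hr n) (hrδ n) hd0 h, norm_zero]
    · filter_upwards [ae_all_iff.2 fun n => (hm2 n).coeFn_toLp, hp2,
        mollify_tendsto hr hr0 hdl] with x h1 h2 h3
      simpa only [h1, h2] using h3

end Mollification

/-! ### Multiplication by cutoff functions and supports -/

section Multiplication

variable {d : ℕ}

theorem memLp_clm_apply {E F : Type*} [NormedAddCommGroup E] [NormedSpace ℝ E]
    [NormedAddCommGroup F] [NormedSpace ℝ F] {A : Rd d → (E →L[ℝ] F)}
    (hA : AEStronglyMeasurable A volume) {C : ℝ} (hC : ∀ x, ‖A x‖ ≤ C) (f : Lp E 2 (volume : Measure (Rd d))) :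
    MemLp (fun x => A x (f x)) 2 volume := by
  refine (Lp.memLp f).of_le_mul (c := C) ?_ ?_
  · exact (ContinuousLinearMap.id ℝ (E →L[ℝ] F)).aestronglyMeasurable_comp₂ hA
      (Lp.aestronglyMeasurable f)
  · exact Filter.Eventually.of_forall fun x =>
      ((A x).le_opNorm _).trans (mul_le_mul_of_nonneg_right (hC x) (norm_nonneg _))

/-- The operator `f ↦ (x ↦ A(x) f(x))` on `L²`. -/
def clmApplyL2 {E F : Type*} [NormedAddCommGroup E] [NormedSpace ℝ E]
    [NormedAddCommGroup F] [NormedSpace ℝ F] (A : Rd d → (E →L[ℝ] F))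
    (hA : AEStronglyMeasurable A volume) {C : ℝ} (hC : ∀ x, ‖A x‖ ≤ C) :
    Lp E 2 (volume : Measure (Rd d)) →L[ℝ] Lp F 2 (volume : Measure (Rd d)) :=
  LinearMap.mkContinuous
    { toFun := fun f => (memLp_clm_apply hA hC f).toLp _
      map_add' := fun f g => by
        apply Lp.ext
        filter_upwards [(memLp_clm_apply hA hC (f + g)).coeFn_toLp,
          (memLp_clm_apply hA hC f).coeFn_toLp, (memLp_clm_apply hA hC g).coeFn_toLp,
          Lp.coeFn_add f g, Lp.coeFn_add ((memLp_clm_apply hA hC f).toLp _)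
            ((memLp_clm_apply hA hC g).toLp _)] with x h1 h2 h3 h4 h5
        rw [h1, h5, Pi.add_apply, h2, h3, h4, Pi.add_apply, map_add]
      map_smul' := fun c f => by
        apply Lp.ext
        filter_upwards [(memLp_clm_apply hA hC (c • f)).coeFn_toLp,
          (memLp_clm_apply hA hC f).coeFn_toLp, Lp.coeFn_smul c f,
          Lp.coeFn_smul c ((memLp_clm_apply hA hC f).toLp _)] with x h1 h2 h3 h4
        rw [h1, RingHom.id_apply, h4, Pi.smul_apply, h2, h3, Pi.smul_apply, map_smul] }
    C fun f => by
      refine Lp.norm_le_mul_norm_of_ae_le_mul ?_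
      filter_upwards [(memLp_clm_apply hA hC f).coeFn_toLp] with x hx
      simp only [LinearMap.coe_mk, AddHom.coe_mk]
      rw [hx]
      exact ((A x).le_opNorm _).trans (mul_le_mul_of_nonneg_right (hC x) (norm_nonneg _))

theorem coeFn_clmApplyL2 {E F : Type*} [NormedAddCommGroup E] [NormedSpace ℝ E]
    [NormedAddCommGroup F] [NormedSpace ℝ F] (A : Rd d → (E →L[ℝ] F))
    (hA : AEStronglyMeasurable A volume) {C : ℝ} (hC : ∀ x, ‖A x‖ ≤ C)
    (f : Lp E 2 (volume : Measure (Rd d))) :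
    (clmApplyL2 A hA hC f : Rd d → F) =ᵐ[volume] fun x => A x (f x) :=
  (memLp_clm_apply hA hC f).coeFn_toLp

theorem norm_smul_id_le {E : Type*} [NormedAddCommGroup E] [NormedSpace ℝ E] {c : ℝ}
    (hc : |c| ≤ 1) : ‖c • ContinuousLinearMap.id ℝ E‖ ≤ 1 := by
  rw [norm_smul]
  exact mul_le_one₀ hc (norm_nonneg _) ContinuousLinearMap.norm_id_le

/-- The product rule is used as a definition on arbitrary pairs, whether or not the second component
is a gradient; this makes the product a bounded operator, so that its properties pass to closures.
-/
theorem exists_mul_operator {η : Rd d → ℝ} {L : NNReal} (hη : LipschitzWith L η)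
    (hb : ∀ x, |η x| ≤ 1) : ∃ M : H1Pair d →L[ℝ] H1Pair d, ∀ v : H1Pair d,
      ((M v).1 : Rd d → Rd d) =ᵐ[volume] (fun x => η x • (v.1 : Rd d → Rd d) x) ∧
      ((M v).2 : Rd d → (Rd d →L[ℝ] Rd d)) =ᵐ[volume] (fun x =>
        η x • (v.2 : Rd d → (Rd d →L[ℝ] Rd d)) x + (fderiv ℝ η x).smulRight ((v.1 : Rd d → Rd d) x)) := by
  have m1 : AEStronglyMeasurable (fun x => η x • ContinuousLinearMap.id ℝ (Rd d)) volume :=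
    (hη.continuous.smul continuous_const).aestronglyMeasurable
  have m2 : AEStronglyMeasurable (fun x => η x • ContinuousLinearMap.id ℝ (Rd d →L[ℝ] Rd d))
      (volume : Measure (Rd d)) :=
    (hη.continuous.smul continuous_const).aestronglyMeasurable
  have m3 : AEStronglyMeasurable
      (fun x => ContinuousLinearMap.smulRightL ℝ (Rd d) (Rd d) (fderiv ℝ η x)) volume :=
    (ContinuousLinearMap.continuous _).comp_aestronglyMeasurable
      (measurable_fderiv ℝ η).aestronglyMeasurable
  have b1 : ∀ x, ‖η x • ContinuousLinearMap.id ℝ (Rd d)‖ ≤ 1 := fun x => norm_smul_id_le (hb x)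
  have b2 : ∀ x, ‖η x • ContinuousLinearMap.id ℝ (Rd d →L[ℝ] Rd d)‖ ≤ 1 := fun x => norm_smul_id_le (hb x)
  have b3 : ∀ x, ‖ContinuousLinearMap.smulRightL ℝ (Rd d) (Rd d) (fderiv ℝ η x)‖ ≤
      ‖ContinuousLinearMap.smulRightL ℝ (Rd d) (Rd d)‖ * L := fun x =>
    (ContinuousLinearMap.le_opNorm _ _).trans
      (mul_le_mul_of_nonneg_left (norm_fderiv_le_of_lipschitz ℝ hη) (norm_nonneg _))
  refine ⟨((clmApplyL2 _ m1 b1).comp (ContinuousLinearMap.fst ℝ _ _)).prod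
    ((clmApplyL2 _ m2 b2).comp (ContinuousLinearMap.snd ℝ _ _) +
      (clmApplyL2 _ m3 b3).comp (ContinuousLinearMap.fst ℝ _ _)), fun v => ⟨?_, ?_⟩⟩
  · exact coeFn_clmApplyL2 _ m1 b1 v.1
  · have h1 := coeFn_clmApplyL2 _ m2 b2 v.2
    have h2 := coeFn_clmApplyL2 _ m3 b3 v.1
    have h3 := Lp.coeFn_add (clmApplyL2 _ m2 b2 v.2) (clmApplyL2 _ m3 b3 v.1)
    filter_upwards [h1, h2, h3] with x h1 h2 h3
    change (clmApplyL2 _ m2 b2 v.2 + clmApplyL2 _ m3 b3 v.1 : Lp _ 2 volume) x = _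
    rw [h3, Pi.add_apply, h1, h2]
    rfl

/-- The product of an `H¹` function with a bounded Lipschitz function. -/
def mulH1 {η : Rd d → ℝ} {L : NNReal} (hη : LipschitzWith L η) (hb : ∀ x, |η x| ≤ 1) :
    H1Pair d →L[ℝ] H1Pair d := (exists_mul_operator hη hb).choose

theorem mulH1_fst {η : Rd d → ℝ} {L : NNReal} (hη : LipschitzWith L η) (hb : ∀ x, |η x| ≤ 1)
    (v : H1Pair d) : ((mulH1 hη hb v).1 : Rd d → Rd d) =ᵐ[volume] (fun x => η x • v.1 x) :=
  ((exists_mul_operator hη hb).choose_spec v).1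

theorem mulH1_snd {η : Rd d → ℝ} {L : NNReal} (hη : LipschitzWith L η) (hb : ∀ x, |η x| ≤ 1)
    (v : H1Pair d) : ((mulH1 hη hb v).2 : Rd d → (Rd d →L[ℝ] Rd d)) =ᵐ[volume]
      (fun x => η x • v.2 x + (fderiv ℝ η x).smulRight (v.1 x)) :=
  ((exists_mul_operator hη hb).choose_spec v).2

/-- A cutoff times a test function is Lipschitz, with support in F ∩ tsupport φ, hence compactly
inside Ω'. The closed set F is needed because η ≠ 0 inside Ω' alone would allow the support to touch
the boundary of Ω'. -/
theorem mulH1_mem_H10 {η : Rd d → ℝ} {L : NNReal} (hη : LipschitzWith L η) (hb : ∀ x, |η x| ≤ 1)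
    {Ω Ω' F : Set (Rd d)} (hΩ' : IsOpen Ω') (hF : IsClosed F) (hηF : ∀ x ∈ Ω, η x ≠ 0 → x ∈ F)
    (hFΩ : F ∩ Ω ⊆ Ω') {v : H1Pair d} (hv : v ∈ H10 Ω) : mulH1 hη hb v ∈ H10 Ω' := by
  have hle : Submodule.span ℝ {p : H1Pair d | ∃ φ : Rd d → Rd d,
      ContDiff ℝ ∞ φ ∧ HasCompactSupport φ ∧ tsupport φ ⊆ Ω ∧
      (p.1 : Rd d → Rd d) =ᵐ[volume] φ ∧
      (p.2 : Rd d → (Rd d →L[ℝ] Rd d)) =ᵐ[volume] fderiv ℝ φ} ≤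
      (H10 Ω').comap (mulH1 hη hb).toLinearMap := by
    refine Submodule.span_le.2 ?_
    rintro p ⟨φ, hφ, hφc, hφΩ, h1, h2⟩
    obtain ⟨Lφ, hLφ⟩ := ContDiff.lipschitzWith_of_hasCompactSupport hφc hφ (by simp)
    obtain ⟨M, hM⟩ := hφ.continuous.bounded_above_of_compact_support hφc
    have hM0 : 0 ≤ M := (norm_nonneg _).trans (hM 0)
    have hlip : LipschitzWith (Lφ + L * M.toNNReal) (fun x => η x • φ x) := by
      refine LipschitzWith.of_dist_le_mul fun x y => ?_
      rw [dist_eq_norm]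
      have e : η x • φ x - η y • φ y = η x • (φ x - φ y) + (η x - η y) • φ y := by
        rw [smul_sub, sub_smul]; abel
      have hx := hLφ.dist_le_mul x y
      have hy := hη.dist_le_mul x y
      rw [dist_eq_norm] at hx hy
      calc ‖η x • φ x - η y • φ y‖ ≤ |η x| * ‖φ x - φ y‖ + ‖η x - η y‖ * ‖φ y‖ := by
            rw [e]
            refine (norm_add_le _ _).trans ?_
            rw [norm_smul, norm_smul, Real.norm_eq_abs (η x)]
        _ ≤ 1 * (Lφ * dist x y) + (L * dist x y) * M := by
            gcongr
            · exact hb x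
            · exact hM y
        _ = _ := by
            push_cast
            rw [Real.coe_toNNReal _ hM0]; ring
    have hsub : tsupport (fun x => η x • φ x) ⊆ F ∩ tsupport φ := by
      refine closure_minimal (fun x hx => ?_) (hF.inter (isClosed_tsupport φ))
      have h0 : η x • φ x ≠ 0 := hx
      have hxφ : x ∈ tsupport φ := subset_closure fun h => h0 (by rw [h, smul_zero])
      exact ⟨hηF x (hφΩ hxφ) fun h => h0 (by rw [h, zero_smul]), hxφ⟩
    have hcs : HasCompactSupport (fun x => η x • φ x) :=
      HasCompactSupport.intro hφc fun x hx => by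
        rw [image_eq_zero_of_notMem_tsupport hx, smul_zero]
    have hsub' : tsupport (fun x => η x • φ x) ⊆ Ω' := fun x hx =>
      hFΩ ⟨(hsub hx).1, hφΩ (hsub hx).2⟩
    change mulH1 hη hb p ∈ H10 Ω'
    refine lipschitz_mem_H10 hΩ' hlip hcs hsub' ?_ ?_
    · filter_upwards [mulH1_fst hη hb p, h1] with x hx hx1
      exact hx.trans (by rw [hx1])
    · filter_upwards [mulH1_snd hη hb p, h1, h2, hη.ae_differentiableAt] with x hx hx1 hx2 hd
      refine hx.trans ?_
      rw [hx1, hx2]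
      exact (hd.hasFDerivAt.smul (hφ.differentiable (by simp) x).hasFDerivAt).fderiv.symm
  have hcl : IsClosed ((H10 Ω').comap (mulH1 hη hb).toLinearMap : Set (H1Pair d)) :=
    (Submodule.isClosed_topologicalClosure _).preimage (mulH1 hη hb).continuous
  exact Submodule.topologicalClosure_minimal _ hle hcl hv

theorem H10_mono {Ω Ω' : Set (Rd d)} (h : Ω ⊆ Ω') : H10 Ω ≤ H10 Ω' := by
  refine Submodule.topologicalClosure_mono (Submodule.span_mono ?_)
  rintro p ⟨φ, h1, h2, h3, h4⟩
  exact ⟨φ, h1, h2, h3.trans h, h4⟩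

/-- The pairs that vanish almost everywhere off `A`. -/
def zeroOff (A : Set (Rd d)) : Submodule ℝ (H1Pair d) :=
  ((LpToLpRestrictCLM (Rd d) (Rd d) ℝ volume 2 Aᶜ).comp
      (ContinuousLinearMap.fst ℝ _ _)).ker ⊓
    ((LpToLpRestrictCLM (Rd d) (Rd d →L[ℝ] Rd d) ℝ volume 2 Aᶜ).comp
      (ContinuousLinearMap.snd ℝ _ _)).ker

theorem isClosed_zeroOff (A : Set (Rd d)) : IsClosed (zeroOff A : Set (H1Pair d)) :=
  (ContinuousLinearMap.isClosed_ker _).inter (ContinuousLinearMap.isClosed_ker _)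

theorem mem_zeroOff {A : Set (Rd d)} (hA : MeasurableSet A) {v : H1Pair d} :
    v ∈ zeroOff A ↔ ∀ᵐ x ∂(volume : Measure (Rd d)), x ∉ A → v.1 x = 0 ∧ v.2 x = 0 := by
  have h1 : ∀ {F : Type} [NormedAddCommGroup F] [NormedSpace ℝ F]
      (f : Lp F 2 (volume : Measure (Rd d))),
      LpToLpRestrictCLM (Rd d) F ℝ volume 2 Aᶜ f = 0 ↔
        ∀ᵐ x ∂(volume : Measure (Rd d)), x ∉ A → f x = 0 := by
    intro F _ _ f
    rw [Lp.eq_zero_iff_ae_eq_zero]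
    have h := LpToLpRestrictCLM_coeFn ℝ Aᶜ f
    constructor
    · intro h0
      exact (ae_restrict_iff' hA.compl).1 (h.symm.trans h0)
    · intro h0
      exact h.trans ((ae_restrict_iff' hA.compl).2 h0)
  have h2 : v ∈ zeroOff A ↔ LpToLpRestrictCLM (Rd d) (Rd d) ℝ volume 2 Aᶜ v.1 = 0 ∧
      LpToLpRestrictCLM (Rd d) (Rd d →L[ℝ] Rd d) ℝ volume 2 Aᶜ v.2 = 0 := Iff.rfl
  rw [h2, h1, h1, ← Filter.eventually_and]
  refine Filter.eventually_congr (Filter.Eventually.of_forall fun x => ?_)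
  tauto

theorem H10_le_zeroOff {Ω : Set (Rd d)} (hΩ : IsOpen Ω) : H10 Ω ≤ zeroOff Ω := by
  refine Submodule.topologicalClosure_minimal _ (Submodule.span_le.2 ?_) (isClosed_zeroOff Ω)
  rintro p ⟨φ, -, -, h3, h4, h5⟩
  refine (mem_zeroOff hΩ.measurableSet).2 ?_
  filter_upwards [h4, h5] with x h4 h5 hx
  have hx' : x ∉ tsupport φ := fun h => hx (h3 h)
  rw [h4, h5]
  exact ⟨image_eq_zero_of_notMem_tsupport hx',
    image_eq_zero_of_notMem_tsupport fun h => hx' (tsupport_fderiv_subset ℝ h)⟩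

end Multiplication

/-! ### The elastic energy density -/

section Density

variable {d : ℕ}

/-- The elastic energy density `2μ ε(G) : ε(G') + λ tr(G) tr(G')`. -/
def elasticDensity (l m : ℝ) (G G' : Rd d →L[ℝ] Rd d) : ℝ :=
  2 * m * (∑ i, ∑ j, strain G i j * strain G' i j) + l * divg G * divg G'

theorem strain_add (G G' : Rd d →L[ℝ] Rd d) (i j : Fin d) :
    strain (G + G') i j = strain G i j + strain G' i j := by
  simp only [strain, _root_.add_apply, PiLp.add_apply]; ring

theorem strain_smul (c : ℝ) (G : Rd d →L[ℝ] Rd d) (i j : Fin d) :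
    strain (c • G) i j = c * strain G i j := by
  simp only [strain, _root_.smul_apply, PiLp.smul_apply, smul_eq_mul]; ring

theorem divg_add (G G' : Rd d →L[ℝ] Rd d) : divg (G + G') = divg G + divg G' := by
  simp only [divg, _root_.add_apply, PiLp.add_apply, Finset.sum_add_distrib]

theorem divg_smul (c : ℝ) (G : Rd d →L[ℝ] Rd d) : divg (c • G) = c * divg G := by
  simp only [divg, _root_.smul_apply, PiLp.smul_apply, smul_eq_mul, Finset.mul_sum]

theorem abs_entry_le (G : Rd d →L[ℝ] Rd d) (i j : Fin d) :
    |G (EuclideanSpace.single j 1) i| ≤ ‖G‖ := by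
  have h1 := PiLp.norm_apply_le (G (EuclideanSpace.single j 1)) i
  have h2 := G.le_opNorm (EuclideanSpace.single j (1 : ℝ))
  rw [PiLp.norm_single, norm_one, mul_one] at h2
  exact h1.trans h2

theorem abs_strain_le (G : Rd d →L[ℝ] Rd d) (i j : Fin d) : |strain G i j| ≤ ‖G‖ := by
  rw [strain, abs_div, abs_two, div_le_iff₀ two_pos]
  have := abs_add_le (G (EuclideanSpace.single j 1) i) (G (EuclideanSpace.single i 1) j)
  linarith [abs_entry_le G i j, abs_entry_le G j i]

theorem abs_divg_le (G : Rd d →L[ℝ] Rd d) : |divg G| ≤ d * ‖G‖ := by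
  refine (Finset.abs_sum_le_sum_abs _ _).trans ?_
  refine (Finset.sum_le_card_nsmul _ _ ‖G‖ fun i _ => abs_entry_le G i i).trans ?_
  simp

theorem continuous_strain (i j : Fin d) :
    Continuous fun G : Rd d →L[ℝ] Rd d => strain G i j := by
  unfold strain; fun_prop

theorem continuous_divg : Continuous fun G : Rd d →L[ℝ] Rd d => divg G := by
  unfold divg; fun_prop

theorem abs_elasticDensity_le (l m : ℝ) (G G' : Rd d →L[ℝ] Rd d) :
    |elasticDensity l m G G'| ≤ (2 * |m| + |l|) * d ^ 2 * (‖G‖ * ‖G'‖) := by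
  have h1 : |∑ i, ∑ j, strain G i j * strain G' i j| ≤ d ^ 2 * (‖G‖ * ‖G'‖) := by
    refine (Finset.abs_sum_le_sum_abs _ _).trans ?_
    refine (Finset.sum_le_card_nsmul _ _ (d * (‖G‖ * ‖G'‖)) fun i _ => ?_).trans ?_
    · refine (Finset.abs_sum_le_sum_abs _ _).trans ?_
      refine (Finset.sum_le_card_nsmul _ _ (‖G‖ * ‖G'‖) fun j _ => ?_).trans ?_
      · rw [abs_mul]
        exact mul_le_mul (abs_strain_le G i j) (abs_strain_le G' i j) (abs_nonneg _)
          (norm_nonneg _)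
      · simp
    · simp; exact le_of_eq (by ring)
  have h2 : |divg G| * |divg G'| ≤ d ^ 2 * (‖G‖ * ‖G'‖) := by
    refine (mul_le_mul (abs_divg_le G) (abs_divg_le G') (abs_nonneg _) (by positivity)).trans ?_
    exact le_of_eq (by ring)
  rw [elasticDensity]
  refine (abs_add_le _ _).trans ?_
  rw [abs_mul, abs_mul, abs_mul, abs_mul, abs_two, mul_assoc |l|]
  have := mul_le_mul_of_nonneg_left h1 (by positivity : 0 ≤ 2 * |m|)
  have := mul_le_mul_of_nonneg_left h2 (abs_nonneg l)
  nlinarith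

theorem elasticDensity_symm (l m : ℝ) (G G' : Rd d →L[ℝ] Rd d) :
    elasticDensity l m G G' = elasticDensity l m G' G := by
  simp only [elasticDensity, mul_comm (strain G _ _)]; ring

theorem elasticDensity_add_left (l m : ℝ) (G₁ G₂ G' : Rd d →L[ℝ] Rd d) :
    elasticDensity l m (G₁ + G₂) G' = elasticDensity l m G₁ G' + elasticDensity l m G₂ G' := by
  simp only [elasticDensity, strain_add, divg_add, add_mul, Finset.sum_add_distrib]; ring

theorem elasticDensity_smul_left (l m c : ℝ) (G G' : Rd d →L[ℝ] Rd d) :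
    elasticDensity l m (c • G) G' = c * elasticDensity l m G G' := by
  simp only [elasticDensity, strain_smul, divg_smul, mul_assoc, ← Finset.mul_sum]; ring

theorem elasticDensity_nonneg {l m : ℝ} (hl : 0 ≤ l) (hm : 0 ≤ m) (G : Rd d →L[ℝ] Rd d) :
    0 ≤ elasticDensity l m G G := by
  refine add_nonneg (mul_nonneg (by positivity)
    (Finset.sum_nonneg fun i _ => Finset.sum_nonneg fun j _ => mul_self_nonneg _)) ?_
  rw [mul_assoc]
  exact mul_nonneg hl (mul_self_nonneg _)

/-- The energy density as a bilinear form. -/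
def elasticForm (l m : ℝ) : LinearMap.BilinForm ℝ (Rd d →L[ℝ] Rd d) :=
  LinearMap.mk₂ ℝ (elasticDensity l m) (elasticDensity_add_left l m)
    (fun c G G' => elasticDensity_smul_left l m c G G')
    (fun G G₁ G₂ => by
      rw [elasticDensity_symm, elasticDensity_add_left, elasticDensity_symm l m G₁,
        elasticDensity_symm l m G₂])
    (fun c G G' => by
      rw [elasticDensity_symm, elasticDensity_smul_left, elasticDensity_symm l m G', smul_eq_mul])

theorem elasticForm_apply (l m : ℝ) (G G' : Rd d →L[ℝ] Rd d) :
    elasticForm l m G G' = elasticDensity l m G G' := rfl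

theorem isPsd_elasticForm {l m : ℝ} (hl : 0 ≤ l) (hm : 0 ≤ m) :
    IsPsd (elasticForm (d := d) l m) :=
  ⟨elasticDensity_symm l m, elasticDensity_nonneg hl hm⟩

/-- The vector q of entries represents g, and evaluating g at q gives ‖q‖² ≤ ‖g‖ ‖q‖. -/
theorem sum_sq_entries_le (g : Rd d →L[ℝ] ℝ) :
    ∑ j, g (EuclideanSpace.single j 1) ^ 2 ≤ ‖g‖ ^ 2 := by
  set q : Rd d := WithLp.toLp 2 fun j => g (EuclideanSpace.single j 1) with hq
  have hq2 : ‖q‖ ^ 2 = ∑ j, g (EuclideanSpace.single j 1) ^ 2 := by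
    rw [EuclideanSpace.norm_sq_eq]; simp [hq]
  have hgq : g q = ‖q‖ ^ 2 := by
    have : q = ∑ j, q j • EuclideanSpace.single j (1 : ℝ) := by
      ext i; simp [Finset.sum_apply, Pi.single_apply]
    rw [hq2]
    conv_lhs => rw [this, map_sum]
    exact Finset.sum_congr rfl fun j _ => by simp [hq, sq]
  have h1 := g.le_opNorm q
  rw [hgq, Real.norm_of_nonneg (sq_nonneg _)] at h1
  rw [← hq2]
  rcases (norm_nonneg q).eq_or_lt with h | h
  · rw [← h, zero_pow two_ne_zero]; positivity
  · have : ‖q‖ ≤ ‖g‖ := by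
      refine le_of_mul_le_mul_right ?_ h
      linarith
    gcongr

/-- The energy density of a rank-one gradient `v ⊗ g`. -/
theorem elasticDensity_smulRight_le {l m : ℝ} (hl : 0 ≤ l) (hm : 0 ≤ m) (g : Rd d →L[ℝ] ℝ)
    (v : Rd d) : elasticDensity l m (g.smulRight v) (g.smulRight v) ≤
      (l + 2 * m) * ‖g‖ ^ 2 * ‖v‖ ^ 2 := by
  set q : Fin d → ℝ := fun j => g (EuclideanSpace.single j 1) with hq
  have hg : ∑ j, q j ^ 2 ≤ ‖g‖ ^ 2 := sum_sq_entries_le g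
  have hv : ∑ i, v i ^ 2 = ‖v‖ ^ 2 := by rw [EuclideanSpace.norm_sq_eq]; simp
  have hs : ∀ i j, strain (g.smulRight v) i j = (q j * v i + q i * v j) / 2 := by
    intro i j; simp [strain, hq]
  have hd : divg (g.smulRight v) = ∑ i, q i * v i := by simp [divg, hq]
  have hcs : (∑ i, q i * v i) ^ 2 ≤ (∑ j, q j ^ 2) * ∑ i, v i ^ 2 :=
    Finset.sum_mul_sq_le_sq_mul_sq _ _ _
  have hle : (∑ j, q j ^ 2) * ∑ i, v i ^ 2 ≤ ‖g‖ ^ 2 * ‖v‖ ^ 2 := by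
    rw [hv]; gcongr
  have hst : ∑ i, ∑ j, strain (g.smulRight v) i j * strain (g.smulRight v) i j ≤
      (∑ j, q j ^ 2) * ∑ i, v i ^ 2 := by
    have h1 : ∀ i j, strain (g.smulRight v) i j * strain (g.smulRight v) i j ≤
        (q j ^ 2 * v i ^ 2 + q i ^ 2 * v j ^ 2) / 2 := by
      intro i j
      rw [hs]
      -- This is (x + y)² ≤ 2 (x² + y²); symmetrization loses nothing after summation, so the
      -- constant is λ + 2μ as in κ̃.
      nlinarith [sq_nonneg (q j * v i - q i * v j)]
    refine (Finset.sum_le_sum fun i _ => Finset.sum_le_sum fun j _ => h1 i j).trans ?_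
    simp only [← Finset.sum_div, Finset.sum_add_distrib, ← Finset.mul_sum, ← Finset.sum_mul]
    linarith
  rw [elasticDensity, hd]
  have h1 := mul_le_mul_of_nonneg_left (hst.trans hle) (by positivity : 0 ≤ 2 * m)
  have h2 := mul_le_mul_of_nonneg_left (hcs.trans hle) hl
  nlinarith

end Density

/-! ### The forms a and s on the domain and on the cells -/

namespace ElasticSetup

variable {d : ℕ} {ρ : ℝ} {Nv : ℕ} (S : ElasticSetup d ρ Nv)

theorem aOn_eq (K : Set (Rd d)) (u v : H1Pair d) :
    S.aOn K u v = ∫ x in K, elasticDensity (S.lam x) (S.mu x) (u.2 x) (v.2 x) := rfl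

theorem integrableOn_elasticDensity {K : Set (Rd d)} (hK : K ⊆ S.dom) (u v : H1Pair d) :
    IntegrableOn (fun x => elasticDensity (S.lam x) (S.mu x) (u.2 x) (v.2 x)) K := by
  refine IntegrableOn.mono_set ?_ hK
  obtain ⟨M, hM⟩ := S.lame_bdd
  have hu := Lp.memLp u.2
  have hv := Lp.memLp v.2
  have hint : Integrable (fun x => 3 * M * d ^ 2 * (‖u.2 x‖ * ‖v.2 x‖)) (volume.restrict S.dom) :=
    ((hu.norm.integrable_mul hv.norm).const_mul _).integrableOn
  refine hint.mono' ?_ ?_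
  · have hu' := (Lp.aestronglyMeasurable u.2).restrict (s := S.dom)
    have hv' := (Lp.aestronglyMeasurable v.2).restrict (s := S.dom)
    have hst : ∀ i j, AEStronglyMeasurable (fun x => strain (u.2 x) i j * strain (v.2 x) i j)
        (volume.restrict S.dom) := fun i j =>
      ((continuous_strain i j).comp_aestronglyMeasurable hu').mul
        ((continuous_strain i j).comp_aestronglyMeasurable hv')
    have hsum : AEStronglyMeasurable
        (fun x => ∑ i, ∑ j, strain (u.2 x) i j * strain (v.2 x) i j) (volume.restrict S.dom) :=
      Finset.aestronglyMeasurable_fun_sum _ fun i _ =>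
        Finset.aestronglyMeasurable_fun_sum _ fun j _ => hst i j
    have hl := S.lam_meas.aestronglyMeasurable (μ := volume.restrict S.dom)
    have hm := S.mu_meas.aestronglyMeasurable (μ := volume.restrict S.dom)
    exact ((hm.const_mul 2).mul hsum).add
      ((hl.mul (continuous_divg.comp_aestronglyMeasurable hu')).mul
        (continuous_divg.comp_aestronglyMeasurable hv'))
  · filter_upwards [hM, S.lame_pos] with x h1 h2
    refine (abs_elasticDensity_le _ _ _ _).trans ?_
    rw [abs_of_pos h2.1, abs_of_pos h2.2]
    gcongr
    linarith

theorem integrableOn_elasticForm {K : Set (Rd d)} (hK : K ⊆ S.dom) (u v : H1Pair d) :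
    IntegrableOn (fun x => elasticForm (S.lam x) (S.mu x) (u.2 x) (v.2 x)) K :=
  S.integrableOn_elasticDensity hK u v

theorem kappa_measurable : Measurable S.kappa := by
  unfold kappa
  exact Finset.measurable_fun_sum _ fun j _ =>
    (S.lam_meas.add (S.mu_meas.const_mul 2)).mul
      ((measurable_fderiv ℝ (S.chi j)).norm.pow_const 2)

theorem kappa_bounded : ∃ M : ℝ, 0 ≤ M ∧ ∀ᵐ x ∂(volume.restrict S.dom), S.kappa x ≤ M := by
  obtain ⟨M, hM⟩ := S.lame_bdd
  choose L hL using S.chi_lipschitz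
  refine ⟨∑ j, 3 * |M| * L j ^ 2, Finset.sum_nonneg fun j _ => by positivity, ?_⟩
  filter_upwards [hM, S.lame_pos, ae_restrict_mem S.dom_open.measurableSet] with x h1 h2 hx
  refine Finset.sum_le_sum fun j _ => ?_
  have h3 := norm_fderiv_le_of_lipschitzOn ℝ (S.dom_open.mem_nhds hx) (hL j)
  have h4 := le_abs_self M
  gcongr
  linarith

theorem kappa_pos : ∀ᵐ x ∂(volume.restrict S.dom), 0 < S.kappa x := S.weight_pos

theorem integrableOn_weighted {K : Set (Rd d)} (hK : K ⊆ S.dom) (u v : H1Pair d) :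
    IntegrableOn (fun x => S.kappa x * inner ℝ (u.1 x) (v.1 x)) K := by
  refine IntegrableOn.mono_set ?_ hK
  obtain ⟨M, -, hM⟩ := S.kappa_bounded
  have hu := Lp.memLp u.1
  have hv := Lp.memLp v.1
  have hint : Integrable (fun x => M * (‖u.1 x‖ * ‖v.1 x‖)) (volume.restrict S.dom) :=
    ((hu.norm.integrable_mul hv.norm).const_mul _).integrableOn
  refine hint.mono' ?_ ?_
  · exact S.kappa_measurable.aestronglyMeasurable.mul
      ((Lp.aestronglyMeasurable u.1).restrict.inner (Lp.aestronglyMeasurable v.1).restrict)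
  · filter_upwards [hM, S.kappa_pos] with x h1 h2
    rw [norm_mul, Real.norm_of_nonneg h2.le]
    exact mul_le_mul h1 (norm_inner_le_norm _ _) (norm_nonneg _) (h2.le.trans h1)

/-- The form `a` on a part `K` of the domain. -/
def aForm (K : Set (Rd d)) (hK : K ⊆ S.dom) : LinearMap.BilinForm ℝ (H1Pair d) :=
  LinearMap.mk₂ ℝ (fun u v => ∫ x in K, elasticForm (S.lam x) (S.mu x) (u.2 x) (v.2 x))
    (fun u u' v => by
      rw [← integral_add (S.integrableOn_elasticForm hK u v)
        (S.integrableOn_elasticForm hK u' v)]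
      refine integral_congr_ae (ae_restrict_of_ae ?_)
      filter_upwards [Lp.coeFn_add u.2 u'.2] with x hx
      rw [Prod.snd_add, hx, Pi.add_apply, map_add, LinearMap.add_apply])
    (fun c u v => by
      rw [smul_eq_mul, ← integral_const_mul]
      refine integral_congr_ae (ae_restrict_of_ae ?_)
      filter_upwards [Lp.coeFn_smul c u.2] with x hx
      rw [Prod.smul_snd, hx, Pi.smul_apply, map_smul, LinearMap.smul_apply, smul_eq_mul])
    (fun u v v' => by
      rw [← integral_add (S.integrableOn_elasticForm hK u v)
        (S.integrableOn_elasticForm hK u v')]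
      refine integral_congr_ae (ae_restrict_of_ae ?_)
      filter_upwards [Lp.coeFn_add v.2 v'.2] with x hx
      rw [Prod.snd_add, hx, Pi.add_apply, map_add])
    (fun c u v => by
      rw [smul_eq_mul, ← integral_const_mul]
      refine integral_congr_ae (ae_restrict_of_ae ?_)
      filter_upwards [Lp.coeFn_smul c v.2] with x hx
      rw [Prod.smul_snd, hx, Pi.smul_apply, map_smul, smul_eq_mul])

theorem aForm_apply {K : Set (Rd d)} (hK : K ⊆ S.dom) (u v : H1Pair d) :
    S.aForm K hK u v = ∫ x in K, elasticDensity (S.lam x) (S.mu x) (u.2 x) (v.2 x) := rfl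

/-- The weighted `L²` product on a part `K` of the domain. -/
def sForm (K : Set (Rd d)) (hK : K ⊆ S.dom) : LinearMap.BilinForm ℝ (H1Pair d) :=
  LinearMap.mk₂ ℝ (fun u v => ∫ x in K, S.kappa x * inner ℝ (u.1 x) (v.1 x))
    (fun u u' v => by
      rw [← integral_add (S.integrableOn_weighted hK u v) (S.integrableOn_weighted hK u' v)]
      refine integral_congr_ae (ae_restrict_of_ae ?_)
      filter_upwards [Lp.coeFn_add u.1 u'.1] with x hx
      rw [Prod.fst_add, hx, Pi.add_apply, inner_add_left, mul_add])
    (fun c u v => by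
      rw [smul_eq_mul, ← integral_const_mul]
      refine integral_congr_ae (ae_restrict_of_ae ?_)
      filter_upwards [Lp.coeFn_smul c u.1] with x hx
      rw [Prod.smul_fst, hx, Pi.smul_apply, real_inner_smul_left]; ring)
    (fun u v v' => by
      rw [← integral_add (S.integrableOn_weighted hK u v) (S.integrableOn_weighted hK u v')]
      refine integral_congr_ae (ae_restrict_of_ae ?_)
      filter_upwards [Lp.coeFn_add v.1 v'.1] with x hx
      rw [Prod.fst_add, hx, Pi.add_apply, inner_add_right, mul_add])
    (fun c u v => by
      rw [smul_eq_mul, ← integral_const_mul]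
      refine integral_congr_ae (ae_restrict_of_ae ?_)
      filter_upwards [Lp.coeFn_smul c v.1] with x hx
      rw [Prod.smul_fst, hx, Pi.smul_apply, real_inner_smul_right]; ring)

theorem sForm_apply {K : Set (Rd d)} (hK : K ⊆ S.dom) (u v : H1Pair d) :
    S.sForm K hK u v = ∫ x in K, S.kappa x * inner ℝ (u.1 x) (v.1 x) := rfl

theorem isPsd_aForm {K : Set (Rd d)} (hK : K ⊆ S.dom) : IsPsd (S.aForm K hK) where
  symm u v := by
    simp only [aForm_apply]
    exact integral_congr_ae (Filter.Eventually.of_forall fun x => elasticDensity_symm _ _ _ _)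
  nonneg u := by
    refine integral_nonneg_of_ae ?_
    filter_upwards [ae_restrict_of_ae_restrict_of_subset hK S.lame_pos] with x hx
    exact elasticDensity_nonneg hx.1.le hx.2.le _

theorem isPsd_sForm {K : Set (Rd d)} (hK : K ⊆ S.dom) : IsPsd (S.sForm K hK) where
  symm u v := by
    simp only [sForm_apply]
    exact integral_congr_ae (Filter.Eventually.of_forall fun x => by
      dsimp only; rw [real_inner_comm])
  nonneg u := by
    refine integral_nonneg_of_ae ?_
    filter_upwards [ae_restrict_of_ae_restrict_of_subset hK S.kappa_pos] with x hx
    exact mul_nonneg hx.le real_inner_self_nonneg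

/-- The part of the interior of a cell inside the domain. -/
def core (k : Fin S.N) : Set (Rd d) := interior (S.cell k) ∩ S.dom

theorem core_subset (k : Fin S.N) : S.core k ⊆ S.dom := Set.inter_subset_right

theorem isOpen_core (k : Fin S.N) : IsOpen (S.core k) := isOpen_interior.inter S.dom_open

theorem core_disjoint : Pairwise (Function.onFun Disjoint S.core) := fun i j hij =>
  (S.cell_disjoint i j hij).mono Set.inter_subset_left Set.inter_subset_left

theorem cell_ae_interior (k : Fin S.N) :
    (interior (S.cell k) : Set (Rd d)) =ᵐ[volume] S.cell k :=
  interior_ae_eq_of_null_frontier (S.cell_frontier k)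

theorem dom_ae_core : (⋃ k, S.core k : Set (Rd d)) =ᵐ[volume] S.dom := by
  have h1 : (⋃ k, S.core k : Set (Rd d)) =ᵐ[volume] (⋃ k, S.cell k ∩ S.dom : Set (Rd d)) :=
    Filter.EventuallyEq.countable_iUnion fun k =>
      (S.cell_ae_interior k).inter (Filter.EventuallyEq.refl _ _)
  have h2 : (⋃ k, S.cell k ∩ S.dom) = S.dom := by
    rw [← Set.iUnion_inter, S.cell_cover]
    exact Set.inter_eq_right.2 subset_closure
  rwa [h2] at h1

theorem sum_setIntegral_core {g : Rd d → ℝ} (hg : IntegrableOn g S.dom) :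
    ∑ k, ∫ x in S.core k, g x = ∫ x in S.dom, g x := by
  rw [← setIntegral_congr_set S.dom_ae_core, integral_iUnion
    (fun k => (S.isOpen_core k).measurableSet) S.core_disjoint
    (hg.mono_set (Set.iUnion_subset S.core_subset)), tsum_fintype]

/-- The form `a` on the cell `K_k`. -/
def aCell (k : Fin S.N) : LinearMap.BilinForm ℝ (H1Pair d) := S.aForm (S.core k) (S.core_subset k)

/-- The form `s` on the cell `K_k`. -/
def sCell (k : Fin S.N) : LinearMap.BilinForm ℝ (H1Pair d) := S.sForm (S.core k) (S.core_subset k)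

theorem sum_aCell (u v : H1Pair d) : ∑ k, S.aCell k u v = S.a u v :=
  S.sum_setIntegral_core (S.integrableOn_elasticDensity subset_rfl u v)

theorem sum_sCell (u : H1Pair d) : ∑ k, S.sCell k u u = S.sNorm u.1 ^ 2 := by
  rw [sNorm, Real.sq_sqrt]
  · have := S.sum_setIntegral_core (S.integrableOn_weighted subset_rfl u u)
    simp only [real_inner_self_eq_norm_sq] at this
    rw [← this]
    simp only [sCell, sForm_apply, real_inner_self_eq_norm_sq]
  · refine integral_nonneg_of_ae ?_
    filter_upwards [S.kappa_pos] with x hx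
    exact mul_nonneg hx.le (sq_nonneg _)

/-- The boundary of the domain may have positive measure, so a cell can exceed its core
substantially; the hypothesis on g removes that part, and the boundary of the cell is null. -/
theorem setIntegral_cell_eq_core (k : Fin S.N) {g : Rd d → ℝ}
    (hg : ∀ᵐ x ∂(volume : Measure (Rd d)), x ∉ S.dom → g x = 0) :
    ∫ x in S.cell k, g x = ∫ x in S.core k, g x := by
  rw [← setIntegral_congr_set (S.cell_ae_interior k), core,
    ← setIntegral_eq_of_subset_of_ae_sdiff_eq_zero isOpen_interior.measurableSet.nullMeasurableSet
      Set.inter_subset_left]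
  filter_upwards [hg] with x hx hxm
  exact hx fun h => hxm.2 ⟨hxm.1, h⟩

theorem aOn_cell (k : Fin S.N) (u : H1Pair d) {v : H1Pair d} (hv : v ∈ zeroOff S.dom) :
    S.aOn (S.cell k) u v = S.aCell k u v := by
  rw [aOn_eq, aCell, aForm_apply]
  refine S.setIntegral_cell_eq_core k ?_
  filter_upwards [(mem_zeroOff S.dom_open.measurableSet).1 hv] with x hx hxd
  rw [(hx hxd).2]
  simp [elasticDensity, strain, divg]

theorem sLoc_eq (k : Fin S.N) (u : H1Pair d) {v : H1Pair d} (hv : v ∈ zeroOff S.dom) :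
    S.sLoc k u.1 v.1 = S.sCell k u v := by
  rw [sLoc, sCell, sForm_apply]
  refine S.setIntegral_cell_eq_core k ?_
  filter_upwards [(mem_zeroOff S.dom_open.measurableSet).1 hv] with x hx hxd
  rw [(hx hxd).1, inner_zero_right, mul_zero]

theorem V_le_zeroOff : S.V ≤ zeroOff S.dom := H10_le_zeroOff S.dom_open

end ElasticSetup

/-! ### Orthogonal families and the local spectral estimate -/

section OrthogonalFamilies

variable {X ι : Type*} [AddCommGroup X] [Module ℝ X] [Fintype ι]

theorem form_sum_of_orthogonal {b : LinearMap.BilinForm ℝ X} {g : ι → X}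
    (h : ∀ i j, i ≠ j → b (g i) (g j) = 0) (c : ι → ℝ) :
    b (∑ i, c i • g i) (∑ i, c i • g i) = ∑ i, c i ^ 2 * b (g i) (g i) := by
  simp only [map_sum, LinearMap.sum_apply, map_smul, LinearMap.smul_apply, smul_eq_mul]
  refine Finset.sum_congr rfl fun i _ => ?_
  rw [Finset.sum_eq_single i]
  · ring
  · intro j _ hj; rw [h j i hj]; ring
  · simp

theorem linearIndependent_of_orthogonal {s : LinearMap.BilinForm ℝ X} {g : ι → X}
    (h : ∀ i j, i ≠ j → s (g i) (g j) = 0) (hpos : ∀ i, 0 < s (g i) (g i)) :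
    LinearIndependent ℝ g := by
  refine Fintype.linearIndependent_iff.2 fun c hc i => ?_
  have h1 := form_sum_of_orthogonal h c
  rw [hc, map_zero] at h1
  have h2 := (Finset.sum_eq_zero_iff_of_nonneg
    fun i _ => mul_nonneg (sq_nonneg (c i)) (hpos i).le).1 h1.symm i (Finset.mem_univ i)
  rcases mul_eq_zero.1 h2 with h3 | h3
  · exact pow_eq_zero_iff two_ne_zero |>.1 h3
  · exact absurd h3 (hpos i).ne'

end OrthogonalFamilies

namespace ElasticSetup

variable {d : ℕ} {ρ : ℝ} {Nv : ℕ} (S : ElasticSetup d ρ Nv)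

theorem VLoc_le_zeroOff (i : Fin S.N) : S.VLoc i ≤ zeroOff (S.core i) := by
  refine Submodule.topologicalClosure_minimal _ (Submodule.span_le.2 ?_) (isClosed_zeroOff _)
  rintro p ⟨v, hv, h1, h2⟩
  refine (mem_zeroOff (S.isOpen_core i).measurableSet).2 ?_
  filter_upwards [h1, h2, (mem_zeroOff S.dom_open.measurableSet).1 (S.V_le_zeroOff hv),
    (S.cell_ae_interior i).mem_iff] with x h1 h2 h3 h4 hx
  rw [h1, h2]
  by_cases hc : x ∈ S.cell i
  · rw [Set.indicator_of_mem hc, Set.indicator_of_mem hc]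
    exact h3 fun hd => hx ⟨h4.2 hc, hd⟩
  · rw [Set.indicator_of_notMem hc, Set.indicator_of_notMem hc]
    exact ⟨rfl, rfl⟩

theorem zeroOff_core_le (i : Fin S.N) : zeroOff (S.core i) ≤ zeroOff S.dom := by
  intro v hv
  rw [mem_zeroOff S.dom_open.measurableSet]
  filter_upwards [(mem_zeroOff (S.isOpen_core i).measurableSet).1 hv] with x hx hxd
  exact hx fun h => hxd h.2

theorem VLoc_le_zeroOff_dom (i : Fin S.N) : S.VLoc i ≤ zeroOff S.dom :=
  (S.VLoc_le_zeroOff i).trans (S.zeroOff_core_le i)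

theorem aCell_congr_left (k : Fin S.N) {u u' : H1Pair d}
    (h : ∀ᵐ x ∂(volume : Measure (Rd d)), x ∈ S.core k → u.2 x = u'.2 x) (v : H1Pair d) :
    S.aCell k u v = S.aCell k u' v := by
  refine setIntegral_congr_ae (S.isOpen_core k).measurableSet ?_
  filter_upwards [h] with x hx hxk
  rw [hx hxk]

theorem sCell_congr_left (k : Fin S.N) {u u' : H1Pair d}
    (h : ∀ᵐ x ∂(volume : Measure (Rd d)), x ∈ S.core k → u.1 x = u'.1 x) (v : H1Pair d) :
    S.sCell k u v = S.sCell k u' v := by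
  refine setIntegral_congr_ae (S.isOpen_core k).measurableSet ?_
  filter_upwards [h] with x hx hxk
  rw [hx hxk]

theorem isPsd_aCell (k : Fin S.N) : IsPsd (S.aCell k) := S.isPsd_aForm _

theorem isPsd_sCell (k : Fin S.N) : IsPsd (S.sCell k) := S.isPsd_sForm _

/-- Transfers estimates on V(K_i), where the eigenfunctions live, to elements of V: the cell forms
only see the restriction. -/
theorem exists_restriction (i : Fin S.N) {v : H1Pair d} (hv : v ∈ S.V) :
    ∃ p ∈ S.VLoc i, S.aCell i p p = S.aCell i v v ∧ S.sCell i p p = S.sCell i v v ∧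
      ∀ w, S.sCell i p w = S.sCell i v w := by
  have hm := (S.cell_compact i).measurableSet
  set p : H1Pair d := (((Lp.memLp v.1).indicator hm).toLp _, ((Lp.memLp v.2).indicator hm).toLp _)
  have h1 : (p.1 : Rd d → Rd d) =ᵐ[volume] (S.cell i).indicator (v.1 : Rd d → Rd d) :=
    ((Lp.memLp v.1).indicator hm).coeFn_toLp
  have h2 : (p.2 : Rd d → (Rd d →L[ℝ] Rd d)) =ᵐ[volume]
      (S.cell i).indicator (v.2 : Rd d → (Rd d →L[ℝ] Rd d)) :=
    ((Lp.memLp v.2).indicator hm).coeFn_toLp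
  have e1 : ∀ᵐ x ∂(volume : Measure (Rd d)), x ∈ S.core i → p.1 x = v.1 x := by
    filter_upwards [h1] with x hx hc
    rw [hx, Set.indicator_of_mem (interior_subset hc.1)]
  have e2 : ∀ᵐ x ∂(volume : Measure (Rd d)), x ∈ S.core i → p.2 x = v.2 x := by
    filter_upwards [h2] with x hx hc
    rw [hx, Set.indicator_of_mem (interior_subset hc.1)]
  refine ⟨p, Submodule.le_topologicalClosure _ (Submodule.subset_span ⟨v, hv, h1, h2⟩), ?_, ?_,
    S.sCell_congr_left i e1⟩
  · rw [S.aCell_congr_left i e2, (S.isPsd_aCell i).symm, S.aCell_congr_left i e2]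
  · rw [S.sCell_congr_left i e1, (S.isPsd_sCell i).symm, S.sCell_congr_left i e1]

theorem eigval_le (i : Fin S.N) (k : ℕ) {W : Submodule ℝ (H1Pair d)} (hW : W ≤ S.VLoc i)
    (hdim : Module.finrank ℝ W = k + 1) {r : ℝ}
    (hpos : ∀ w ∈ W, w ≠ 0 → 0 < S.sCell i w w)
    (hr : ∀ w ∈ W, S.aCell i w w ≤ r * S.sCell i w w) : S.eigval i k ≤ r := by
  have ha : ∀ W' : Submodule ℝ (H1Pair d), W' ≤ S.VLoc i → ∀ w ∈ W',
      S.aOn (S.cell i) w w = S.aCell i w w := fun W' h w hw =>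
    S.aOn_cell i w (S.VLoc_le_zeroOff_dom i (h hw))
  have hs : ∀ W' : Submodule ℝ (H1Pair d), W' ≤ S.VLoc i → ∀ w ∈ W',
      S.sLoc i w.1 w.1 = S.sCell i w w := fun W' h w hw =>
    S.sLoc_eq i w (S.VLoc_le_zeroOff_dom i (h hw))
  -- The infimum needs a lower bound: 0 is one, since a_i ≥ 0 and s_i > 0 on some vector of each
  -- competing subspace.
  refine csInf_le ⟨0, ?_⟩ ⟨W, hW, hdim, ?_, ?_⟩
  · rintro r' ⟨W', hW', hd', hp', hr'⟩
    have : Nontrivial W' := Module.nontrivial_of_finrank_pos (R := ℝ) (by omega)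
    obtain ⟨⟨w, hw⟩, hw0⟩ := exists_ne (0 : W')
    have hw0' : w ≠ 0 := fun h => hw0 (Subtype.ext h)
    have h1 := hp' w hw hw0'
    have h2 := hr' w hw
    rw [ha W' hW' w hw] at h2
    have h3 := (S.isPsd_aCell i).nonneg w
    by_contra! h
    have := mul_neg_of_neg_of_pos h h1
    linarith
  · intro w hw hw0
    rw [hs W hW w hw]; exact hpos w hw hw0
  · intro w hw
    rw [hs W hW w hw, ha W hW w hw]; exact hr w hw

namespace AuxBasis

variable {S} (B : S.AuxBasis)

theorem phi_mem_zeroOff (i : Fin S.N) (j : Fin (B.J i)) : B.phi i j ∈ zeroOff S.dom :=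
  S.VLoc_le_zeroOff_dom i (B.phi_mem i j)

theorem sCell_phi_phi (i : Fin S.N) (j k : Fin (B.J i)) :
    S.sCell i (B.phi i j) (B.phi i k) = if j = k then 1 else 0 := by
  rw [← S.sLoc_eq i _ (B.phi_mem_zeroOff i k), B.phi_orthonormal]

theorem aCell_phi (i : Fin S.N) (j : Fin (B.J i)) {v : H1Pair d} (hv : v ∈ S.VLoc i) :
    S.aCell i (B.phi i j) v = S.eigval i j * S.sCell i (B.phi i j) v := by
  have h0 := S.VLoc_le_zeroOff_dom i hv
  rw [← S.sLoc_eq i _ h0, ← S.aOn_cell i _ h0, B.phi_eigen i j v hv]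

theorem sCell_phi_of_ne {i k : Fin S.N} (h : k ≠ i) (j : Fin (B.J i)) (v : H1Pair d) :
    S.sCell k (B.phi i j) v = 0 := by
  rw [S.sCell_congr_left k (u' := 0), map_zero, LinearMap.zero_apply]
  have h1 := (mem_zeroOff (S.isOpen_core i).measurableSet).1
    (S.VLoc_le_zeroOff i (B.phi_mem i j))
  filter_upwards [h1, Lp.coeFn_zero (Rd d) 2 (volume : Measure (Rd d))] with x hx h0 hxk
  rw [(hx fun hxi => Set.disjoint_left.1 (S.core_disjoint h) hxk hxi).1]
  exact h0.symm

/-- The Rayleigh quotient on the orthogonal complement of the eigenfunctions. -/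
theorem eigval_mul_le (i : Fin S.N) {r : H1Pair d} (hr : r ∈ S.VLoc i)
    (horth : ∀ j, S.sCell i (B.phi i j) r = 0) :
    S.eigval i (B.J i) * S.sCell i r r ≤ S.aCell i r r := by
  have hs := S.isPsd_sCell i
  have ha := S.isPsd_aCell i
  rcases (hs.nonneg r).eq_or_lt with h0 | h0
  · rw [← h0, mul_zero]; exact ha.nonneg r
  set q := S.aCell i r r / S.sCell i r r with hq
  have hqr : S.aCell i r r = q * S.sCell i r r := by rw [hq]; field_simp
  -- The span of r and the first k eigenfunctions is a competitor for eigenvalue number k. Its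
  -- Rayleigh quotients are at most the maximum of q and the preceding eigenvalues, and those are at
  -- most q by induction. Neither monotonicity of the eigenvalues nor compactness is needed.
  suffices h : ∀ k, k ≤ B.J i → S.eigval i k ≤ q by
    rw [hqr]; exact mul_le_mul_of_nonneg_right (h _ le_rfl) h0.le
  intro k
  induction k using Nat.strong_induction_on with
  | _ k ih =>
    intro hk
    let g : Option (Fin k) → H1Pair d := fun o => o.elim r fun j => B.phi i (Fin.castLE hk j)
    have hg0 : g none = r := rfl
    have hgs : ∀ j, g (some j) = B.phi i (Fin.castLE hk j) := fun j => rfl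
    have hgV : ∀ o, g o ∈ S.VLoc i := by
      rintro (_ | j)
      exacts [hr, B.phi_mem i _]
    have hso : ∀ o o', o ≠ o' → S.sCell i (g o) (g o') = 0 := by
      rintro (_ | j) (_ | j') h
      · exact absurd rfl h
      · rw [hs.symm, hg0, hgs, horth]
      · rw [hg0, hgs, horth]
      · rw [hgs, hgs, B.sCell_phi_phi, if_neg]
        intro hjj
        exact h (congrArg some (Fin.castLE_injective hk hjj))
    have hsp : ∀ o, 0 < S.sCell i (g o) (g o) := by
      rintro (_ | j)
      · exact h0
      · rw [hgs, B.sCell_phi_phi, if_pos rfl]; exact one_pos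
    have hao : ∀ o o', o ≠ o' → S.aCell i (g o) (g o') = 0 := by
      rintro (_ | j) o' h
      · rcases o' with _ | j'
        · exact absurd rfl h
        · rw [ha.symm, hgs, B.aCell_phi i _ (hgV none), ← hgs, hso _ _ h.symm, mul_zero]
      · rw [hgs, B.aCell_phi i _ (hgV o'), ← hgs, hso _ _ h, mul_zero]
    have had : ∀ o, S.aCell i (g o) (g o) ≤ q * S.sCell i (g o) (g o) := by
      rintro (_ | j)
      · exact hqr.le
      · rw [hgs, B.aCell_phi i _ (B.phi_mem i _), B.sCell_phi_phi, if_pos rfl, mul_one, mul_one]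
        exact ih j j.2 (j.2.le.trans hk)
    have hmem : ∀ w ∈ Submodule.span ℝ (Set.range g), ∃ c : Option (Fin k) → ℝ,
        ∑ o, c o • g o = w := fun w hw => (Submodule.mem_span_range_iff_exists_fun ℝ).1 hw
    refine S.eigval_le i k (W := Submodule.span ℝ (Set.range g)) ?_ ?_ ?_ ?_
    · exact Submodule.span_le.2 (Set.range_subset_iff.2 hgV)
    · rw [finrank_span_eq_card (linearIndependent_of_orthogonal hso hsp)]
      simp
    · intro w hw hw0
      obtain ⟨c, rfl⟩ := hmem w hw
      rw [form_sum_of_orthogonal hso]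
      obtain ⟨o, ho⟩ : ∃ o, c o ≠ 0 := by
        by_contra! h
        exact hw0 (by simp [h])
      exact Finset.sum_pos' (fun o _ => mul_nonneg (sq_nonneg _) (hsp o).le)
        ⟨o, Finset.mem_univ o, mul_pos (by positivity) (hsp o)⟩
    · intro w hw
      obtain ⟨c, rfl⟩ := hmem w hw
      rw [form_sum_of_orthogonal hso, form_sum_of_orthogonal hao, Finset.mul_sum]
      refine Finset.sum_le_sum fun o _ => ?_
      have := mul_le_mul_of_nonneg_left (had o) (sq_nonneg (c o))
      linarith

/-- The coefficients `s_i(v, φ_j^i)` of `π v`. -/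
def coef : H1Pair d →ₗ[ℝ] EuclideanSpace ℝ (Σ i, Fin (B.J i)) :=
  (WithLp.linearEquiv 2 ℝ _).symm.toLinearMap ∘ₗ
    LinearMap.pi fun q => (S.sCell q.1).flip (B.phi q.1 q.2)

theorem coef_apply (v : H1Pair d) (q : Σ i, Fin (B.J i)) :
    B.coef v q = S.sCell q.1 v (B.phi q.1 q.2) := rfl

theorem coef_phi (i : Fin S.N) (j : Fin (B.J i)) :
    B.coef (B.phi i j) = EuclideanSpace.single (⟨i, j⟩ : Σ i, Fin (B.J i)) 1 := by
  ext ⟨k, l⟩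
  rw [coef_apply]
  by_cases h : k = i
  · subst h
    rw [B.sCell_phi_phi]
    simp [eq_comm]
  · rw [B.sCell_phi_of_ne h]
    have : (⟨k, l⟩ : Σ i, Fin (B.J i)) ≠ ⟨i, j⟩ := fun he => h (congrArg Sigma.fst he)
    simp [this]

theorem Lam_le (i : Fin S.N) : B.Lam ≤ S.eigval i (B.J i) :=
  ciInf_le (Set.finite_range _).bddBelow i

theorem remainder_identity (k : Fin S.N) (v : H1Pair d) :
    S.sCell k (v - ∑ j, S.sCell k v (B.phi k j) • B.phi k j)
      (v - ∑ j, S.sCell k v (B.phi k j) • B.phi k j) =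
      S.sCell k v v - ∑ j, S.sCell k v (B.phi k j) ^ 2 := by
  rw [(S.isPsd_sCell k).expand_sub, form_sum_of_orthogonal]
  · simp only [map_sum, map_smul, smul_eq_mul, B.sCell_phi_phi, if_true, mul_one, sq]
    ring
  · intro i j hij
    rw [B.sCell_phi_phi, if_neg hij]

theorem bessel (k : Fin S.N) (v : H1Pair d) :
    ∑ j, S.sCell k v (B.phi k j) ^ 2 ≤ S.sCell k v v := by
  have := (S.isPsd_sCell k).nonneg (v - ∑ j, S.sCell k v (B.phi k j) • B.phi k j)
  rw [B.remainder_identity] at this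
  linarith

/-- Subtracting the s-projection q onto the eigenfunctions leaves a remainder with Rayleigh quotient
at least Λ. Since q is a combination of eigenfunctions, the remainder is also a-orthogonal to q, so
its energy is at most that of p. -/
theorem spectral_estimate_local (hΛ : 0 < B.Lam) (k : Fin S.N) {p : H1Pair d}
    (hp : p ∈ S.VLoc k) :
    S.sCell k p p ≤ ∑ j, S.sCell k p (B.phi k j) ^ 2 + B.Lam⁻¹ * S.aCell k p p := by
  have hs := S.isPsd_sCell k
  have ha := S.isPsd_aCell k
  have hid := B.remainder_identity k p
  obtain ⟨q, hq⟩ : ∃ q, q = ∑ j, S.sCell k p (B.phi k j) • B.phi k j := ⟨_, rfl⟩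
  have hqV : q ∈ S.VLoc k := by
    rw [hq]
    exact Submodule.sum_mem _ fun j _ => Submodule.smul_mem _ _ (B.phi_mem k j)
  have hrV : p - q ∈ S.VLoc k := Submodule.sub_mem _ hp hqV
  have horth : ∀ j, S.sCell k (B.phi k j) (p - q) = 0 := by
    intro j
    rw [map_sub, hq, map_sum]
    simp only [map_smul, smul_eq_mul, B.sCell_phi_phi, mul_ite, mul_one, mul_zero,
      Finset.sum_ite_eq, Finset.mem_univ, if_true]
    rw [hs.symm, sub_self]
  have h1 := B.eigval_mul_le k hrV horth
  have h2 : S.aCell k q (p - q) = 0 := by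
    have h : ∀ w, w = p - q → S.aCell k q w = 0 := by
      rintro w rfl
      generalize p - q = r at hrV horth
      rw [hq, LinearMap.map_sum₂]
      refine Finset.sum_eq_zero fun j _ => ?_
      rw [LinearMap.map_smul₂, B.aCell_phi k j hrV, horth, mul_zero, smul_zero]
    exact h _ rfl
  have h3 : S.aCell k (p - q) (p - q) ≤ S.aCell k p p := by
    have e : S.aCell k p p = S.aCell k (q + (p - q)) (q + (p - q)) := by
      rw [add_sub_cancel]
    rw [e, ha.expand_add, h2]
    linarith [ha.nonneg q]
  rw [← hq] at hid
  have h4 := mul_le_mul_of_nonneg_right (B.Lam_le k) (hs.nonneg (p - q))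
  have h5 : S.sCell k (p - q) (p - q) ≤ B.Lam⁻¹ * S.aCell k p p := by
    rw [inv_mul_eq_div, le_div_iff₀ hΛ]
    linarith
  rw [hid] at h5
  linarith

/-- The spectral estimate for the projection `π` on a cell. -/
theorem spectral_estimate (hΛ : 0 < B.Lam) (k : Fin S.N) {v : H1Pair d} (hv : v ∈ S.V) :
    S.sCell k v v ≤ ∑ j, S.sCell k v (B.phi k j) ^ 2 + B.Lam⁻¹ * S.aCell k v v := by
  obtain ⟨p, hp, hpa, hps, hpw⟩ := S.exists_restriction k hv
  have h := B.spectral_estimate_local hΛ k hp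
  rw [hpa, hps] at h
  simpa only [hpw] using h

end AuxBasis

end ElasticSetup

/-! ### Gradients of cutoff functions -/

section CutoffTools

open Filter Topology

/-- Compares difference quotients in each direction. It serves to estimate the gradient of a
truncated cutoff without a chain rule for the maximum. -/
theorem norm_fderiv_le_of_dominated {E : Type*} [NormedAddCommGroup E] [NormedSpace ℝ E]
    {f g : E → ℝ} {x : E} {c : ℝ} (hc : 0 ≤ c) (hf : DifferentiableAt ℝ f x)
    (hg : DifferentiableAt ℝ g x) (h : ∀ y, |g y - g x| ≤ c * |f y - f x|) :
    ‖fderiv ℝ g x‖ ≤ c * ‖fderiv ℝ f x‖ := by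
  refine ContinuousLinearMap.opNorm_le_bound _ (by positivity) fun w => ?_
  have h1 := (hg.hasFDerivAt.hasLineDerivAt w).tendsto_slope_zero.norm
  have h2 := ((hf.hasFDerivAt.hasLineDerivAt w).tendsto_slope_zero.norm).const_mul c
  have h3 : ‖fderiv ℝ g x w‖ ≤ c * ‖fderiv ℝ f x w‖ := by
    refine le_of_tendsto_of_tendsto' h1 h2 fun t => ?_
    rw [norm_smul, norm_smul, mul_left_comm]
    exact mul_le_mul_of_nonneg_left (h _) (norm_nonneg _)
  rw [mul_assoc]
  exact h3.trans (mul_le_mul_of_nonneg_left (ContinuousLinearMap.le_opNorm _ _) hc)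

theorem lipschitzWith_sum {α ι : Type*} [PseudoEMetricSpace α] {f : ι → α → ℝ} {L : ι → NNReal}
    (hf : ∀ i, LipschitzWith (L i) (f i)) (s : Finset ι) :
    LipschitzWith (∑ i ∈ s, L i) (fun x => ∑ i ∈ s, f i x) := by
  classical
  induction s using Finset.induction_on with
  | empty => simp
  | insert a s ha ih =>
    simp only [Finset.sum_insert ha]
    exact (hf a).add ih

/-- A partial sum of vectors with vanishing total sum. -/
theorem norm_partial_sum_sq_le {ι E : Type*} [DecidableEq ι] [NormedAddCommGroup E] {I J : Finset ι}
    {n : ℕ} (hI : I.card ≤ n) (hJ : J ⊆ I) {g : ι → E} (hg : ∑ i ∈ I, g i = 0) :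
    ‖∑ i ∈ J, g i‖ ^ 2 ≤ (n : ℝ) / 4 * ∑ i ∈ I, ‖g i‖ ^ 2 := by
  have hbd : ∀ s : Finset ι, ‖∑ i ∈ s, g i‖ ^ 2 ≤ s.card * ∑ i ∈ s, ‖g i‖ ^ 2 := fun s =>
    (pow_le_pow_left₀ (norm_nonneg _) (norm_sum_le _ _) 2).trans sq_sum_le_card_mul_sum_sq
  have h1 := hbd J
  have h2 := hbd (I \ J)
  have hsum := Finset.sum_sdiff (f := g) hJ
  rw [hg] at hsum
  rw [eq_neg_of_add_eq_zero_left hsum, norm_neg] at h2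
  have h3 := Finset.sum_sdiff (f := fun i => ‖g i‖ ^ 2) hJ
  have h4 : ((I \ J).card : ℝ) + J.card ≤ n := by
    exact_mod_cast (Finset.card_sdiff_add_card_eq_card hJ).le.trans hI
  have ha : 0 ≤ ∑ i ∈ J, ‖g i‖ ^ 2 := Finset.sum_nonneg fun _ _ => by positivity
  have hb : 0 ≤ ∑ i ∈ I \ J, ‖g i‖ ^ 2 := Finset.sum_nonneg fun _ _ => by positivity
  rw [← h3]
  set a := ∑ i ∈ J, ‖g i‖ ^ 2
  set b := ∑ i ∈ I \ J, ‖g i‖ ^ 2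
  set x := ‖∑ i ∈ J, g i‖ ^ 2
  have hn1 : (0 : ℝ) ≤ J.card := Nat.cast_nonneg _
  have hn2 : (0 : ℝ) ≤ (I \ J).card := Nat.cast_nonneg _
  set p : ℝ := (J.card : ℝ)
  set q : ℝ := ((I \ J).card : ℝ)
  -- The sums over J and over its complement are opposite, so x ≤ p a and x ≤ q b. Weighting these
  -- by q and p gives (p + q) x ≤ p q (a + b), and 4 p q ≤ (p + q)².
  have h5 : x ≤ (q + p) / 4 * (b + a) := by
    rcases (add_nonneg hn2 hn1).eq_or_lt with h0 | h0
    · have : p = 0 := by linarith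
      rw [this, zero_mul] at h1
      rw [← h0]; linarith
    · refine le_of_mul_le_mul_left ?_ h0
      have e1 := mul_le_mul_of_nonneg_left h1 hn2
      have e2 := mul_le_mul_of_nonneg_left h2 hn1
      nlinarith [mul_nonneg (sq_nonneg (p - q)) (add_nonneg hb ha)]
  exact h5.trans (mul_le_mul_of_nonneg_right (by linarith) (by linarith))

end CutoffTools

/-! ### Patches of cells and cutoff operations -/

namespace ElasticSetup

variable {d : ℕ} {ρ : ℝ} {Nv : ℕ} (S : ElasticSetup d ρ Nv)

/-- The indices of the cells that form the patch `K_{i,m}`. -/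
def patchIdx (i : Fin S.N) : ℕ → Set (Fin S.N)
  | 0 => {i}
  | m + 1 => {j | (S.cell j ∩ S.patch i m).Nonempty}

theorem patch_eq (i : Fin S.N) (m : ℕ) : S.patch i m = ⋃ j ∈ S.patchIdx i m, S.cell j := by
  cases m with
  | zero => simp [patch, patchIdx]
  | succ m => rfl

theorem cell_subset_patch {i k : Fin S.N} {m : ℕ} (h : k ∈ S.patchIdx i m) :
    S.cell k ⊆ S.patch i m := by
  rw [patch_eq]
  exact Set.subset_biUnion_of_mem (u := S.cell) h

theorem cell_nonempty (hρ : 0 < ρ) (k : Fin S.N) : (S.cell k).Nonempty := by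
  obtain ⟨c, hc⟩ := S.cell_ball k
  exact ⟨c, hc (Metric.mem_ball_self (mul_pos hρ S.H_pos))⟩

theorem patchIdx_mono (hρ : 0 < ρ) (i : Fin S.N) (m : ℕ) :
    S.patchIdx i m ⊆ S.patchIdx i (m + 1) := by
  intro k hk
  obtain ⟨x, hx⟩ := S.cell_nonempty hρ k
  exact ⟨x, hx, S.cell_subset_patch hk hx⟩

/-- A cell is the closure of its interior, so if it contained an interior point of another cell, the
two interiors would meet. -/
theorem eq_of_mem_core_of_mem_cell {k l : Fin S.N} {x : Rd d} (hk : x ∈ S.core k)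
    (hl : x ∈ S.cell l) : l = k := by
  by_contra h
  rw [← S.cell_regular l] at hl
  obtain ⟨y, hy1, hy2⟩ := mem_closure_iff.1 hl _ isOpen_interior hk.1
  exact Set.disjoint_left.1 (S.cell_disjoint l k h) hy2 hy1

theorem chi_eq_zero {k : Fin S.N} {j : Fin S.Nc} (hj : S.vertex j ∉ S.cell k) {x : Rd d}
    (hx : x ∈ S.core k) : S.chi j x = 0 :=
  S.chi_support j x hx.2 fun l hl hxl => by
    rw [S.eq_of_mem_core_of_mem_cell hx hxl] at hl
    exact hj hl

theorem ae_mem_core : ∀ᵐ x ∂(volume : Measure (Rd d)), x ∈ S.dom → ∃ k, x ∈ S.core k := by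
  filter_upwards [S.dom_ae_core.mem_iff] with x hx hd
  simpa using hx.2 hd

theorem ae_chi_differentiable :
    ∀ᵐ x ∂(volume : Measure (Rd d)), x ∈ S.dom → ∀ j, DifferentiableAt ℝ (S.chi j) x := by
  have h : ∀ j, ∀ᵐ x ∂(volume : Measure (Rd d)), x ∈ S.dom → DifferentiableAt ℝ (S.chi j) x := by
    intro j
    obtain ⟨L, hL⟩ := S.chi_lipschitz j
    filter_upwards [hL.ae_differentiableWithinAt_of_mem] with x hx hd
    exact (hx hd).differentiableAt (S.dom_open.mem_nhds hd)
  filter_upwards [ae_all_iff.2 h] with x hx hd j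
  exact hx j hd

open Classical in
/-- The sum of the partition of unity functions of the vertices in a set. -/
theorem exists_sum_chi (A : Set (Rd d)) : ∃ (η : Rd d → ℝ) (L : NNReal), LipschitzWith L η ∧
    (∀ x, 0 ≤ η x ∧ η x ≤ 1) ∧
    (∀ x ∈ S.dom, η x = ∑ j with S.vertex j ∈ A, S.chi j x) := by
  choose L hL using S.chi_lipschitz
  choose g hg hgeq using fun j => (hL j).extend_real
  -- Each χ_j is Lipschitz only on the domain. It is extended to the whole space, and clipping the
  -- sum to [0, 1] restores the bounds outside without changing it inside.
  have hsum := lipschitzWith_sum hg (Finset.univ.filter fun j => S.vertex j ∈ A)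
  refine ⟨_, _, (hsum.min_const 1).max_const 0, fun x => ⟨le_max_right _ _, ?_⟩, fun x hx => ?_⟩
  · exact max_le (min_le_right _ _) zero_le_one
  · have e : ∑ j with S.vertex j ∈ A, g j x = ∑ j with S.vertex j ∈ A, S.chi j x :=
      Finset.sum_congr rfl fun j _ => (hgeq j hx).symm
    have h0 : 0 ≤ ∑ j with S.vertex j ∈ A, S.chi j x :=
      Finset.sum_nonneg fun j _ => S.chi_nonneg j x hx
    have h1 : ∑ j with S.vertex j ∈ A, S.chi j x ≤ 1 := by
      rw [← S.chi_sum x hx]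
      exact Finset.sum_le_sum_of_subset_of_nonneg (Finset.subset_univ _)
        fun j _ _ => S.chi_nonneg j x hx
    rw [e, min_eq_left h1, max_eq_left h0]

-- In the interior of a cell only the vertices of that cell contribute, and all gradients there sum
-- to zero. The gradient of η is thus a partial sum of at most Nv vectors with zero total, which
-- gives Nv/4 instead of Nv.
open Classical in
theorem fderiv_sum_chi_sq_le {A : Set (Rd d)} {η : Rd d → ℝ}
    (hη : ∀ x ∈ S.dom, η x = ∑ j with S.vertex j ∈ A, S.chi j x) :
    ∀ᵐ x ∂(volume : Measure (Rd d)), x ∈ S.dom →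
      ‖fderiv ℝ η x‖ ^ 2 ≤ (Nv : ℝ) / 4 * ∑ j, ‖fderiv ℝ (S.chi j) x‖ ^ 2 := by
  filter_upwards [S.ae_mem_core, S.ae_chi_differentiable] with x h1 h2 hd
  obtain ⟨k, hk⟩ := h1 hd
  have hdiff := h2 hd
  have hzero : ∀ j, S.vertex j ∉ S.cell k → fderiv ℝ (S.chi j) x = 0 := by
    intro j hj
    have : S.chi j =ᶠ[nhds x] fun _ => 0 :=
      Filter.eventuallyEq_of_mem ((S.isOpen_core k).mem_nhds hk) fun y hy => S.chi_eq_zero hj hy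
    rw [this.fderiv_eq, fderiv_fun_const]; rfl
  have hfs : ∀ s : Finset (Fin S.Nc), fderiv ℝ (fun y => ∑ j ∈ s, S.chi j y) x =
      ∑ j ∈ s, fderiv ℝ (S.chi j) x := fun s => fderiv_fun_sum fun j _ => hdiff j
  have htot : ∑ j, fderiv ℝ (S.chi j) x = 0 := by
    rw [← hfs]
    have : (fun y => ∑ j, S.chi j y) =ᶠ[nhds x] fun _ => 1 :=
      Filter.eventuallyEq_of_mem (S.dom_open.mem_nhds hd) fun y hy => S.chi_sum y hy
    rw [this.fderiv_eq, fderiv_fun_const]; rfl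
  have hηx : fderiv ℝ η x = ∑ j with S.vertex j ∈ A, fderiv ℝ (S.chi j) x := by
    rw [← hfs]
    have : η =ᶠ[nhds x] fun y => ∑ j with S.vertex j ∈ A, S.chi j y :=
      Filter.eventuallyEq_of_mem (S.dom_open.mem_nhds hd) hη
    exact this.fderiv_eq
  set I : Finset (Fin S.Nc) := Finset.univ.filter fun j => S.vertex j ∈ S.cell k
  set J : Finset (Fin S.Nc) := I.filter fun j => S.vertex j ∈ A
  have hI : I.card ≤ Nv := by
    have := S.cell_vertices k
    rwa [Set.ncard_eq_toFinset_card', Set.toFinset_ofPred] at this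
  have hIsum : ∑ j ∈ I, fderiv ℝ (S.chi j) x = 0 := by
    rw [← htot]
    refine Finset.sum_subset (Finset.subset_univ _) fun j _ hj => hzero j fun h => hj ?_
    simpa [I] using h
  have hJsum : fderiv ℝ η x = ∑ j ∈ J, fderiv ℝ (S.chi j) x := by
    rw [hηx]
    symm
    refine Finset.sum_subset (fun j hj => ?_) fun j hjA hj => hzero j fun h => hj ?_
    · simp only [J, Finset.mem_filter] at hj
      simp [hj.2]
    · simp only [Finset.mem_filter, Finset.mem_univ, true_and] at hjA
      simp [J, I, h, hjA]
  have hle := norm_partial_sum_sq_le hI (Finset.filter_subset _ I : J ⊆ I) hIsum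
  rw [hJsum]
  refine hle.trans (mul_le_mul_of_nonneg_left ?_ (by positivity))
  exact Finset.sum_le_sum_of_subset_of_nonneg (Finset.subset_univ _) fun j _ _ => by positivity

/-- A cutoff function that is one on a patch and zero off the next larger one. -/
structure IsCutoff (i : Fin S.N) (n : ℕ) (η : Rd d → ℝ) : Prop where
  bounds : ∀ x, 0 ≤ η x ∧ η x ≤ 1
  one : ∀ k ∈ S.patchIdx i n, ∀ x ∈ S.core k, η x = 1
  zero : ∀ k ∉ S.patchIdx i (n + 1), ∀ x ∈ S.core k, η x = 0
  zero' : ∀ x ∈ S.dom, x ∉ S.patch i (n + 1) → η x = 0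
  grad : ∀ᵐ x ∂(volume : Measure (Rd d)), x ∈ S.dom →
    (S.lam x + 2 * S.mu x) * ‖fderiv ℝ η x‖ ^ 2 ≤ (Nv : ℝ) / 4 * S.kappa x

/-- Sum the χ_j over the vertices in the patch: a cell of the patch has all its vertices there, and
a cell with any vertex there meets the patch and so belongs to the next layer. -/
theorem exists_cutoff (i : Fin S.N) (n : ℕ) :
    ∃ (η : Rd d → ℝ) (L : NNReal), LipschitzWith L η ∧ S.IsCutoff i n η := by
  classical
  obtain ⟨η, L, hL, hb, hη⟩ := S.exists_sum_chi (S.patch i n)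
  refine ⟨η, L, hL, hb, ?_, ?_, ?_, ?_⟩
  · intro k hk x hx
    rw [hη x hx.2, ← S.chi_sum x hx.2]
    refine Finset.sum_subset (Finset.subset_univ _) fun j _ hj => S.chi_eq_zero (fun h => hj ?_) hx
    simpa using S.cell_subset_patch hk h
  · intro k hk x hx
    rw [hη x hx.2]
    refine Finset.sum_eq_zero fun j hj => S.chi_eq_zero (fun h => hk ?_) hx
    exact ⟨S.vertex j, h, by simpa using hj⟩
  · intro x hx hxp
    rw [hη x hx]
    refine Finset.sum_eq_zero fun j hj => S.chi_support j x hx fun l hl hxl => hxp ?_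
    have hlp : l ∈ S.patchIdx i (n + 1) := ⟨S.vertex j, hl, by simpa using hj⟩
    exact S.cell_subset_patch hlp hxl
  · filter_upwards [S.fderiv_sum_chi_sq_le hη,
      (ae_restrict_iff' S.dom_open.measurableSet).1 S.lame_pos] with x h1 h2 hd
    obtain ⟨hl, hm⟩ := h2 hd
    have := mul_le_mul_of_nonneg_left (h1 hd) (by linarith : 0 ≤ S.lam x + 2 * S.mu x)
    refine this.trans (le_of_eq ?_)
    rw [kappa, ← Finset.mul_sum]; ring

theorem ae_core_of_ae_dom {k : Fin S.N} {p : Rd d → Prop}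
    (h : ∀ᵐ x ∂(volume : Measure (Rd d)), x ∈ S.dom → p x) : ∀ᵐ x ∂(volume.restrict (S.core k)), p x :=
  (ae_restrict_iff' (S.isOpen_core k).measurableSet).2 (h.mono fun _ hx hk => hx hk.2)

theorem mulH1_of_const {η : Rd d → ℝ} {L : NNReal} (hη : LipschitzWith L η)
    (hb : ∀ x, |η x| ≤ 1) {O : Set (Rd d)} (hO : IsOpen O) {c : ℝ} (hc : ∀ x ∈ O, η x = c)
    (v : H1Pair d) : ∀ᵐ x ∂(volume : Measure (Rd d)), x ∈ O →
      (mulH1 hη hb v).1 x = c • v.1 x ∧ (mulH1 hη hb v).2 x = c • v.2 x := by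
  filter_upwards [mulH1_fst hη hb v, mulH1_snd hη hb v] with x h1 h2 hx
  have : η =ᶠ[nhds x] fun _ => c := Filter.eventuallyEq_of_mem (hO.mem_nhds hx) hc
  have hd : fderiv ℝ η x = 0 := by rw [this.fderiv_eq, fderiv_fun_const]; rfl
  rw [h1, h2, hc x hx, hd]
  simp

theorem aCell_eq_zero {k : Fin S.N} {y : H1Pair d}
    (h : ∀ᵐ x ∂(volume : Measure (Rd d)), x ∈ S.core k → y.2 x = 0) (v : H1Pair d) :
    S.aCell k y v = 0 := by
  rw [S.aCell_congr_left k (u' := 0), map_zero, LinearMap.zero_apply]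
  filter_upwards [h, Lp.coeFn_zero (Rd d →L[ℝ] Rd d) 2 (volume : Measure (Rd d))] with x hx h0 hk
  rw [hx hk]; exact h0.symm

theorem sCell_eq_zero {k : Fin S.N} {y : H1Pair d}
    (h : ∀ᵐ x ∂(volume : Measure (Rd d)), x ∈ S.core k → y.1 x = 0) (v : H1Pair d) :
    S.sCell k y v = 0 := by
  rw [S.sCell_congr_left k (u' := 0), map_zero, LinearMap.zero_apply]
  filter_upwards [h, Lp.coeFn_zero (Rd d) 2 (volume : Measure (Rd d))] with x hx h0 hk
  rw [hx hk]; exact h0.symm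

/-- The element `y` vanishes on the cell `K_k`. -/
def VanishesOn (k : Fin S.N) (y : H1Pair d) : Prop :=
  ∀ᵐ x ∂(volume : Measure (Rd d)), x ∈ S.core k → y.1 x = 0 ∧ y.2 x = 0

theorem VanishesOn.a_eq_zero {k : Fin S.N} {y : H1Pair d} (h : S.VanishesOn k y) (v : H1Pair d) :
    S.aCell k y v = 0 := S.aCell_eq_zero (h.mono fun _ hx hk => (hx hk).2) v

theorem VanishesOn.s_eq_zero {k : Fin S.N} {y : H1Pair d} (h : S.VanishesOn k y) (v : H1Pair d) :
    S.sCell k y v = 0 := S.sCell_eq_zero (h.mono fun _ hx hk => (hx hk).1) v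

theorem vanishesOn_mulH1 {η : Rd d → ℝ} {L : NNReal} (hη : LipschitzWith L η)
    (hb : ∀ x, |η x| ≤ 1) {k : Fin S.N} (hc : ∀ x ∈ S.core k, η x = 0) (v : H1Pair d) :
    S.VanishesOn k (mulH1 hη hb v) := by
  filter_upwards [mulH1_of_const hη hb (S.isOpen_core k) hc v] with x hx hk
  obtain ⟨e1, e2⟩ := hx hk
  exact ⟨e1.trans (zero_smul ℝ _), e2.trans (by ext w; simp)⟩

theorem vanishesOn_sub_mulH1 {η : Rd d → ℝ} {L : NNReal} (hη : LipschitzWith L η)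
    (hb : ∀ x, |η x| ≤ 1) {k : Fin S.N} (hc : ∀ x ∈ S.core k, η x = 1) (v : H1Pair d) :
    S.VanishesOn k (v - mulH1 hη hb v) := by
  filter_upwards [mulH1_of_const hη hb (S.isOpen_core k) hc v,
    Lp.coeFn_sub v.1 (mulH1 hη hb v).1, Lp.coeFn_sub v.2 (mulH1 hη hb v).2] with x hx h1 h2 hk
  obtain ⟨e1, e2⟩ := hx hk
  rw [Prod.fst_sub, Prod.snd_sub, h1, h2, Pi.sub_apply, Pi.sub_apply, e1, e2]
  simp

theorem sCell_mulH1_le {η : Rd d → ℝ} {L : NNReal} (hη : LipschitzWith L η)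
    (hb : ∀ x, |η x| ≤ 1) (k : Fin S.N) (v : H1Pair d) :
    S.sCell k (mulH1 hη hb v) (mulH1 hη hb v) ≤ S.sCell k v v := by
  refine integral_mono_ae (S.integrableOn_weighted (S.core_subset k) _ _)
    (S.integrableOn_weighted (S.core_subset k) _ _) ?_
  filter_upwards [ae_restrict_of_ae (mulH1_fst hη hb v),
    ae_restrict_of_ae_restrict_of_subset (S.core_subset k) S.kappa_pos] with x h1 h2
  rw [h1, real_inner_smul_left, real_inner_smul_right]
  have h3 : η x * η x ≤ 1 := by
    rw [← abs_mul_abs_self]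
    exact mul_le_one₀ (hb x) (abs_nonneg _) (hb x)
  have h4 : (0 : ℝ) ≤ inner ℝ (v.1 x) (v.1 x) := real_inner_self_nonneg
  refine mul_le_mul_of_nonneg_left ?_ h2.le
  nlinarith

/-- The energy density of the term with the gradient of the cutoff function. -/
theorem elasticDensity_cutoff_le {η : Rd d → ℝ} {C : ℝ}
    (hg : ∀ᵐ x ∂(volume : Measure (Rd d)), x ∈ S.dom →
      (S.lam x + 2 * S.mu x) * ‖fderiv ℝ η x‖ ^ 2 ≤ C * S.kappa x) (k : Fin S.N) (v : H1Pair d) :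
    ∀ᵐ x ∂(volume.restrict (S.core k)), elasticDensity (S.lam x) (S.mu x)
      ((fderiv ℝ η x).smulRight (v.1 x)) ((fderiv ℝ η x).smulRight (v.1 x)) ≤
      C * (S.kappa x * inner ℝ (v.1 x) (v.1 x)) := by
  filter_upwards [S.ae_core_of_ae_dom hg,
    ae_restrict_of_ae_restrict_of_subset (S.core_subset k) S.lame_pos] with x h1 h2
  refine (elasticDensity_smulRight_le h2.1.le h2.2.le _ _).trans ?_
  rw [real_inner_self_eq_norm_sq, ← mul_assoc]
  exact mul_le_mul_of_nonneg_right h1 (sq_nonneg _)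

/-- Pointwise the density of v against η v is η times the density of v, which is nonnegative, plus a
cross term with the gradient of η. Only the cross term is estimated, by Young's inequality with a
free parameter. -/
theorem aCell_mulH1_ge {η : Rd d → ℝ} {L : NNReal} (hη : LipschitzWith L η)
    (hb : ∀ x, |η x| ≤ 1) (h0 : ∀ x, 0 ≤ η x) {C : ℝ}
    (hg : ∀ᵐ x ∂(volume : Measure (Rd d)), x ∈ S.dom →
      (S.lam x + 2 * S.mu x) * ‖fderiv ℝ η x‖ ^ 2 ≤ C * S.kappa x) (k : Fin S.N) (v : H1Pair d)
    {t : ℝ} (ht : 0 < t) :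
    -(t / 2 * S.aCell k v v + 1 / (2 * t) * (C * S.sCell k v v)) ≤
      S.aCell k v (mulH1 hη hb v) := by
  have i1 := S.integrableOn_elasticDensity (S.core_subset k) v v
  have i2 := S.integrableOn_weighted (S.core_subset k) v v
  have i3 := S.integrableOn_elasticDensity (S.core_subset k) v (mulH1 hη hb v)
  rw [aCell, sCell, aForm_apply, aForm_apply, sForm_apply]
  simp only [← integral_const_mul]
  rw [← integral_add (i1.const_mul _) ((i2.const_mul _).const_mul _), ← integral_neg]
  refine integral_mono_ae ((i1.const_mul _).add ((i2.const_mul _).const_mul _)).neg i3 ?_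
  filter_upwards [ae_restrict_of_ae (mulH1_snd hη hb v), S.elasticDensity_cutoff_le hg k v,
    ae_restrict_of_ae_restrict_of_subset (S.core_subset k) S.lame_pos] with x h1 h2 h3
  have hp := isPsd_elasticForm (d := d) h3.1.le h3.2.le
  set G := v.2 x
  set R := (fderiv ℝ η x).smulRight (v.1 x)
  have h4 := hp.young (-G) R ht
  simp only [map_neg, LinearMap.neg_apply, neg_neg, elasticForm_apply] at h4
  have h5 : elasticDensity (S.lam x) (S.mu x) G (η x • G + R) =
      η x * elasticDensity (S.lam x) (S.mu x) G G + elasticDensity (S.lam x) (S.mu x) G R := by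
    simp only [← elasticForm_apply, map_add, map_smul, smul_eq_mul]
  have h6 := mul_nonneg (h0 x) (hp.nonneg G)
  rw [elasticForm_apply] at h6
  have h7 := mul_le_mul_of_nonneg_left h2 (by positivity : 0 ≤ 1 / (2 * t))
  rw [h1, h5]
  linarith

theorem aCell_mulH1_le {η : Rd d → ℝ} {L : NNReal} (hη : LipschitzWith L η)
    (hb : ∀ x, |η x| ≤ 1) {C : ℝ}
    (hg : ∀ᵐ x ∂(volume : Measure (Rd d)), x ∈ S.dom →
      (S.lam x + 2 * S.mu x) * ‖fderiv ℝ η x‖ ^ 2 ≤ C * S.kappa x) (k : Fin S.N)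
    (v : H1Pair d) :
    S.aCell k (mulH1 hη hb v) (mulH1 hη hb v) ≤
      2 * S.aCell k v v + 2 * (C * S.sCell k v v) := by
  have i1 := S.integrableOn_elasticDensity (S.core_subset k) v v
  have i2 := S.integrableOn_weighted (S.core_subset k) v v
  have i3 := S.integrableOn_elasticDensity (S.core_subset k) (mulH1 hη hb v) (mulH1 hη hb v)
  rw [aCell, sCell, aForm_apply, aForm_apply, sForm_apply]
  simp only [← integral_const_mul]
  rw [← integral_add (i1.const_mul _) ((i2.const_mul _).const_mul _)]
  refine integral_mono_ae i3 ((i1.const_mul _).add ((i2.const_mul _).const_mul _)) ?_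
  filter_upwards [ae_restrict_of_ae (mulH1_snd hη hb v), S.elasticDensity_cutoff_le hg k v,
    ae_restrict_of_ae_restrict_of_subset (S.core_subset k) S.lame_pos] with x h1 h2 h3
  have hp := isPsd_elasticForm (d := d) h3.1.le h3.2.le
  set G := v.2 x
  set R := (fderiv ℝ η x).smulRight (v.1 x)
  have h4 := hp.sub_le (η x • G) (-R)
  have h5 : η x * η x ≤ 1 := by
    rw [← abs_mul_abs_self]
    exact mul_le_one₀ (hb x) (abs_nonneg _) (hb x)
  have h6 := mul_le_mul_of_nonneg_right h5 (hp.nonneg G)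
  simp only [sub_neg_eq_add, map_neg, LinearMap.neg_apply, neg_neg, map_smul,
    LinearMap.smul_apply, smul_eq_mul, elasticForm_apply] at h4 h6
  rw [h1]
  linarith

/-- The sharp cutoff operation, with values in `V`. -/
theorem exists_cut_out (i : Fin S.N) (n : ℕ) {v : H1Pair d} (hv : v ∈ S.V) :
    ∃ y ∈ S.V, (∀ k ∈ S.patchIdx i n, S.VanishesOn k y) ∧
      (∀ k ∉ S.patchIdx i (n + 1), S.VanishesOn k (v - y)) ∧
      (∀ k, S.sCell k y y ≤ S.sCell k v v) ∧
      ∀ k, ∀ t : ℝ, 0 < t →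
        -(t / 2 * S.aCell k v v + 1 / (2 * t) * ((Nv : ℝ) / 4 * S.sCell k v v)) ≤
          S.aCell k v y := by
  obtain ⟨η, L, hL, hη⟩ := S.exists_cutoff i n
  -- Membership in V does not need a smaller support, so the complementary cutoff keeps the sharp
  -- constant Nv/4 that enters the decay rate.
  have hL' : LipschitzWith L (fun x => 1 - η x) := by
    simpa using (LipschitzWith.const (1 : ℝ)).sub hL
  have h0 : ∀ x, 0 ≤ 1 - η x := fun x => by linarith [(hη.bounds x).2]
  have hb : ∀ x, |1 - η x| ≤ 1 := fun x => by
    rw [abs_of_nonneg (h0 x)]; linarith [(hη.bounds x).1]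
  refine ⟨mulH1 hL' hb v, mulH1_mem_H10 hL' hb S.dom_open isClosed_univ (fun _ _ _ => trivial)
    Set.inter_subset_right hv, fun k hk => S.vanishesOn_mulH1 hL' hb (fun x hx => ?_) v,
    fun k hk => S.vanishesOn_sub_mulH1 hL' hb (fun x hx => ?_) v,
    fun k => S.sCell_mulH1_le hL' hb k v, fun k t ht => S.aCell_mulH1_ge hL' hb h0 ?_ k v ht⟩
  · rw [hη.one k hk x hx, sub_self]
  · rw [hη.zero k hk x hx, sub_zero]
  · filter_upwards [hη.grad] with x hx hd
    rw [fderiv_const_sub, norm_neg]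
    exact hx hd

/-- A cutoff function whose support in the domain is in the interior of the larger patch. -/
theorem exists_interior_cutoff (i : Fin S.N) (n : ℕ) :
    ∃ (θ : Rd d → ℝ) (L : NNReal) (F : Set (Rd d)), LipschitzWith L θ ∧ (∀ x, |θ x| ≤ 1) ∧
      IsClosed F ∧ (∀ x ∈ S.dom, θ x ≠ 0 → x ∈ F) ∧
      F ∩ S.dom ⊆ S.dom ∩ interior (S.patch i (n + 1)) ∧
      (∀ k ∈ S.patchIdx i n, ∀ x ∈ S.core k, θ x = 1) ∧
      ∀ᵐ x ∂(volume : Measure (Rd d)), x ∈ S.dom →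
        (S.lam x + 2 * S.mu x) * ‖fderiv ℝ θ x‖ ^ 2 ≤ Nv * S.kappa x := by
  obtain ⟨η, L, hL, hη⟩ := S.exists_cutoff i n
  -- The support of η may touch the boundary of the larger patch inside the domain. The truncation
  -- confines θ to the closed set η ≥ 1/2, contained within the domain in the relatively open set η
  -- > 0. It doubles gradients, turning Nv/4 into Nv.
  obtain ⟨θ, hθ⟩ : ∃ θ : Rd d → ℝ, ∀ x, θ x = max (2 * η x - 1) 0 := ⟨_, fun _ => rfl⟩
  have hL' : LipschitzWith (2 * L) θ := by
    refine LipschitzWith.of_dist_le_mul fun x y => ?_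
    rw [hθ, hθ, Real.dist_eq]
    refine (abs_max_sub_max_le_abs _ _ _).trans ?_
    rw [show 2 * η x - 1 - (2 * η y - 1) = 2 * (η x - η y) by ring, abs_mul, abs_two,
      ← Real.dist_eq, NNReal.coe_mul, mul_assoc]
    exact mul_le_mul_of_nonneg_left (hL.dist_le_mul x y) zero_le_two
  have hb : ∀ x, |θ x| ≤ 1 := fun x => by
    rw [hθ, abs_of_nonneg (le_max_right _ _)]
    exact max_le (by linarith [(hη.bounds x).2]) zero_le_one
  have hF : IsClosed {x | 1 / 2 ≤ η x} := isClosed_le continuous_const hL.continuous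
  have hFη : ∀ x ∈ S.dom, θ x ≠ 0 → x ∈ {x | 1 / 2 ≤ η x} := by
    intro x _ hx
    by_contra h
    refine hx ((hθ x).trans (max_eq_right ?_))
    simp only [Set.mem_ofPred_eq, not_le] at h
    linarith
  have hFdom : {x | 1 / 2 ≤ η x} ∩ S.dom ⊆ S.dom ∩ interior (S.patch i (n + 1)) := by
    rintro x ⟨hx1, hx2⟩
    have hpos : IsOpen ({x | 0 < η x} ∩ S.dom) :=
      (isOpen_lt continuous_const hL.continuous).inter S.dom_open
    have hsub : {x | 0 < η x} ∩ S.dom ⊆ S.patch i (n + 1) := by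
      intro y hy
      by_contra h
      have h0 : 0 < η y := hy.1
      exact h0.ne' (hη.zero' y hy.2 h)
    have hx1' : 1 / 2 ≤ η x := hx1
    have hx0 : 0 < η x := by linarith
    exact ⟨hx2, interior_maximal hsub hpos ⟨hx0, hx2⟩⟩
  have hone : ∀ k ∈ S.patchIdx i n, ∀ x ∈ S.core k, θ x = 1 := by
    intro k hk x hx
    rw [hθ, hη.one k hk x hx]; norm_num
  have hgrad : ∀ᵐ x ∂(volume : Measure (Rd d)), x ∈ S.dom →
      (S.lam x + 2 * S.mu x) * ‖fderiv ℝ θ x‖ ^ 2 ≤ Nv * S.kappa x := by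
    filter_upwards [hη.grad, hL.ae_differentiableAt, hL'.ae_differentiableAt,
      (ae_restrict_iff' S.dom_open.measurableSet).1 S.lame_pos] with x h1 h2 h3 h4 hd
    have h5 := norm_fderiv_le_of_dominated zero_le_two h2 h3 fun y => by
      have := abs_max_sub_max_le_abs (2 * η y - 1) (2 * η x - 1) 0
      rw [hθ, hθ]
      refine this.trans (le_of_eq ?_)
      rw [show 2 * η y - 1 - (2 * η x - 1) = 2 * (η y - η x) by ring, abs_mul, abs_two]
    have h6 : ‖fderiv ℝ θ x‖ ^ 2 ≤ 4 * ‖fderiv ℝ η x‖ ^ 2 := by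
      have := pow_le_pow_left₀ (norm_nonneg _) h5 2
      linarith [mul_pow 2 ‖fderiv ℝ η x‖ 2]
    obtain ⟨hl, hm⟩ := h4 hd
    have h7 := mul_le_mul_of_nonneg_left h6 (by linarith : 0 ≤ S.lam x + 2 * S.mu x)
    have h8 := h1 hd
    linarith
  exact ⟨θ, 2 * L, _, hL', hb, hF, hFη, hFdom, hone, hgrad⟩

/-- The cutoff operation with values in the local space of the next larger patch. -/
theorem exists_cut_in (i : Fin S.N) (n : ℕ) {v : H1Pair d} (hv : v ∈ S.V) :
    ∃ y ∈ S.VPatch i (n + 1), (∀ k ∈ S.patchIdx i n, S.VanishesOn k (v - y)) ∧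
      (∀ k, S.sCell k y y ≤ S.sCell k v v) ∧
      ∀ k, S.aCell k y y ≤ 2 * S.aCell k v v + 2 * (Nv * S.sCell k v v) := by
  obtain ⟨θ, L, F, hL, hb, hF, hFη, hFdom, hone, hgrad⟩ := S.exists_interior_cutoff i n
  exact ⟨mulH1 hL hb v,
    mulH1_mem_H10 hL hb (S.dom_open.inter isOpen_interior) hF hFη hFdom hv,
    fun k hk => S.vanishesOn_sub_mulH1 hL hb (hone k hk) v,
    fun k => S.sCell_mulH1_le hL hb k v, fun k => S.aCell_mulH1_le hL hb hgrad k v⟩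

end ElasticSetup

/-- The energy and coefficient parts are treated with the same Young parameter Q. One half of Q b
arises directly, the other from (1 + ν) s / (2Q) ≤ (1 + ν)(1 + L) b / (2Q); this is why Q² need only
exceed (1 + ν)(1 + L). -/
theorem weighted_young_bound {ι : Type*} [Fintype ι] {Q ν L a a' s b : ℝ} {p r : ι → ℝ}
    (hQ : 0 < Q) (hν : 0 ≤ 1 + ν) (hQ2 : (1 + ν) * (1 + L) ≤ Q ^ 2)
    (ha : -(Q / 2 * a + 1 / (2 * Q) * (ν * s)) ≤ a') (hr : ∑ j, r j ^ 2 ≤ s)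
    (hs : s ≤ (1 + L) * b) (hb : 0 ≤ b) (hab : b = a + ∑ j, p j ^ 2) :
    -(Q * b) ≤ a' + ∑ j, p j * r j := by
  have e2 : -(Q / 2 * ∑ j, p j ^ 2 + 1 / (2 * Q) * ∑ j, r j ^ 2) ≤ ∑ j, p j * r j := by
    rw [Finset.mul_sum, Finset.mul_sum, ← Finset.sum_add_distrib, ← Finset.sum_neg_distrib]
    refine Finset.sum_le_sum fun j _ => ?_
    have : p j * r j + (Q / 2 * p j ^ 2 + 1 / (2 * Q) * r j ^ 2) =
        (Q * p j + r j) ^ 2 / (2 * Q) := by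
      field_simp; ring
    have h0 : 0 ≤ (Q * p j + r j) ^ 2 / (2 * Q) := by positivity
    linarith
  have e5 : (1 + ν) * s ≤ Q ^ 2 * b :=
    (mul_le_mul_of_nonneg_left hs hν).trans (by
      rw [← mul_assoc]
      exact mul_le_mul_of_nonneg_right hQ2 hb)
  have hq : 0 ≤ 1 / (2 * Q) := by positivity
  have e6 := mul_le_mul_of_nonneg_left e5 hq
  have e7 := mul_le_mul_of_nonneg_left hr hq
  have e8 : 1 / (2 * Q) * (Q ^ 2 * b) = Q / 2 * b := by
    field_simp
  rw [e8] at e6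
  have e10 : Q / 2 * b = Q / 2 * a + Q / 2 * ∑ j, p j ^ 2 := by rw [hab]; ring
  linarith

/-! ### Overlap of patches, the relaxed energy form and the decay constant -/

namespace ElasticSetup

variable {d : ℕ} {ρ : ℝ} {Nv : ℕ} (S : ElasticSetup d ρ Nv)

theorem dist_le_of_mem_patch {i : Fin S.N} {n : ℕ} {x y : Rd d} (hx : x ∈ S.patch i n)
    (hy : y ∈ S.cell i) : dist x y ≤ (n + 1) * S.H := by
  have hd : ∀ k, ∀ a ∈ S.cell k, ∀ b ∈ S.cell k, dist a b ≤ S.H := fun k a ha b hb =>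
    (Metric.dist_le_diam_of_mem (S.cell_compact k).isBounded ha hb).trans (S.cell_diam k)
  induction n generalizing x with
  | zero => simpa using hd i x hx y hy
  | succ n ih =>
    rw [patch_eq] at hx
    obtain ⟨j, hj, hxj⟩ := Set.mem_iUnion₂.1 hx
    obtain ⟨z, hz1, hz2⟩ := hj
    have h1 := hd j x hxj z hz1
    have h2 := ih hz2
    have h3 := dist_triangle x z y
    push_cast
    linarith

/-- The cells i counted here lie within distance (m + 2) H of a point of K_k and contain disjoint
balls of radius ρ H; comparing volumes gives ((m + 2) / ρ)^d, and m + 2 ≤ 2 (m + 1). -/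
theorem overlap_le (hρ : 0 < ρ) (k : Fin S.N) (m : ℕ) :
    ({i | k ∈ S.patchIdx i (m + 1)}.ncard : ℝ) ≤ (2 / ρ) ^ d * ((m : ℝ) + 1) ^ d := by
  classical
  obtain ⟨x₀, hx₀⟩ := S.cell_nonempty hρ k
  choose c hc using S.cell_ball
  have hH := S.H_pos
  set I : Finset (Fin S.N) := Finset.univ.filter fun i => k ∈ S.patchIdx i (m + 1)
  have hr : 0 < ρ * S.H := mul_pos hρ hH
  set v := volume (Metric.ball (0 : Rd d) 1)
  have hv0 : v ≠ 0 := (Metric.measure_ball_pos volume _ one_pos).ne'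
  have hv1 : v ≠ ⊤ := measure_ball_lt_top.ne
  have hsub : ∀ i, Metric.ball (c i) (ρ * S.H) ⊆ interior (S.cell i) := fun i =>
    interior_maximal (hc i) Metric.isOpen_ball
  have hdisj : (I : Set (Fin S.N)).PairwiseDisjoint fun i => Metric.ball (c i) (ρ * S.H) :=
    fun i _ j _ hij => (S.cell_disjoint i j hij).mono (hsub i) (hsub j)
  have hin : (⋃ i ∈ I, Metric.ball (c i) (ρ * S.H)) ⊆
      Metric.closedBall x₀ ((m + 2) * S.H) := by
    refine Set.iUnion₂_subset fun i hi y hy => ?_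
    have hk : k ∈ S.patchIdx i (m + 1) := by simpa [I] using hi
    have := S.dist_le_of_mem_patch (S.cell_subset_patch hk hx₀) (hc i hy)
    rw [Metric.mem_closedBall, dist_comm]
    push_cast at this
    linarith
  have hvol := measure_mono (μ := (volume : Measure (Rd d))) hin
  rw [measure_biUnion_finset hdisj fun i _ => measurableSet_ball] at hvol
  simp only [Measure.addHaar_ball_of_pos volume _ hr,
    Measure.addHaar_closedBall volume _ (by positivity : 0 ≤ (m + 2) * S.H),
    finrank_euclideanSpace, Fintype.card_fin, Finset.sum_const, nsmul_eq_mul] at hvol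
  rw [← mul_assoc, ENNReal.mul_le_mul_iff_left hv0 hv1, ← ENNReal.ofReal_natCast,
    ← ENNReal.ofReal_mul (by positivity), ENNReal.ofReal_le_ofReal_iff (by positivity)] at hvol
  rw [Set.ncard_eq_toFinset_card', Set.toFinset_ofPred, ← mul_pow]
  have h1 : (I.card : ℝ) ≤ (((m : ℝ) + 2) / ρ) ^ d := by
    rw [div_pow, le_div_iff₀ (by positivity)]
    rw [mul_pow, mul_pow, ← mul_assoc] at hvol
    exact le_of_mul_le_mul_right hvol (by positivity)
  refine h1.trans (pow_le_pow_left₀ (by positivity) ?_ d)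
  rw [div_mul_eq_mul_div]
  gcongr
  linarith [Nat.cast_nonneg (α := ℝ) m]

theorem VPatch_le (i : Fin S.N) (n : ℕ) : S.VPatch i n ≤ S.V := H10_mono Set.inter_subset_left

theorem vanishesOn_of_mem_VPatch {i k : Fin S.N} {n : ℕ} (hk : k ∉ S.patchIdx i n) {v : H1Pair d}
    (hv : v ∈ S.VPatch i n) : S.VanishesOn k v := by
  have ho : IsOpen (S.dom ∩ interior (S.patch i n)) := S.dom_open.inter isOpen_interior
  filter_upwards [(mem_zeroOff ho.measurableSet).1 (H10_le_zeroOff ho hv)] with x hx hxk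
  refine hx fun hxp => hk ?_
  have hxp' := interior_subset hxp.2
  rw [patch_eq] at hxp'
  obtain ⟨l, hl, hxl⟩ := Set.mem_iUnion₂.1 hxp'
  rwa [S.eq_of_mem_core_of_mem_cell hxk hxl] at hl

/-- The form `a` on the whole domain. -/
def aTotal : LinearMap.BilinForm ℝ (H1Pair d) := ∑ k, S.aCell k

theorem aTotal_apply (u v : H1Pair d) : S.aTotal u v = S.a u v := by
  rw [← S.sum_aCell, aTotal]; simp only [LinearMap.sum_apply]

theorem isPsd_aTotal : IsPsd S.aTotal := IsPsd.sum fun k _ => S.isPsd_aCell k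

theorem aNorm_eq (u : H1Pair d) : S.aNorm u = √(S.aTotal u u) := by
  rw [aNorm, aTotal_apply]

namespace AuxBasis

variable {S} (B : S.AuxBasis)

/-- The relaxed energy form `a + ⟨coef, coef⟩` on the cell `K_k`. -/
def energyForm (k : Fin S.N) : LinearMap.BilinForm ℝ (H1Pair d) :=
  S.aCell k + ∑ j, LinearMap.smulRight ((S.sCell k).flip (B.phi k j)) ((S.sCell k).flip (B.phi k j))

theorem energyForm_apply (k : Fin S.N) (u v : H1Pair d) : B.energyForm k u v =
    S.aCell k u v + ∑ j, S.sCell k u (B.phi k j) * S.sCell k v (B.phi k j) := by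
  simp only [energyForm, LinearMap.add_apply, LinearMap.sum_apply, LinearMap.smulRight_apply,
    LinearMap.smul_apply, smul_eq_mul]
  rfl

theorem energyForm_self (k : Fin S.N) (u : H1Pair d) : B.energyForm k u u =
    S.aCell k u u + ∑ j, S.sCell k u (B.phi k j) ^ 2 := by
  simp only [energyForm_apply, sq]

theorem isPsd_energyForm (k : Fin S.N) : IsPsd (B.energyForm k) where
  symm u v := by
    rw [energyForm_apply, energyForm_apply, (S.isPsd_aCell k).symm u v]
    exact congrArg _ (Finset.sum_congr rfl fun j _ => mul_comm _ _)
  nonneg u := by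
    rw [energyForm_self]
    exact add_nonneg ((S.isPsd_aCell k).nonneg u) (Finset.sum_nonneg fun _ _ => sq_nonneg _)

theorem sum_energyForm (u v : H1Pair d) :
    ∑ k, B.energyForm k u v = S.aTotal u v + inner ℝ (B.coef u) (B.coef v) := by
  simp only [energyForm_apply, Finset.sum_add_distrib, S.aTotal_apply, ← S.sum_aCell]
  rw [PiLp.inner_apply, Fintype.sum_sigma]
  exact congrArg _ (Finset.sum_congr rfl fun k _ => Finset.sum_congr rfl fun j _ => mul_comm _ _)

theorem norm_coef_sq (v : H1Pair d) :
    ‖B.coef v‖ ^ 2 = ∑ k, ∑ j, S.sCell k v (B.phi k j) ^ 2 := by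
  rw [EuclideanSpace.norm_sq_eq, Fintype.sum_sigma]
  simp only [coef_apply, Real.norm_eq_abs, sq_abs]

theorem norm_coef_le (v : H1Pair d) : ‖B.coef v‖ ^ 2 ≤ ∑ k, S.sCell k v v := by
  rw [norm_coef_sq]
  exact Finset.sum_le_sum fun k _ => B.bessel k v

theorem sum_sCell_le (hΛ : 0 < B.Lam) {v : H1Pair d} (hv : v ∈ S.V) :
    ∑ k, S.sCell k v v ≤ ‖B.coef v‖ ^ 2 + B.Lam⁻¹ * S.aTotal v v := by
  rw [norm_coef_sq, S.aTotal_apply, ← S.sum_aCell, Finset.mul_sum, ← Finset.sum_add_distrib]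
  exact Finset.sum_le_sum fun k _ => B.spectral_estimate hΛ k hv

theorem sCell_le_energyForm (hΛ : 0 < B.Lam) (k : Fin S.N) {v : H1Pair d} (hv : v ∈ S.V) :
    S.sCell k v v ≤ (1 + B.Lam⁻¹) * B.energyForm k v v := by
  have h := B.spectral_estimate hΛ k hv
  have h0 : 0 ≤ ∑ j, S.sCell k v (B.phi k j) ^ 2 := Finset.sum_nonneg fun _ _ => sq_nonneg _
  have h1 := (S.isPsd_aCell k).nonneg v
  have h2 : 0 < B.Lam⁻¹ := inv_pos.2 hΛ
  rw [energyForm_self]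
  nlinarith

theorem energyForm_eq_zero {k : Fin S.N} {y : H1Pair d} (h : S.VanishesOn k y) :
    B.energyForm k y y = 0 := by
  rw [energyForm_self, h.a_eq_zero]
  simp only [h.s_eq_zero]
  simp

/-- The constant in the decay rate. -/
def _root_.decayConst (Nv : ℕ) (Λ : ℝ) : ℝ :=
  max 2 (√(1 + (Nv : ℝ) / 4)) * (1 + Λ ^ (-(1 / 2) : ℝ))

theorem _root_.decayConst_pos (Nv : ℕ) {Λ : ℝ} (hΛ : 0 < Λ) : 0 < decayConst Nv Λ :=
  mul_pos (lt_of_lt_of_le two_pos (le_max_left _ _))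
    (add_pos one_pos (Real.rpow_pos_of_pos hΛ _))

theorem _root_.le_decayConst_sq (Nv : ℕ) {Λ : ℝ} (hΛ : 0 < Λ) :
    (1 + (Nv : ℝ) / 4) * (1 + Λ⁻¹) ≤ decayConst Nv Λ ^ 2 := by
  have h0 : 0 < Λ ^ (-(1 / 2) : ℝ) := Real.rpow_pos_of_pos hΛ _
  have h1 : (Λ ^ (-(1 / 2) : ℝ)) ^ 2 = Λ⁻¹ := by
    rw [← Real.rpow_natCast, ← Real.rpow_mul hΛ.le, ← Real.rpow_neg_one]
    norm_num
  rw [decayConst, mul_pow]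
  refine mul_le_mul ?_ ?_ (by positivity) (by positivity)
  · refine (Real.sq_sqrt (by positivity : 0 ≤ 1 + (Nv : ℝ) / 4)).symm.le.trans ?_
    exact pow_le_pow_left₀ (Real.sqrt_nonneg _) (le_max_right _ _) 2
  · rw [← h1]; nlinarith

theorem cut_out_bound (hΛ : 0 < B.Lam) {k : Fin S.N} {v y : H1Pair d} (hv : v ∈ S.V)
    (hs : S.sCell k y y ≤ S.sCell k v v)
    (ha : ∀ t : ℝ, 0 < t →
      -(t / 2 * S.aCell k v v + 1 / (2 * t) * ((Nv : ℝ) / 4 * S.sCell k v v)) ≤ S.aCell k v y) :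
    -(decayConst Nv B.Lam * B.energyForm k v v) ≤ B.energyForm k v y := by
  have hQ : 0 < decayConst Nv B.Lam := decayConst_pos Nv hΛ
  have h := weighted_young_bound hQ (by positivity) (le_decayConst_sq Nv hΛ) (ha _ hQ)
    ((B.bessel k y).trans hs) (B.sCell_le_energyForm hΛ k hv) ((B.isPsd_energyForm k).nonneg v)
    (B.energyForm_self k v)
  rw [B.energyForm_apply k v y]
  exact h

theorem cut_in_bound (hΛ : 0 < B.Lam) {k : Fin S.N} {v y : H1Pair d} (hv : v ∈ S.V)
    (hs : S.sCell k y y ≤ S.sCell k v v)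
    (ha : S.aCell k y y ≤ 2 * S.aCell k v v + 2 * (Nv * S.sCell k v v)) :
    B.energyForm k y y ≤ (2 * Nv + 3) * (1 + B.Lam⁻¹) * B.energyForm k v v := by
  have e1 := (B.bessel k y).trans hs
  have e2 := B.sCell_le_energyForm hΛ k hv
  have hb0 := (B.isPsd_energyForm k).nonneg v
  have hi : 0 < B.Lam⁻¹ := inv_pos.2 hΛ
  have e0 : S.aCell k v v ≤ B.energyForm k v v := by
    rw [energyForm_self]
    linarith [Finset.sum_nonneg fun j (_ : j ∈ Finset.univ) =>
      sq_nonneg (S.sCell k v (B.phi k j))]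
  rw [energyForm_self B k y]
  generalize ∑ j, S.sCell k y (B.phi k j) ^ 2 = cyy at *
  generalize B.energyForm k v v = bvv at *
  generalize S.sCell k v v = svv at *
  generalize S.aCell k v v = avv at *
  generalize S.aCell k y y = ayy at *
  generalize B.Lam⁻¹ = Li at *
  -- Total: 2 from the energy of v, 2 Nv from the gradient of the cutoff and 1 from the
  -- coefficients, each with the factor 1 + Λ⁻¹.
  have e3 : avv ≤ (1 + Li) * bvv := by nlinarith
  have e4 := mul_le_mul_of_nonneg_left e2 (by positivity : (0 : ℝ) ≤ 2 * Nv + 1)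
  linarith

theorem patchSystem (hρ : 0 < ρ) (hΛ : 0 < B.Lam) :
    PatchSystem B.energyForm S.V S.patchIdx S.VPatch (decayConst Nv B.Lam)
      ((2 * Nv + 3) * (1 + B.Lam⁻¹)) where
  psd := B.isPsd_energyForm
  Q_pos := decayConst_pos Nv hΛ
  C_pos := by positivity
  self_mem i := rfl
  mono i n := S.patchIdx_mono hρ i n
  Vp_le := S.VPatch_le
  Vp_supp i n v hv k hk := B.energyForm_eq_zero (S.vanishesOn_of_mem_VPatch hk hv)
  cut_out i n v hv := by
    obtain ⟨y, hy, h1, h2, h3, h4⟩ := S.exists_cut_out i n hv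
    exact ⟨y, hy, fun k hk => B.energyForm_eq_zero (h1 k hk),
      fun k hk => B.energyForm_eq_zero (h2 k hk), fun k => B.cut_out_bound hΛ hv (h3 k) (h4 k)⟩
  cut_in i n v hv := by
    obtain ⟨y, hy, h1, h2, h3⟩ := S.exists_cut_in i n hv
    exact ⟨y, hy, fun k hk => B.energyForm_eq_zero (h1 k hk),
      fun k => B.cut_in_bound hΛ hv (h2 k) (h3 k)⟩

end AuxBasis

end ElasticSetup

/-! ### Load, coefficients, localization error and the constant D_* -/

namespace ElasticSetup

variable {d : ℕ} {ρ : ℝ} {Nv : ℕ} (S : ElasticSetup d ρ Nv)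

theorem sLoc_congr (k : Fin S.N) {g g' h h' : Rd d → Rd d} (hg : g =ᵐ[volume] g')
    (hh : h =ᵐ[volume] h') : S.sLoc k g h = S.sLoc k g' h' := by
  refine integral_congr_ae (ae_restrict_of_ae ?_)
  filter_upwards [hg, hh] with x h1 h2
  rw [h1, h2]

theorem exists_test_function {g : Rd d → ℝ} (hg : ContDiff ℝ ∞ g) (hgc : HasCompactSupport g)
    (hgd : tsupport g ⊆ S.dom) (l : Fin d) : ∃ v ∈ S.V,
      (v.1 : Rd d → Rd d) =ᵐ[volume] fun x => g x • EuclideanSpace.single l 1 := by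
  set φ : Rd d → Rd d := fun x => g x • EuclideanSpace.single l (1 : ℝ) with hφ
  have hφd : ContDiff ℝ ∞ φ := hg.smul contDiff_const
  have hφc : HasCompactSupport φ := HasCompactSupport.intro hgc fun x hx => by
    simp [hφ, image_eq_zero_of_notMem_tsupport hx]
  have hφs : tsupport φ ⊆ S.dom := (closure_mono fun x hx => by
    intro h
    exact hx (by simp [hφ, h])).trans hgd
  have m1 : MemLp φ 2 volume := hφd.continuous.memLp_of_hasCompactSupport hφc
  have m2 : MemLp (fderiv ℝ φ) 2 volume :=
    (hφd.continuous_fderiv (by simp)).memLp_of_hasCompactSupport (hφc.fderiv ℝ)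
  exact ⟨(m1.toLp _, m2.toLp _), Submodule.le_topologicalClosure _
    (Submodule.subset_span ⟨φ, hφd, hφc, hφs, m1.coeFn_toLp, m2.coeFn_toLp⟩), m1.coeFn_toLp⟩

/-- An `L²` function that is `s`-orthogonal to all of `V` vanishes on the domain. -/
theorem ae_eq_zero_of_orthogonal {w : H1Pair d}
    (h : ∀ v ∈ S.V, ∫ x in S.dom, S.kappa x * inner ℝ (v.1 x) (w.1 x) = 0) :
    ∀ᵐ x ∂(volume : Measure (Rd d)), x ∈ S.dom → w.1 x = 0 := by
  have hl : ∀ l : Fin d, ∀ᵐ x ∂(volume : Measure (Rd d)), x ∈ S.dom →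
      S.kappa x * w.1 x l = 0 := by
    intro l
    refine S.dom_open.ae_eq_zero_of_integral_contDiff_smul_eq_zero ?_ ?_
    · refine IntegrableOn.locallyIntegrableOn ?_
      obtain ⟨M, hM0, hM⟩ := S.kappa_bounded
      have hfin : IsFiniteMeasure (volume.restrict S.dom) :=
        ⟨by simpa using S.dom_bounded.measure_lt_top⟩
      have hw : Integrable (fun x => M * ‖w.1 x‖) (volume.restrict S.dom) :=
        (((Lp.memLp w.1).restrict S.dom).integrable (by norm_num)).norm.const_mul M
      refine hw.mono' ?_ ?_
      · exact S.kappa_measurable.aestronglyMeasurable.mul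
          ((by fun_prop : Continuous fun y : Rd d => y l).comp_aestronglyMeasurable
            (Lp.aestronglyMeasurable w.1).restrict)
      · filter_upwards [hM, S.kappa_pos] with x h1 h2
        rw [norm_mul, Real.norm_of_nonneg h2.le]
        exact mul_le_mul h1 (PiLp.norm_apply_le _ _) (norm_nonneg _) hM0
    · intro g hg hgc hgd
      obtain ⟨v, hv, hvg⟩ := S.exists_test_function hg hgc hgd l
      rw [← h v hv, ← setIntegral_eq_integral_of_forall_compl_eq_zero (s := S.dom)]
      · refine integral_congr_ae (ae_restrict_of_ae ?_)
        filter_upwards [hvg] with x hx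
        rw [hx, real_inner_smul_left, EuclideanSpace.inner_single_left]
        simp; ring
      · intro x hx
        rw [image_eq_zero_of_notMem_tsupport fun hx' => hx (hgd hx'), zero_smul]
  filter_upwards [ae_all_iff.2 hl, (ae_restrict_iff' S.dom_open.measurableSet).1 S.kappa_pos]
    with x h1 h2 hd
  ext l
  exact (mul_eq_zero.1 (h1 l hd)).resolve_left (h2 hd).ne'

theorem integrable_load {f : Rd d → Rd d} (hf : MemLp f 2 (volume.restrict S.dom))
    (v : H1Pair d) :
    Integrable (fun x => (inner ℝ (f x) (v.1 x) : ℝ)) (volume.restrict S.dom) :=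
  (hf.norm.integrable_mul ((Lp.memLp v.1).restrict S.dom).norm).mono'
    (hf.aestronglyMeasurable.inner (Lp.aestronglyMeasurable v.1).restrict)
    (Filter.Eventually.of_forall fun _ => norm_inner_le_norm _ _)

/-- The load as a linear functional. -/
theorem exists_load {f : Rd d → Rd d} (hf : MemLp f 2 (volume.restrict S.dom)) :
    ∃ l : H1Pair d →ₗ[ℝ] ℝ, ∀ v, l v = S.load f v :=
  ⟨{ toFun := S.load f
     map_add' := fun u v => by
      simp only [load]
      rw [← integral_add (S.integrable_load hf u) (S.integrable_load hf v)]
      refine integral_congr_ae (ae_restrict_of_ae ?_)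
      filter_upwards [Lp.coeFn_add u.1 v.1] with x hx
      rw [Prod.fst_add, hx, Pi.add_apply, inner_add_right]
     map_smul' := fun c u => by
      simp only [load, RingHom.id_apply, smul_eq_mul]
      rw [← integral_const_mul]
      refine integral_congr_ae (ae_restrict_of_ae ?_)
      filter_upwards [Lp.coeFn_smul c u.1] with x hx
      rw [Prod.smul_fst, hx, Pi.smul_apply, real_inner_smul_right] }, fun _ => rfl⟩

theorem load_sq_le {f : Rd d → Rd d} (hf : MemLp f 2 (volume.restrict S.dom))
    (hfk : IntegrableOn (fun x => ‖f x‖ ^ 2 / S.kappa x) S.dom) (v : H1Pair d) :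
    S.load f v ^ 2 ≤ S.loadNorm f ^ 2 * ∑ k, S.sCell k v v := by
  have hs : ∑ k, S.sCell k v v = ∫ x in S.dom, S.kappa x * inner ℝ (v.1 x) (v.1 x) :=
    S.sum_setIntegral_core (S.integrableOn_weighted subset_rfl v v)
  have hF : S.loadNorm f ^ 2 = ∫ x in S.dom, ‖f x‖ ^ 2 / S.kappa x := by
    rw [loadNorm, Real.sq_sqrt]
    refine integral_nonneg_of_ae ?_
    filter_upwards [S.kappa_pos] with x hx
    exact div_nonneg (sq_nonneg _) hx.le
  have i1 := S.integrable_load hf v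
  have i2 := S.integrableOn_weighted subset_rfl v v
  -- This is the integral of |t f - κ̃ v|² / κ̃; the nonpositive discriminant is the weighted
  -- Cauchy–Schwarz inequality.
  have hq : ∀ t : ℝ, 0 ≤ S.loadNorm f ^ 2 * (t * t) + (-2 * S.load f v) * t +
      ∑ k, S.sCell k v v := by
    intro t
    have e : S.loadNorm f ^ 2 * (t * t) + (-2 * S.load f v) * t + ∑ k, S.sCell k v v =
        ∫ x in S.dom, (t * t * (‖f x‖ ^ 2 / S.kappa x) + (-2 * t) * inner ℝ (f x) (v.1 x) +
          S.kappa x * inner ℝ (v.1 x) (v.1 x)) := by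
      have i3 := (hfk.const_mul (t * t)).add (i1.const_mul (-2 * t))
      have e1 := integral_add i3 i2
      have e2 := integral_add (hfk.const_mul (t * t)) (i1.const_mul (-2 * t))
      simp only [Pi.add_apply] at e1
      rw [e1, e2, integral_const_mul, integral_const_mul, hs, hF, load]
      ring
    rw [e]
    refine integral_nonneg_of_ae ?_
    filter_upwards [S.kappa_pos] with x hx
    have h1 := real_inner_self_nonneg (x := t • f x - S.kappa x • v.1 x)
    rw [real_inner_self_eq_norm_sq, norm_sub_sq_real, norm_smul, norm_smul, mul_pow, mul_pow,
      real_inner_smul_left, real_inner_smul_right, Real.norm_eq_abs, Real.norm_eq_abs, sq_abs,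
      sq_abs] at h1
    have h2 : t * t * (‖f x‖ ^ 2 / S.kappa x) + (-2 * t) * inner ℝ (f x) (v.1 x) +
          S.kappa x * inner ℝ (v.1 x) (v.1 x) =
        (t ^ 2 * ‖f x‖ ^ 2 - 2 * (t * (S.kappa x * inner ℝ (f x) (v.1 x))) +
          S.kappa x ^ 2 * ‖v.1 x‖ ^ 2) / S.kappa x := by
      rw [real_inner_self_eq_norm_sq]
      field_simp
      ring
    rw [Pi.zero_apply, h2]
    exact div_nonneg h1 hx.le
  have hd := discrim_le_zero hq
  rw [discrim] at hd
  nlinarith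

namespace AuxBasis

variable {S} (B : S.AuxBasis)

/-- The linear combinations of a family of functions indexed like the eigenfunctions. -/
def combine (ψ : (i : Fin S.N) → Fin (B.J i) → H1Pair d) :
    EuclideanSpace ℝ (Σ i, Fin (B.J i)) →ₗ[ℝ] H1Pair d :=
  (Fintype.linearCombination ℝ fun q : Σ i, Fin (B.J i) => ψ q.1 q.2) ∘ₗ
    (WithLp.linearEquiv 2 ℝ ((Σ i, Fin (B.J i)) → ℝ)).toLinearMap

theorem combine_apply (ψ : (i : Fin S.N) → Fin (B.J i) → H1Pair d)
    (c : EuclideanSpace ℝ (Σ i, Fin (B.J i))) :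
    B.combine ψ c = ∑ q : Σ i, Fin (B.J i), c q • ψ q.1 q.2 := rfl

theorem combine_apply' (ψ : (i : Fin S.N) → Fin (B.J i) → H1Pair d)
    (c : EuclideanSpace ℝ (Σ i, Fin (B.J i))) :
    B.combine ψ c = ∑ i, ∑ j, c ⟨i, j⟩ • ψ i j := by
  rw [combine_apply, Fintype.sum_sigma]

theorem mem_spanAll {ψ : (i : Fin S.N) → Fin (B.J i) → H1Pair d} {v : H1Pair d} :
    v ∈ B.spanAll ψ ↔ ∃ c, B.combine ψ c = v := by
  have h : {p | ∃ i j, p = ψ i j} = Set.range fun q : Σ i, Fin (B.J i) => ψ q.1 q.2 := by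
    ext p
    constructor
    · rintro ⟨i, j, rfl⟩; exact ⟨⟨i, j⟩, rfl⟩
    · rintro ⟨⟨i, j⟩, rfl⟩; exact ⟨i, j, rfl⟩
  rw [spanAll, h, Submodule.mem_span_range_iff_exists_fun]
  constructor
  · rintro ⟨c, hc⟩; exact ⟨WithLp.toLp 2 c, hc⟩
  · rintro ⟨c, hc⟩; exact ⟨c, hc⟩

/-- The function `∑ c_j^i φ_j^i`. -/
def auxFn (c : EuclideanSpace ℝ (Σ i, Fin (B.J i))) : Rd d → Rd d :=
  ∑ i, ∑ j, c ⟨i, j⟩ • B.fn i j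

theorem coeFn_combine_phi (c : EuclideanSpace ℝ (Σ i, Fin (B.J i))) :
    ((B.combine B.phi c).1 : Rd d → Rd d) =ᵐ[volume] B.auxFn c := by
  have h1 : (B.combine B.phi c).1 = ∑ i, ∑ j, c ⟨i, j⟩ • (B.phi i j).1 := by
    rw [combine_apply']
    simp only [Prod.fst_sum, Prod.smul_fst]
  have h2 : ∀ i j, ∀ᵐ x ∂(volume : Measure (Rd d)),
      (c ⟨i, j⟩ • (B.phi i j).1 : Lp (Rd d) 2 volume) x = c ⟨i, j⟩ • B.fn i j x := fun i j =>
    Lp.coeFn_smul _ _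
  have h3 : ∀ i, ∀ᵐ x ∂(volume : Measure (Rd d)),
      (∑ j, c ⟨i, j⟩ • (B.phi i j).1 : Lp (Rd d) 2 volume) x =
        ∑ j, (c ⟨i, j⟩ • (B.phi i j).1 : Lp (Rd d) 2 volume) x := by
    intro i
    filter_upwards [Lp.coeFn_finsetSum Finset.univ fun j => c ⟨i, j⟩ • (B.phi i j).1] with x hx
    rw [hx, Finset.sum_apply]
  rw [h1]
  filter_upwards [ae_all_iff.2 fun i => ae_all_iff.2 (h2 i), ae_all_iff.2 h3,
    Lp.coeFn_finsetSum Finset.univ fun i => ∑ j, c ⟨i, j⟩ • (B.phi i j).1] with x h2 h3 h4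
  rw [h4]
  simp only [h3, h2, auxFn, Finset.sum_apply, Pi.smul_apply]

theorem proj_eq (v : H1Pair d) : B.proj v = B.auxFn (B.coef v) := by
  simp only [proj, auxFn, coef_apply]
  refine Finset.sum_congr rfl fun i _ => Finset.sum_congr rfl fun j _ => ?_
  rw [fn, S.sLoc_eq i v (B.phi_mem_zeroOff i j)]

theorem fn_eq (i : Fin S.N) (j : Fin (B.J i)) :
    B.fn i j = B.auxFn (EuclideanSpace.single ⟨i, j⟩ 1) := by
  classical
  rw [auxFn, Finset.sum_eq_single i, Finset.sum_eq_single j]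
  · simp
  · intro j' _ hj
    have : (⟨i, j'⟩ : Σ i, Fin (B.J i)) ≠ ⟨i, j⟩ := fun h => hj (by simpa using h)
    simp [this]
  · simp
  · intro i' _ hi
    refine Finset.sum_eq_zero fun j' _ => ?_
    have : (⟨i', j'⟩ : Σ i, Fin (B.J i)) ≠ ⟨i, j⟩ := fun h => hi (congrArg Sigma.fst h)
    simp [this]
  · simp

theorem auxFn_sub (c c' : EuclideanSpace ℝ (Σ i, Fin (B.J i))) :
    B.auxFn (c - c') = B.auxFn c - B.auxFn c' := by
  simp only [auxFn, PiLp.sub_apply, sub_smul, Finset.sum_sub_distrib]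

theorem combine_phi_mem_zeroOff (c : EuclideanSpace ℝ (Σ i, Fin (B.J i))) :
    B.combine B.phi c ∈ zeroOff S.dom := by
  rw [combine_apply]
  exact Submodule.sum_mem _ fun q _ => Submodule.smul_mem _ _ (B.phi_mem_zeroOff q.1 q.2)

theorem coef_combine_phi (c : EuclideanSpace ℝ (Σ i, Fin (B.J i))) :
    B.coef (B.combine B.phi c) = c := by
  rw [combine_apply, map_sum]
  ext q
  simp only [map_smul, B.coef_phi]
  simp [Finset.sum_apply, Pi.single_apply]

theorem sCell_combine_phi (k : Fin S.N) (v : H1Pair d)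
    (c : EuclideanSpace ℝ (Σ i, Fin (B.J i))) :
    S.sCell k v (B.combine B.phi c) = ∑ j, c ⟨k, j⟩ * S.sCell k v (B.phi k j) := by
  rw [combine_apply', map_sum, Finset.sum_eq_single k]
  · simp only [map_sum, map_smul, smul_eq_mul]
  · intro i _ hi
    simp only [map_sum, map_smul]
    refine Finset.sum_eq_zero fun j _ => ?_
    rw [(S.isPsd_sCell k).symm, B.sCell_phi_of_ne hi.symm, smul_zero]
  · simp

theorem sum_sCell_combine_phi (v : H1Pair d) (c : EuclideanSpace ℝ (Σ i, Fin (B.J i))) :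
    ∑ k, S.sCell k v (B.combine B.phi c) = inner ℝ c (B.coef v) := by
  simp only [sCell_combine_phi]
  rw [PiLp.inner_apply, Fintype.sum_sigma]
  exact Finset.sum_congr rfl fun k _ => Finset.sum_congr rfl fun j _ => mul_comm _ _

theorem s_auxFn (c : EuclideanSpace ℝ (Σ i, Fin (B.J i))) :
    S.s (B.auxFn c) (B.auxFn c) = ‖c‖ ^ 2 := by
  have h := B.coeFn_combine_phi c
  rw [s, ← real_inner_self_eq_norm_sq]
  nth_rewrite 4 [← B.coef_combine_phi c]
  rw [← sum_sCell_combine_phi]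
  refine Finset.sum_congr rfl fun k _ => ?_
  rw [← S.sLoc_eq k _ (B.combine_phi_mem_zeroOff c)]
  exact S.sLoc_congr k h.symm h.symm

/-- The eigenfunctions of all cells together are s-orthonormal, so `auxFn` is an isometry and the
relaxed energy is a quadratic functional with form b, a linear term and the constant ‖φ_j^i‖_s² = 1.
-/
theorem energy_eq (i : Fin S.N) (j : Fin (B.J i)) (ψ : H1Pair d) :
    B.energy i j ψ = (∑ k, B.energyForm k) ψ ψ - 2 * B.coef ψ ⟨i, j⟩ + 1 := by
  rw [energy, proj_eq, fn_eq, ← auxFn_sub, s_auxFn, LinearMap.sum_apply, LinearMap.sum_apply,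
    sum_energyForm, norm_sub_sq_real, EuclideanSpace.inner_single_right,
    real_inner_self_eq_norm_sq, S.aTotal_apply]
  simp
  ring

/-- The variational equation of the relaxed basis functions. -/
theorem IsRelaxedBasis.eq {X : Fin S.N → Submodule ℝ (H1Pair d)}
    {ψ : (i : Fin S.N) → Fin (B.J i) → H1Pair d} (h : B.IsRelaxedBasis X ψ) (i : Fin S.N)
    (j : Fin (B.J i)) {v : H1Pair d} (hv : v ∈ X i) :
    ∑ k, B.energyForm k (ψ i j) v = B.coef v ⟨i, j⟩ := by
  obtain ⟨h1, h2⟩ := h i j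
  have hp : IsPsd (∑ k, B.energyForm k) := IsPsd.sum fun k _ => B.isPsd_energyForm k
  have := hp.euler_lagrange (l := (S.sCell i).flip (B.phi i j)) h1 (fun y hy => ?_) hv
  · rw [LinearMap.sum_apply, LinearMap.sum_apply] at this
    exact this
  · have h3 : B.energy i j (ψ i j) ≤ B.energy i j y := h2 hy
    rw [energy_eq, energy_eq] at h3
    change _ - 2 * B.coef (ψ i j) ⟨i, j⟩ ≤ _ - 2 * B.coef y ⟨i, j⟩
    linarith

theorem combine_mem {V : Submodule ℝ (H1Pair d)} {ψ : (i : Fin S.N) → Fin (B.J i) → H1Pair d}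
    (h : ∀ i j, ψ i j ∈ V) (c : EuclideanSpace ℝ (Σ i, Fin (B.J i))) : B.combine ψ c ∈ V := by
  rw [combine_apply]
  exact Submodule.sum_mem _ fun q _ => Submodule.smul_mem _ _ (h q.1 q.2)

theorem relaxedSolver {ψ : (i : Fin S.N) → Fin (B.J i) → H1Pair d}
    (h : B.IsRelaxedBasis (fun _ => S.V) ψ) :
    RelaxedSolver S.aTotal S.V B.coef (B.combine ψ) where
  psd := S.isPsd_aTotal
  mem := B.combine_mem fun i j => (h i j).1
  eq c v hv := by
    rw [← sum_energyForm, combine_apply]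
    simp only [LinearMap.map_sum₂, LinearMap.map_smul₂]
    rw [Finset.sum_comm, PiLp.inner_apply]
    refine Finset.sum_congr rfl fun q _ => ?_
    rw [← Finset.smul_sum, h.eq B q.1 q.2 hv]
    exact mul_comm _ _

theorem localization_error (hρ : 0 < ρ) (hΛ : 0 < B.Lam) {m : ℕ}
    {ψms ψglo : (i : Fin S.N) → Fin (B.J i) → H1Pair d}
    (hms : B.IsRelaxedBasis (fun i => S.VPatch i m) ψms)
    (hglo : B.IsRelaxedBasis (fun _ => S.V) ψglo) (c : EuclideanSpace ℝ (Σ i, Fin (B.J i))) :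
    S.aTotal (B.combine ψglo c - B.combine ψms c) (B.combine ψglo c - B.combine ψms c) ≤
      (2 * Nv + 3) * (1 + B.Lam⁻¹) * ((2 / ρ) ^ d * ((m : ℝ) + 1) ^ d) *
        (2 * (1 + (2 * Nv + 3) * (1 + B.Lam⁻¹)) *
          (1 + (decayConst Nv B.Lam)⁻¹) ^ (1 - (m : ℤ))) * ‖c‖ ^ 2 := by
  have hcomb : ∀ (X : Fin S.N → Submodule ℝ (H1Pair d)) ψ, B.IsRelaxedBasis X ψ → ∀ i,
      ∀ v ∈ X i, ∑ k, B.energyForm k (∑ j, c ⟨i, j⟩ • ψ i j) v =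
        (∑ j, c ⟨i, j⟩ • (S.sCell i).flip (B.phi i j)) v := by
    intro X ψ h i v hv
    simp only [LinearMap.map_sum₂, LinearMap.map_smul₂]
    rw [Finset.sum_comm, LinearMap.sum_apply]
    refine Finset.sum_congr rfl fun j _ => ?_
    rw [← Finset.smul_sum, h.eq B i j hv]
    rfl
  have key := (B.patchSystem hρ hΛ).total_error m
    (n₀ := (2 / ρ) ^ d * ((m : ℝ) + 1) ^ d) (by positivity)
    (fun k => S.overlap_le hρ k m)
    -- All basis functions of one cell are treated as a single problem, so the number of
    -- eigenfunctions never enters.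
    (l := fun i => ∑ j, c ⟨i, j⟩ • (S.sCell i).flip (B.phi i j))
    (W := fun i => ∑ j, c ⟨i, j⟩ ^ 2) (fun i => Finset.sum_nonneg fun _ _ => sq_nonneg _)
    (fun i v => ?_)
    (x := fun i => ∑ j, c ⟨i, j⟩ • ψglo i j) (z := fun i => ∑ j, c ⟨i, j⟩ • ψms i j)
    (fun i => Submodule.sum_mem _ fun j _ => Submodule.smul_mem _ _ (hglo i j).1)
    (fun i => Submodule.sum_mem _ fun j _ => Submodule.smul_mem _ _ (hms i j).1)
    (hcomb _ _ hglo) (hcomb _ _ hms)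
  · rw [sum_energyForm, Finset.sum_sub_distrib, ← combine_apply', ← combine_apply'] at key
    have hc : ‖c‖ ^ 2 = ∑ i, ∑ j, c ⟨i, j⟩ ^ 2 := by
      rw [EuclideanSpace.norm_sq_eq, Fintype.sum_sigma]
      simp only [Real.norm_eq_abs, sq_abs]
    rw [hc]
    refine le_trans ?_ key
    -- The error is controlled in the form b; its coefficient part is dropped.
    exact le_add_of_nonneg_right real_inner_self_nonneg
  · have h1 : (∑ j, c ⟨i, j⟩ • (S.sCell i).flip (B.phi i j)) v =
        ∑ j, c ⟨i, j⟩ * S.sCell i v (B.phi i j) := by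
      rw [LinearMap.sum_apply]; rfl
    rw [h1]
    refine (Finset.sum_mul_sq_le_sq_mul_sq _ _ _).trans ?_
    refine mul_le_mul_of_nonneg_left ?_ (Finset.sum_nonneg fun _ _ => sq_nonneg _)
    rw [energyForm_self]
    exact le_add_of_nonneg_left ((S.isPsd_aCell i).nonneg v)

/-- The auxiliary function with coefficients c is s-orthogonal to all test functions, so it vanishes
on the domain because κ̃ > 0. This makes π map V onto the auxiliary space. -/
theorem eq_zero_of_orthogonal {c : EuclideanSpace ℝ (Σ i, Fin (B.J i))}
    (h : ∀ v ∈ S.V, inner ℝ c (B.coef v) = 0) : c = 0 := by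
  have h1 := S.ae_eq_zero_of_orthogonal (w := B.combine B.phi c) fun v hv => by
    rw [← h v hv, ← sum_sCell_combine_phi]
    exact (S.sum_setIntegral_core (S.integrableOn_weighted subset_rfl v _)).symm
  rw [← B.coef_combine_phi c]
  ext q
  rw [coef_apply, S.sCell_eq_zero]
  · rfl
  · exact h1.mono fun x hx hk => hx hk.2

theorem mem_auxSpace {w : Rd d → Rd d} : w ∈ B.auxSpace ↔ ∃ c, B.auxFn c = w := by
  constructor
  · intro hw
    let Φ : EuclideanSpace ℝ (Σ i, Fin (B.J i)) →ₗ[ℝ] (Rd d → Rd d) :=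
      { toFun := B.auxFn
        map_add' := fun c c' => by
          simp only [auxFn, PiLp.add_apply, add_smul, Finset.sum_add_distrib]
        map_smul' := fun r c => by
          simp only [auxFn, PiLp.smul_apply, smul_eq_mul, mul_smul, Finset.smul_sum,
            RingHom.id_apply] }
    have hle : B.auxSpace ≤ LinearMap.range Φ := by
      refine iSup_le fun i => Submodule.span_le.2 ?_
      rintro _ ⟨j, rfl⟩
      exact ⟨_, (B.fn_eq i j).symm⟩
    exact hle hw
  · rintro ⟨c, rfl⟩
    refine Submodule.sum_mem _ fun i _ => Submodule.sum_mem _ fun j _ =>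
      Submodule.smul_mem _ _ ?_
    exact Submodule.mem_iSup_of_mem i (Submodule.subset_span ⟨j, rfl⟩)

theorem auxFn_injective : Function.Injective B.auxFn := by
  intro c c' h
  have h0 : S.s (B.auxFn (c - c')) (B.auxFn (c - c')) = 0 := by
    rw [auxFn_sub, h, sub_self]
    simp [s, sLoc]
  rw [s_auxFn] at h0
  exact sub_eq_zero.1 (norm_eq_zero.1 (pow_eq_zero_iff two_ne_zero |>.1 h0))

/-- The solution operator is bounded from below in terms of the constant `D_*`. -/
theorem norm_le_stab {ψ : (i : Fin S.N) → Fin (B.J i) → H1Pair d}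
    (h : B.IsRelaxedBasis (fun _ => S.V) ψ) (c : EuclideanSpace ℝ (Σ i, Fin (B.J i))) :
    0 ≤ B.stab ∧ ‖c‖ ≤ (1 + B.stab) * ‖B.coef (B.combine ψ c)‖ := by
  have hR := B.relaxedSolver h
  -- Without an admissible constant the infimum would be the default value 0, and no bound could be
  -- drawn from it.
  have hne : {D : ℝ | 0 ≤ D ∧ ∀ w ∈ B.auxSpace, ∃ v ∈ S.V, B.proj v = w ∧
      S.a v v ≤ D * S.s w w}.Nonempty := by
    obtain ⟨D, hD, hDw⟩ := hR.exists_stable fun c hc => B.eq_zero_of_orthogonal hc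
    refine ⟨D, hD, fun w hw => ?_⟩
    obtain ⟨c, rfl⟩ := B.mem_auxSpace.1 hw
    obtain ⟨v, hv, hvc, hva⟩ := hDw c
    refine ⟨v, hv, by rw [proj_eq, hvc], ?_⟩
    rw [s_auxFn, ← S.aTotal_apply]
    exact hva
  have h0 : 0 ≤ B.stab := Real.sInf_nonneg fun D hD => hD.1
  refine ⟨h0, ?_⟩
  have hall : ∀ D ∈ {D : ℝ | 0 ≤ D ∧ ∀ w ∈ B.auxSpace, ∃ v ∈ S.V, B.proj v = w ∧
      S.a v v ≤ D * S.s w w}, ‖c‖ ≤ (1 + D) * ‖B.coef (B.combine ψ c)‖ := by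
    rintro D ⟨hD, hDw⟩
    obtain ⟨v, hv, hvw, hva⟩ := hDw (B.auxFn c) (B.mem_auxSpace.2 ⟨c, rfl⟩)
    rw [proj_eq] at hvw
    rw [s_auxFn, ← S.aTotal_apply] at hva
    exact hR.norm_le_of_stable hD hv (B.auxFn_injective hvw) hva
  -- The infimum need not be attained, so the bound is passed to it by solving for D; this needs
  -- division by ‖T c‖, and if that is zero, any admissible D shows c = 0.
  rcases (norm_nonneg (B.coef (B.combine ψ c))).eq_or_lt with hP | hP
  · obtain ⟨D, hD⟩ := hne
    have := hall D hD
    rw [← hP, mul_zero] at this ⊢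
    exact this
  · have : ‖c‖ / ‖B.coef (B.combine ψ c)‖ - 1 ≤ B.stab := by
      refine le_csInf hne fun D hD => ?_
      rw [sub_le_iff_le_add, div_le_iff₀ hP, add_comm]
      exact hall D hD
    rw [sub_le_iff_le_add, div_le_iff₀ hP, add_comm] at this
    exact this

end AuxBasis

end ElasticSetup

/-! ### The error of the localized multiscale method -/

namespace ElasticSetup

variable {d : ℕ} {ρ : ℝ} {Nv : ℕ} {S : ElasticSetup d ρ Nv} (B : S.AuxBasis)

namespace AuxBasis

theorem load_sq_le_coef (hΛ : 0 < B.Lam) {f : Rd d → Rd d}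
    (hf : MemLp f 2 (volume.restrict S.dom))
    (hfk : IntegrableOn (fun x => ‖f x‖ ^ 2 / S.kappa x) S.dom) {v : H1Pair d} (hv : v ∈ S.V) :
    S.load f v ^ 2 ≤ S.loadNorm f ^ 2 * (‖B.coef v‖ ^ 2 + B.Lam⁻¹ * S.aTotal v v) :=
  (S.load_sq_le hf hfk v).trans
    (mul_le_mul_of_nonneg_left (B.sum_sCell_le hΛ hv) (sq_nonneg _))

theorem norm_coef_le_sNorm (v : H1Pair d) : ‖B.coef v‖ ≤ S.sNorm v.1 := by
  refine (sq_le_sq₀ (norm_nonneg _) (Real.sqrt_nonneg _)).1 ?_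
  change _ ≤ S.sNorm v.1 ^ 2
  rw [← S.sum_sCell]
  exact B.norm_coef_le v

/-- The global multiscale solution is close, in the energy norm, to one whose coefficients are
controlled by the `s`-norm of the global multiscale solution. -/
theorem exists_controlled_coef (hΛ : 0 < B.Lam) {f : Rd d → Rd d}
    (hf : MemLp f 2 (volume.restrict S.dom))
    (hfk : IntegrableOn (fun x => ‖f x‖ ^ 2 / S.kappa x) S.dom)
    {ψ : (i : Fin S.N) → Fin (B.J i) → H1Pair d} (hψ : B.IsRelaxedBasis (fun _ => S.V) ψ)
    {w : EuclideanSpace ℝ (Σ i, Fin (B.J i))}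
    (hw : S.IsGalerkin f (B.spanAll ψ) (B.combine ψ w)) {D : ℝ}
    (hD : D = B.stab ∨ D = B.Lam) :
    ∃ g, ‖g‖ ^ 2 ≤ (1 + B.Lam) * (1 + D) * S.sNorm (B.combine ψ w).1 ^ 2 ∧
      S.aTotal (B.combine ψ (w - g)) (B.combine ψ (w - g)) ≤
        2 * B.Lam⁻¹ * S.loadNorm f ^ 2 := by
  obtain ⟨l, hl⟩ := S.exists_load hf
  have hR := B.relaxedSolver hψ
  have hU := B.norm_coef_le_sNorm (B.combine ψ w)
  obtain ⟨hst, hwst⟩ := B.norm_le_stab hψ w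
  have sq_le : ∀ {x y : ℝ}, 0 ≤ x → x ≤ B.Lam → x ≤ D → 0 ≤ y →
      y ≤ (1 + x) * ‖B.coef (B.combine ψ w)‖ →
      y ^ 2 ≤ (1 + B.Lam) * (1 + D) * S.sNorm (B.combine ψ w).1 ^ 2 := by
    intro x y hx hxΛ hxD hy0 hy
    calc y ^ 2 ≤ ((1 + x) * S.sNorm (B.combine ψ w).1) ^ 2 :=
          pow_le_pow_left₀ hy0 (hy.trans (by gcongr)) 2
      _ = (1 + x) * (1 + x) * S.sNorm (B.combine ψ w).1 ^ 2 := by ring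
      _ ≤ _ := by gcongr
  -- The spectral splitting costs (1 + Λ)² and the stability argument (1 + D_*)². Choosing the
  -- smaller of Λ and D bounds either by (1 + Λ)(1 + D); its first factor is part of E. In the
  -- second case g = w and there is no low part.
  by_cases h : B.Lam ≤ D
  · obtain ⟨g, hg, hga⟩ := hR.exists_low_part (l := l) (F := S.loadNorm f) hΛ
      (fun v hv => by rw [hl]; exact B.load_sq_le_coef hΛ hf hfk hv)
      (fun c => by rw [hl, S.aTotal_apply]; exact hw.2 _ (B.mem_spanAll.2 ⟨c, rfl⟩))
    exact ⟨g, sq_le hΛ.le le_rfl h (norm_nonneg _) hg, hga⟩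
  · have hDs : D = B.stab := hD.resolve_right fun h' => h h'.ge
    refine ⟨w, sq_le hst (hDs ▸ (not_le.1 h).le) hDs.ge (norm_nonneg _) hwst, ?_⟩
    rw [sub_self, map_zero, map_zero]
    positivity

/-- Collects the factors into E: one power of 1 + Λ⁻¹ comes from the overlap argument, one from the
local error, and 1 + Λ from the bound on c. -/
theorem localization_error_le (hρ : 0 < ρ) (hΛ : 0 < B.Lam) {m : ℕ}
    {ψms ψglo : (i : Fin S.N) → Fin (B.J i) → H1Pair d}
    (hms : B.IsRelaxedBasis (fun i => S.VPatch i m) ψms)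
    (hglo : B.IsRelaxedBasis (fun _ => S.V) ψglo) (c : EuclideanSpace ℝ (Σ i, Fin (B.J i)))
    {D U : ℝ} (hc : ‖c‖ ^ 2 ≤ (1 + B.Lam) * (1 + D) * U ^ 2) :
    S.aTotal (B.combine ψglo c - B.combine ψms c) (B.combine ψglo c - B.combine ψms c) ≤
      2 * (2 * Nv + 3) * (2 * Nv + 4) * (2 / ρ) ^ d * ((m : ℝ) + 1) ^ d * decayE Nv B.Lam m *
        (1 + D) * U ^ 2 := by
  have hi : 0 ≤ B.Lam⁻¹ := (inv_pos.2 hΛ).le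
  have hq : 0 ≤ (1 + (decayConst Nv B.Lam)⁻¹) ^ (1 - (m : ℤ)) :=
    zpow_nonneg (add_nonneg zero_le_one (inv_pos.2 (decayConst_pos Nv hΛ)).le) _
  have h1 : 1 + (2 * (Nv : ℝ) + 3) * (1 + B.Lam⁻¹) ≤ (2 * Nv + 4) * (1 + B.Lam⁻¹) := by
    linarith
  refine (B.localization_error hρ hΛ hms hglo c).trans ?_
  change _ ≤ 2 * (2 * Nv + 3) * (2 * Nv + 4) * (2 / ρ) ^ d * ((m : ℝ) + 1) ^ d *
    ((1 + B.Lam) * (1 + B.Lam⁻¹) ^ 2 * (1 + (decayConst Nv B.Lam)⁻¹) ^ (1 - (m : ℤ))) *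
        (1 + D) * U ^ 2
  calc _ ≤ (2 * Nv + 3) * (1 + B.Lam⁻¹) * ((2 / ρ) ^ d * ((m : ℝ) + 1) ^ d) *
        (2 * ((2 * Nv + 4) * (1 + B.Lam⁻¹)) *
          (1 + (decayConst Nv B.Lam)⁻¹) ^ (1 - (m : ℤ))) *
            ((1 + B.Lam) * (1 + D) * U ^ 2) := by gcongr
    _ = _ := by ring

theorem spanAll_le_V {m : ℕ} {ψ : (i : Fin S.N) → Fin (B.J i) → H1Pair d}
    (h : B.IsRelaxedBasis (fun i => S.VPatch i m) ψ) : B.spanAll ψ ≤ S.V := by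
  intro v hv
  obtain ⟨c, rfl⟩ := B.mem_spanAll.1 hv
  exact B.combine_mem (fun i j => S.VPatch_le i m (h i j).1) c

/-- The error of the localized multiscale method in terms of the constant `D`. -/
theorem aNorm_sub_le (hρ : 0 < ρ) (hΛ : 0 < B.Lam) {m : ℕ} {f : Rd d → Rd d}
    (hf : MemLp f 2 (volume.restrict S.dom))
    (hfk : IntegrableOn (fun x => ‖f x‖ ^ 2 / S.kappa x) S.dom)
    {ψms ψglo : (i : Fin S.N) → Fin (B.J i) → H1Pair d}
    (hms : B.IsRelaxedBasis (fun i => S.VPatch i m) ψms)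
    (hglo : B.IsRelaxedBasis (fun _ => S.V) ψglo) {u ums uglo : H1Pair d}
    (hu : S.IsGalerkin f S.V u) (hums : S.IsGalerkin f (B.spanAll ψms) ums)
    (huglo : S.IsGalerkin f (B.spanAll ψglo) uglo) {D : ℝ} (hD : D = B.stab ∨ D = B.Lam) :
    S.aNorm (u - ums) ≤ 3 * √B.Lam⁻¹ * S.loadNorm f +
      √(2 * (2 * Nv + 3) * (2 * Nv + 4) * (2 / ρ) ^ d) * √(((m : ℝ) + 1) ^ d) *
        √(decayE Nv B.Lam m) * √(1 + D) * S.sNorm uglo.1 := by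
  obtain ⟨w, rfl⟩ := B.mem_spanAll.1 huglo.1
  obtain ⟨g, hg, hga⟩ := B.exists_controlled_coef hΛ hf hfk hglo huglo hD
  obtain ⟨l, hl⟩ := S.exists_load hf
  have hi : 0 ≤ B.Lam⁻¹ := (inv_pos.2 hΛ).le
  have hF : 0 ≤ S.loadNorm f := Real.sqrt_nonneg _
  have hU : 0 ≤ S.sNorm (B.combine ψglo w).1 := Real.sqrt_nonneg _
  have hp := S.isPsd_aTotal
  have h1 := (B.relaxedSolver hglo).global_error (l := l) (F := S.loadNorm f) hΛ
    (fun v hv => by rw [hl]; exact B.load_sq_le_coef hΛ hf hfk hv) hu.1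
    (fun v hv => by rw [hl, S.aTotal_apply]; exact hu.2 v hv)
    (fun c => by rw [hl, S.aTotal_apply]; exact huglo.2 _ (B.mem_spanAll.2 ⟨c, rfl⟩))
  have h3 := B.localization_error_le hρ hΛ hms hglo g hg
  have hbest : S.aTotal (u - ums) (u - ums) ≤
      S.aTotal (u - B.combine ψms g) (u - B.combine ψms g) := by
    refine hp.best_approx ?_
    have hz : ums - B.combine ψms g ∈ B.spanAll ψms :=
      sub_mem hums.1 (B.mem_spanAll.2 ⟨g, rfl⟩)
    rw [LinearMap.map_sub₂, S.aTotal_apply, S.aTotal_apply, hums.2 _ hz,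
      hu.2 _ (B.spanAll_le_V hms hz), sub_self]
  rw [S.aNorm_eq]
  -- Three errors: of the global space, of discarding the low part of w, and of localizing the
  -- remaining combination. The first two contribute 1 + √2 ≤ 3 times the Λ^{-1/2} term.
  have e : u - B.combine ψms g = (u - B.combine ψglo w) +
      (B.combine ψglo (w - g) + (B.combine ψglo g - B.combine ψms g)) := by
    rw [map_sub]; abel
  refine (Real.sqrt_le_sqrt hbest).trans ?_
  rw [e]
  refine (hp.sqrt_add_le _ _).trans ?_
  have t1 := Real.sqrt_le_sqrt h1
  have t2 := (hp.sqrt_add_le (B.combine ψglo (w - g))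
    (B.combine ψglo g - B.combine ψms g)).trans
      (add_le_add (Real.sqrt_le_sqrt hga) (Real.sqrt_le_sqrt h3))
  have hE : 0 ≤ decayE Nv B.Lam m := mul_nonneg (by positivity)
    (zpow_nonneg (add_nonneg zero_le_one (inv_pos.2 (decayConst_pos Nv hΛ)).le) _)
  rw [Real.sqrt_mul hi, Real.sqrt_sq hF] at t1
  rw [Real.sqrt_mul (by positivity), Real.sqrt_mul zero_le_two, Real.sqrt_sq hF,
    Real.sqrt_mul' _ (sq_nonneg _), Real.sqrt_sq hU,
    Real.sqrt_mul (by positivity), Real.sqrt_mul (by positivity),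
    Real.sqrt_mul (by positivity)] at t2
  have h2 : √2 ≤ 2 := Real.sqrt_le_iff.2 ⟨zero_le_two, by norm_num⟩
  have h4 : √2 * √B.Lam⁻¹ * S.loadNorm f ≤ 2 * √B.Lam⁻¹ * S.loadNorm f := by gcongr
  linarith

end AuxBasis

end ElasticSetup

end

theorem theorem2 (d : ℕ) (hd : d = 2 ∨ d = 3) (ρ : ℝ) (hρ : 0 < ρ) (Nv : ℕ) :
    ∃ C : ℝ, 0 < C ∧ ∃ 𝒟 : ℝ → ℕ → ℝ, (∀ Λ m, 0 ≤ 𝒟 Λ m) ∧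
      ∀ (S : ElasticSetup d ρ Nv) (B : S.AuxBasis) (_ : 0 < B.Lam) (m : ℕ)
        (f : Rd d → Rd d) (_ : MemLp f 2 (volume.restrict S.dom))
        (_ : IntegrableOn (fun x => ‖f x‖ ^ 2 / S.kappa x) S.dom)
        (ψms ψglo : (i : Fin S.N) → Fin (B.J i) → H1Pair d)
        (_ : B.IsRelaxedBasis (fun i => S.VPatch i m) ψms)
        (_ : B.IsRelaxedBasis (fun _ => S.V) ψglo)
        (u ums uglo : H1Pair d)
        (_ : S.IsGalerkin f S.V u)
        (_ : S.IsGalerkin f (B.spanAll ψms) ums)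
        (_ : S.IsGalerkin f (B.spanAll ψglo) uglo),
        ∀ D ∈ ({B.stab, 𝒟 B.Lam m} : Set ℝ),
          S.aNorm (u - ums) ≤
            C * B.Lam ^ (-(1 / 2) : ℝ) * S.loadNorm f +
            C * ((m : ℝ) + 1) ^ ((d : ℝ) / 2) * (decayE Nv B.Lam m) ^ (1 / 2 : ℝ) *
              (1 + D) ^ (1 / 2 : ℝ) * S.sNorm uglo.1 := by
  -- The sum of the two constants dominates both. The function 𝒟 is Λ, independent of m; the
  -- absolute value only makes it nonnegative for all arguments.
  refine ⟨3 + √(2 * (2 * Nv + 3) * (2 * Nv + 4) * (2 / ρ) ^ d), by positivity,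
    fun Λ _ => |Λ|, fun Λ _ => abs_nonneg Λ, ?_⟩
  intro S B hΛ m f hf hfk ψms ψglo hms hglo u ums uglo hu hums huglo D hD
  have hD' : D = B.stab ∨ D = B.Lam := by
    rcases hD with h | h
    · exact Or.inl h
    · exact Or.inr ((Set.mem_singleton_iff.1 h).trans (abs_of_pos hΛ))
  have hF : 0 ≤ S.loadNorm f := Real.sqrt_nonneg _
  have hU : 0 ≤ S.sNorm uglo.1 := Real.sqrt_nonneg _
  have e1 : B.Lam ^ (-(1 / 2) : ℝ) = √B.Lam⁻¹ := by
    rw [Real.rpow_neg hΛ.le, ← Real.sqrt_eq_rpow, Real.sqrt_inv]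
  have e2 : ((m : ℝ) + 1) ^ ((d : ℝ) / 2) = √(((m : ℝ) + 1) ^ d) := by
    rw [Real.sqrt_eq_rpow, ← Real.rpow_natCast, ← Real.rpow_mul (by positivity)]
    ring_nf
  rw [e1, e2, ← Real.sqrt_eq_rpow, ← Real.sqrt_eq_rpow]
  refine (B.aNorm_sub_le hρ hΛ hf hfk hms hglo hu hums huglo hD').trans ?_
  gcongr
  · exact le_add_of_nonneg_right (Real.sqrt_nonneg _)
  · exact le_add_of_nonneg_left (by norm_num)
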